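/- **Setting.** Let $H_{\mathbf C}$ be the space of $f\in L^2(\mathbb R^3,\mathbb C^3)$ with $k\cdot f(k)=0$ for a.e. $k$; it is the complexification of the space $H$ of its real-valued elements, and $H^2$ is identified with it by $(q,p)\mapsto q+ip$. Let $\mathcal F_s(H_{\mathbf C})$ be the symmetric Fock space, $\Phi_S(V)=2^{-1/2}(a(V)+a^*(V))$ the Segal field of $V\in H^2$ (with $a^*(V)$ complex linear in $V$), $\mathbf N=\mathrm d\Gamma(I)$ the photon number operator, and $\mathcal H_{sp}=(\mathbb C^2)^{\otimes N}$, with $\sigma_m^{[\lambda]}$ the Pauli matrix $\sigma_m$ acting on the $\lambda$-th factor ($1\le\lambda\le N$, $1\le m\le 3$). Fix $\chi\in\mathcal S(\mathbb R)$, $x_1,\dots,x_N\in\mathbb R^3$, $\beta\in\mathbb R^3$, $h>0$, $t\in\mathbb R$. Put $JX(k)=\frac{k\times X(k)}{|k|}$, $\mathcal F(q,p)=(-p,q)$, $$B_{jx}(k)=\frac{i\chi(|k|)|k|^{1/2}}{(2\pi)^{3/2}}e^{-ik\cdot x}\frac{k\times e_j}{|k|},\qquad E_{jx}=JB_{jx},\qquad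 B_j(x)=h^{1/2}\Phi_S(B_{jx}),\qquad E_j(x)=h^{1/2}\Phi_S(E_{jx}).$$ The Hamiltonian on $\mathcal F_s(H_{\mathbf C})\otimes\mathcal H_{sp}$ is $$H(h)=H_{ph}\otimes I+h\sum_{\lambda=1}^N\sum_{m=1}^3(\beta_m+B_m(x_\lambda))\otimes\sigma_m^{[\lambda]},\qquad H_{ph}=h\,\mathrm d\Gamma(|k|).$$ The Wick symbol of an operator $A$ in $\mathcal F_s(H_{\mathbf C})$ is $X\mapsto\langle A\Psi_{X,h},\Psi_{X,h}\rangle$, $X=(a,b)\in H^2$, where $\Psi_{X,h}=e^{-|X|^2/4h}\sum_{n\ge0}\frac{(a+ib)^{\otimes n}}{(2h)^{n/2}\sqrt{n!}}$. Let $E_m(x,\cdot)$ be the Wick symbol of $E_m(x)$, and let $E_m^{pol}(x)$ be the operator $h^{1/2}\Phi_S(V)$, $V\in H^2$, whose Wick symbol is $X\mapsto-E_m(x,J\mathcal FX)$. Put $$E_m^{pol}(x,t,h)=e^{i\frac thH(h)}(E_m^{pol}(x)\otimes I)e^{-i\frac thH(h)},\qquad S_m^{[\lambda]}(t,h)=e^{i\frac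 thH(h)}(I\otimes\sigma_m^{[\lambda]})e^{-i\frac thH(h)},$$ $$N'(t,h)=\frac ih\,e^{i\frac thH(h)}\,[H(h),\mathbf N\otimes I]\,e^{-i\frac thH(h)},$$ where the commutator is first taken on its natural domain, and $N'(t,h)$ is then extended by continuity, for the graph norm of $H(h)$, to $D(H(h))$. **Statement.** These objects are well defined: $H(h)$ is self-adjoint with domain $D(H_{ph}\otimes I)$, it generates the unitary group $s\mapsto e^{isH(h)}$, the coherent states lie in the domains of the $E_m(x)$, and there is exactly one $V$ as in the definition of $E_m^{pol}(x)$, for all $x$ and $m$. The operator $N'(t,h)$ is defined on all of $D(H(h))$ and is bounded from $D(H(h))$, with the graph norm, to $\mathcal F_s(H_{\mathbf C})\otimes\mathcal H_{sp}$. On $D(H(h))$, where the right-hand sides are defined, one has $$N'(t,h)=-\sum_{\lambda=1}^N\sum_{m=1}^3e^{i\frac thH(h)}\bigl(E_m^{pol}(x_\lambda)\otimes\sigma_m^{[\lambda]}\bigr)e^{-i\frac thH(h)}$$ and $$N'(t,h)=-\sum_{\lambda=1}^N\sum_{m=1}^3E_m^{pol}(x_\lambda,t,h)\circ S_m^{[\lambda]}(t,h).$$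 -/

import Mathlib

open MeasureTheory Filter Topology

noncomputable section

namespace NMR

/-! ## One-photon space -/

/-- Momentum space `ℝ³`. -/
abbrev R3 : Type := EuclideanSpace ℝ (Fin 3)

/-- Polarization vectors, `ℂ³`. -/
abbrev C3 : Type := EuclideanSpace ℂ (Fin 3)

/-- The complexified one-photon space: square-integrable `f : ℝ³ → ℂ³` with `k · f(k) = 0` a.e.
The phase space `H²`, `H` the real-valued elements, is identified with it through
`(q, p) ↦ q + i p`; its real scalar product is the real part of the hermitian one. -/
def photon : Submodule ℂ (Lp C3 2 (volume : Measure R3)) where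
  carrier := {f | ∀ᵐ k, ∑ j, (k j : ℂ) * f k j = 0}
  zero_mem' := by
    change ∀ᵐ k, _
    filter_upwards [Lp.coeFn_zero C3 2 (volume : Measure R3)] with k hk
    simp only [hk, Pi.zero_apply, PiLp.zero_apply, mul_zero, Finset.sum_const_zero]
  add_mem' := by
    intro f g hf hg
    change ∀ᵐ k, _ at hf hg ⊢
    filter_upwards [hf, hg, Lp.coeFn_add f g] with k h1 h2 h3
    simp only [h3, Pi.add_apply, PiLp.add_apply, mul_add, Finset.sum_add_distrib, h1, h2, add_zero]
  smul_mem' := by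
    intro c f hf
    change ∀ᵐ k, _ at hf ⊢
    filter_upwards [hf, Lp.coeFn_smul c f] with k h1 h3
    simp only [h3, Pi.smul_apply, PiLp.smul_apply, smul_eq_mul, mul_left_comm _ c]
    rw [← Finset.mul_sum, h1, mul_zero]

/-- The cross product `k × v` of a real vector with a complex one. -/
def crossC (k : R3) (v : C3) : C3 :=
  WithLp.toLp 2 (crossProduct (fun j => (k j : ℂ)) (fun j => v j))

theorem crossC_apply (k : R3) (v : C3) (j : Fin 3) :
    crossC k v j = ![(k 1 : ℂ) * v 2 - k 2 * v 1, k 2 * v 0 - k 0 * v 2,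
      k 0 * v 1 - k 1 * v 0] j := rfl

theorem sum_crossC (k : R3) (v : C3) : ∑ j, (k j : ℂ) * crossC k v j = 0 := by
  simp only [crossC_apply, Fin.sum_univ_three]
  simp
  ring

theorem continuous_crossC : Continuous fun p : R3 × C3 => crossC p.1 p.2 := by
  refine (PiLp.continuous_toLp 2 _).comp (continuous_pi fun j => ?_)
  fin_cases j <;> simp [cross_apply] <;> fun_prop

theorem norm_crossC_le (k : R3) (v : C3) : ‖crossC k v‖ ≤ ‖k‖ * ‖v‖ := by
  refine le_of_sq_le_sq ?_ (by positivity)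
  rw [mul_pow, EuclideanSpace.norm_sq_eq, EuclideanSpace.norm_sq_eq, EuclideanSpace.norm_sq_eq]
  simp only [Fin.sum_univ_three, crossC_apply, Complex.sq_norm, Complex.normSq_apply,
    Real.norm_eq_abs, sq_abs]
  simp
  nlinarith [sq_nonneg (k 0 * (v 0).re + k 1 * (v 1).re + k 2 * (v 2).re),
    sq_nonneg (k 0 * (v 0).im + k 1 * (v 1).im + k 2 * (v 2).im)]

/-- `k ↦ (k × f(k)) / |k|`. -/
def unitCross (f : R3 → C3) (k : R3) : C3 := ((‖k‖ : ℂ))⁻¹ • crossC k (f k)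

theorem norm_unitCross_le (f : R3 → C3) (k : R3) : ‖unitCross f k‖ ≤ ‖f k‖ := by
  rw [unitCross, norm_smul, norm_inv, Complex.norm_real, norm_norm]
  rcases eq_or_ne k 0 with rfl | hk
  · simp
  · have h : 0 < ‖k‖ := norm_pos_iff.2 hk
    rw [inv_mul_le_iff₀ h]
    exact norm_crossC_le k (f k)

theorem memLp_unitCross {f : R3 → C3} (hf : MemLp f 2 volume) :
    MemLp (unitCross f) 2 volume := by
  refine hf.of_le ?_ (Eventually.of_forall (norm_unitCross_le f))
  have h1 : AEStronglyMeasurable (fun k : R3 => ((‖k‖ : ℂ))⁻¹) volume := by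
    have : Measurable (fun k : R3 => ((‖k‖ : ℂ))⁻¹) := by fun_prop
    exact this.aestronglyMeasurable
  have h2 : AEStronglyMeasurable (fun k : R3 => crossC k (f k)) volume := by
    have h3 : AEStronglyMeasurable (fun k : R3 => (k, f k)) volume :=
      AEStronglyMeasurable.prodMk (f := fun k : R3 => k)
        continuous_id.aestronglyMeasurable hf.1
    exact Continuous.comp_aestronglyMeasurable (f := fun k : R3 => (k, f k))
      continuous_crossC h3
  exact AEStronglyMeasurable.smul h1 h2

theorem unitCross_mem {f : R3 → C3} (hf : MemLp f 2 volume) :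
    (memLp_unitCross hf).toLp (unitCross f) ∈ photon := by
  change ∀ᵐ k, _
  filter_upwards [(memLp_unitCross hf).coeFn_toLp] with k hk
  simp only [hk, unitCross, PiLp.smul_apply, smul_eq_mul, mul_left_comm _ ((‖k‖ : ℂ))⁻¹]
  rw [← Finset.mul_sum, sum_crossC, mul_zero]

/-- The helicity operator `(J X)(k) = k × X(k) / |k|`. -/
def helicity (X : photon) : photon :=
  ⟨(memLp_unitCross (Lp.memLp X.1)).toLp (unitCross X.1), unitCross_mem (Lp.memLp X.1)⟩

/-- The scalar-times-vector factor `i χ(|k|) |k|^{1/2} (2π)^{-3/2} e^{-i k·x} e_j`. -/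
def fieldProfile (χ : SchwartzMap ℝ ℂ) (x : R3) (j : Fin 3) (k : R3) : C3 :=
  (Complex.I * χ ‖k‖ * (Real.sqrt ‖k‖ : ℂ) / (((2 * Real.pi) ^ (3 / 2 : ℝ) : ℝ) : ℂ)
    * Complex.exp (-Complex.I * (inner ℝ k x : ℝ))) • EuclideanSpace.single j (1 : ℂ)

theorem memLp_fieldProfile (χ : SchwartzMap ℝ ℂ) (x : R3) (j : Fin 3) :
    MemLp (fieldProfile χ x j) 2 volume := by
  have hc : Continuous (fieldProfile χ x j) := by
    unfold fieldProfile
    have : Continuous χ := χ.continuous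
    fun_prop
  set C : ℝ := 2 ^ 3 * (Finset.Iic (3, 0)).sup
    (fun m => SchwartzMap.seminorm ℝ m.1 m.2) χ with hC
  have hχ : ∀ k : R3, (1 + ‖k‖) ^ 3 * ‖χ ‖k‖‖ ≤ C := fun k => by
    have := SchwartzMap.one_add_le_sup_seminorm_apply (𝕜 := ℝ) (m := (3, 0)) (k := 3) (n := 0)
      le_rfl le_rfl χ ‖k‖
    simpa using this
  have hpi : (1 : ℝ) ≤ (2 * Real.pi) ^ (3 / 2 : ℝ) :=
    Real.one_le_rpow (by nlinarith [Real.pi_gt_three]) (by norm_num)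
  have hb : ∀ k : R3, ‖fieldProfile χ x j k‖ ^ 2 ≤ C ^ 2 * (1 + ‖k‖) ^ (-(5 : ℝ)) := fun k => by
    have h0 : 0 ≤ ‖k‖ := norm_nonneg k
    have h1 : ‖fieldProfile χ x j k‖ ≤ ‖χ ‖k‖‖ * Real.sqrt ‖k‖ := by
      have he : ‖Complex.exp (-Complex.I * (inner ℝ k x : ℝ))‖ = 1 := by
        have := Complex.norm_exp_ofReal_mul_I (-(inner ℝ k x : ℝ))
        rw [← this]; congr 2; push_cast; ring
      rw [fieldProfile, norm_smul, norm_mul, he, norm_div, norm_mul, norm_mul, Complex.norm_I,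
        Complex.norm_real, Complex.norm_real, Real.norm_of_nonneg (Real.sqrt_nonneg _),
        Real.norm_of_nonneg (by positivity)]
      simp only [one_mul, mul_one, PiLp.norm_single, norm_one]
      exact div_le_self (by positivity) hpi
    have h2 : ‖fieldProfile χ x j k‖ ^ 2 ≤ ‖χ ‖k‖‖ ^ 2 * ‖k‖ := by
      calc _ ≤ (‖χ ‖k‖‖ * Real.sqrt ‖k‖) ^ 2 := by gcongr
        _ = _ := by rw [mul_pow, Real.sq_sqrt h0]
    rw [Real.rpow_neg (by positivity), ← div_eq_mul_inv, le_div_iff₀ (by positivity)]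
    have h5 : (1 + ‖k‖) ^ (5 : ℝ) = (1 + ‖k‖) ^ 5 := by exact_mod_cast Real.rpow_natCast _ 5
    rw [h5]
    calc ‖fieldProfile χ x j k‖ ^ 2 * (1 + ‖k‖) ^ 5
        ≤ (‖χ ‖k‖‖ ^ 2 * (1 + ‖k‖)) * (1 + ‖k‖) ^ 5 := by
          gcongr
          exact h2.trans (by gcongr; linarith)
      _ = ((1 + ‖k‖) ^ 3 * ‖χ ‖k‖‖) ^ 2 := by ring
      _ ≤ C ^ 2 := by gcongr; exact hχ k
  rw [memLp_two_iff_integrable_sq_norm hc.aestronglyMeasurable]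
  have hint : Integrable (fun k : R3 => C ^ 2 * (1 + ‖k‖) ^ (-(5 : ℝ))) volume :=
    (integrable_one_add_norm (by simp; norm_num)).const_mul _
  refine hint.mono' (hc.norm.pow 2).aestronglyMeasurable (Eventually.of_forall fun k => ?_)
  rw [Real.norm_of_nonneg (by positivity)]
  exact hb k

/-- `B_{jx}(k) = i χ(|k|) |k|^{1/2} (2π)^{-3/2} e^{-i k·x} (k × e_j) / |k|`. -/
def magVec (χ : SchwartzMap ℝ ℂ) (x : R3) (j : Fin 3) : photon :=
  ⟨(memLp_unitCross (memLp_fieldProfile χ x j)).toLp (unitCross (fieldProfile χ x j)),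
    unitCross_mem (memLp_fieldProfile χ x j)⟩

/-- `E_{jx} = J B_{jx}`. -/
def elecVec (χ : SchwartzMap ℝ ℂ) (x : R3) (j : Fin 3) : photon := helicity (magVec χ x j)

/-! ## The symmetric Fock space -/

/-- Values of an `n`-photon wave function: `(ℂ³)^{⊗ n}`, in coordinates. -/
abbrev Pol (n : ℕ) : Type := EuclideanSpace ℂ (Fin n → Fin 3)

/-- `L²((ℝ³)ⁿ, (ℂ³)^{⊗ n})`, the `n`-fold Hilbert tensor power of `L²(ℝ³, ℂ³)`. -/
abbrev L2n (n : ℕ) : Type := Lp (Pol n) 2 (volume : Measure (Fin n → R3))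

/-- Permuting the photons preserves the measure. -/
theorem measurePreserving_perm {n : ℕ} (σ : Equiv.Perm (Fin n)) :
    MeasurePreserving (fun k : Fin n → R3 => k ∘ σ) volume volume := by
  have h := volume_measurePreserving_piCongrLeft (fun _ : Fin n => R3) σ.symm
  convert h using 1
  funext k i
  have := MeasurableEquiv.piCongrLeft_apply_apply (β := fun _ : Fin n => R3) σ.symm k (σ i)
  simpa using this.symm

/-- The `n`-photon space: the `n`-fold symmetric tensor power of `photon`, i.e. the wave functions
that are invariant under permutations of the photons and transverse in each photon variable. -/
def sector (n : ℕ) : Submodule ℂ (L2n n) where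
  carrier := {Ψ | (∀ σ : Equiv.Perm (Fin n), ∀ᵐ k, ∀ a, Ψ (k ∘ σ) (a ∘ σ) = Ψ k a) ∧
    ∀ᵐ k, ∀ (i : Fin n) (a : Fin n → Fin 3),
      ∑ j, (k i j : ℂ) * Ψ k (Function.update a i j) = 0}
  zero_mem' := by
    have h := Lp.coeFn_zero (Pol n) 2 (volume : Measure (Fin n → R3))
    refine ⟨fun σ => ?_, ?_⟩
    · filter_upwards [h, (measurePreserving_perm σ).quasiMeasurePreserving.ae h] with k h1 h2 a
      simp only [h1, h2, Pi.zero_apply, PiLp.zero_apply]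
    · filter_upwards [h] with k h1 i a
      simp only [h1, Pi.zero_apply, PiLp.zero_apply, mul_zero, Finset.sum_const_zero]
  add_mem' := by
    rintro Ψ Φ ⟨hΨ, hΨ'⟩ ⟨hΦ, hΦ'⟩
    have h := Lp.coeFn_add Ψ Φ
    refine ⟨fun σ => ?_, ?_⟩
    · filter_upwards [h, (measurePreserving_perm σ).quasiMeasurePreserving.ae h, hΨ σ, hΦ σ]
        with k h1 h2 h3 h4 a
      simp only [h1, h2, Pi.add_apply, PiLp.add_apply, h3, h4]
    · filter_upwards [h, hΨ', hΦ'] with k h1 h2 h3 i a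
      simp only [h1, Pi.add_apply, PiLp.add_apply, mul_add, Finset.sum_add_distrib, h2, h3,
        add_zero]
  smul_mem' := by
    rintro c Ψ ⟨hΨ, hΨ'⟩
    have h := Lp.coeFn_smul c Ψ
    refine ⟨fun σ => ?_, ?_⟩
    · filter_upwards [h, (measurePreserving_perm σ).quasiMeasurePreserving.ae h, hΨ σ]
        with k h1 h2 h3 a
      simp only [h1, h2, Pi.smul_apply, PiLp.smul_apply, h3]
    · filter_upwards [h, hΨ'] with k h1 h2 i a
      simp only [h1, Pi.smul_apply, PiLp.smul_apply, smul_eq_mul, mul_left_comm _ c]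
      rw [← Finset.mul_sum, h2, mul_zero]

theorem isClosed_sector (n : ℕ) : IsClosed (sector n : Set (L2n n)) := by
  refine IsSeqClosed.isClosed fun u f hu hf => ?_
  obtain ⟨ns, -, h⟩ := (tendstoInMeasure_of_tendsto_Lp hf).exists_seq_tendsto_ae
  have hc : ∀ (k : Fin n → R3) (a : Fin n → Fin 3),
      Tendsto (fun i => u (ns i) k) atTop (𝓝 (f k)) →
      Tendsto (fun i => u (ns i) k a) atTop (𝓝 (f k a)) := fun k a hk =>
    ((PiLp.continuous_apply 2 _ a).tendsto _).comp hk
  refine ⟨fun σ => ?_, ?_⟩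
  · have h2 : ∀ᵐ k, ∀ m, ∀ a, u m (k ∘ σ) (a ∘ σ) = u m k a := ae_all_iff.2 fun m => (hu m).1 σ
    filter_upwards [h, (measurePreserving_perm σ).quasiMeasurePreserving.ae h, h2]
      with k h1 h3 h4 a
    refine tendsto_nhds_unique (hc _ _ h3) ?_
    simp only [h4]
    exact hc _ _ h1
  · have h2 : ∀ᵐ k, ∀ m, ∀ (i : Fin n) (a : Fin n → Fin 3),
      ∑ j, (k i j : ℂ) * u m k (Function.update a i j) = 0 := ae_all_iff.2 fun m => (hu m).2
    filter_upwards [h, h2] with k h1 h3 i a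
    have h4 : Tendsto (fun m => ∑ j, (k i j : ℂ) * u (ns m) k (Function.update a i j)) atTop
        (𝓝 (∑ j, (k i j : ℂ) * f k (Function.update a i j))) :=
      tendsto_finsetSum _ fun j _ => (hc _ _ h1).const_mul _
    simp only [h3] at h4
    exact tendsto_nhds_unique h4 tendsto_const_nhds

instance (n : ℕ) : CompleteSpace (sector n) := (isClosed_sector n).completeSpace_coe

/-- The symmetric Fock space: the Hilbert sum of the `n`-photon spaces. -/
abbrev Fock : Type := lp (fun n : ℕ => sector n) 2

/-- `(f ⊗ Ψ)(k₀, …, kₙ) = f(k₀) ⊗ Ψ(k₁, …, kₙ)`. -/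
def tensFun {n : ℕ} (f : R3 → C3) (Ψ : (Fin n → R3) → Pol n) (k : Fin (n + 1) → R3) :
    Pol (n + 1) :=
  WithLp.toLp 2 fun a => f (k 0) (a 0) * Ψ (Fin.tail k) (Fin.tail a)

theorem measurePreserving_cons (n : ℕ) :
    MeasurePreserving (fun k : Fin (n + 1) → R3 => (k 0, Fin.tail k)) volume
      (volume.prod volume) := by
  have h := volume_preserving_piFinSuccAbove (fun _ : Fin (n + 1) => R3) 0
  exact h

theorem norm_tensFun {n : ℕ} (f : R3 → C3) (Ψ : (Fin n → R3) → Pol n)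
    (k : Fin (n + 1) → R3) : ‖tensFun f Ψ k‖ = ‖f (k 0)‖ * ‖Ψ (Fin.tail k)‖ := by
  have h : ‖tensFun f Ψ k‖ ^ 2 = (‖f (k 0)‖ * ‖Ψ (Fin.tail k)‖) ^ 2 := by
    rw [mul_pow, EuclideanSpace.norm_sq_eq, EuclideanSpace.norm_sq_eq, EuclideanSpace.norm_sq_eq,
      Finset.sum_mul_sum, ← Finset.sum_product',
      ← (Fin.consEquiv (fun _ : Fin (n + 1) => Fin 3)).sum_comp]
    refine Finset.sum_congr rfl fun p _ => ?_
    simp [tensFun, Fin.consEquiv, mul_pow]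
  exact (pow_left_inj₀ (norm_nonneg _) (by positivity) two_ne_zero).1 h

theorem aesm_tensFun {n : ℕ} {f : R3 → C3} {Ψ : (Fin n → R3) → Pol n}
    (hf : AEStronglyMeasurable f volume) (hΨ : AEStronglyMeasurable Ψ volume) :
    AEStronglyMeasurable (tensFun f Ψ) volume := by
  have h1 : AEStronglyMeasurable (fun k : Fin (n + 1) → R3 => f (k 0)) volume :=
    (hf.comp_quasiMeasurePreserving Measure.quasiMeasurePreserving_fst).comp_measurePreserving
      (measurePreserving_cons n)
  have h2 : AEStronglyMeasurable (fun k : Fin (n + 1) → R3 => Ψ (Fin.tail k)) volume :=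
    (hΨ.comp_quasiMeasurePreserving Measure.quasiMeasurePreserving_snd).comp_measurePreserving
      (measurePreserving_cons n)
  have hc : Continuous fun p : C3 × Pol n =>
      (WithLp.toLp 2 fun a => p.1 (a 0) * p.2 (Fin.tail a) : Pol (n + 1)) := by
    refine (PiLp.continuous_toLp 2 _).comp (continuous_pi fun a => ?_)
    fun_prop
  exact Continuous.comp_aestronglyMeasurable
    (f := fun k : Fin (n + 1) → R3 => (f (k 0), Ψ (Fin.tail k))) hc (h1.prodMk h2)

theorem eLpNorm_tensFun {n : ℕ} {f : R3 → C3} {Ψ : (Fin n → R3) → Pol n}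
    (hf : AEStronglyMeasurable f volume) (hΨ : AEStronglyMeasurable Ψ volume) :
    eLpNorm (tensFun f Ψ) 2 volume = eLpNorm f 2 volume * eLpNorm Ψ 2 volume := by
  simp only [eLpNorm_eq_lintegral_rpow_enorm_toReal two_ne_zero ENNReal.ofNat_ne_top]
  rw [← ENNReal.mul_rpow_of_nonneg _ _ (by simp)]
  congr 1
  have h : ∀ k, ‖tensFun f Ψ k‖ₑ ^ (2 : ENNReal).toReal =
      (fun p : R3 × (Fin n → R3) =>
        ‖f p.1‖ₑ ^ (2 : ENNReal).toReal * ‖Ψ p.2‖ₑ ^ (2 : ENNReal).toReal)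
        (k 0, Fin.tail k) := fun k => by
    change _ = ‖f (k 0)‖ₑ ^ _ * ‖Ψ (Fin.tail k)‖ₑ ^ _
    rw [← ENNReal.mul_rpow_of_nonneg _ _ (by simp), ← ofReal_norm, norm_tensFun,
      ENNReal.ofReal_mul (norm_nonneg _), ofReal_norm, ofReal_norm]
  simp only [h]
  rw [MeasurePreserving.lintegral_comp_emb (f := fun p : R3 × (Fin n → R3) =>
        ‖f p.1‖ₑ ^ (2 : ENNReal).toReal * ‖Ψ p.2‖ₑ ^ (2 : ENNReal).toReal)
        (g := fun k : Fin (n + 1) → R3 => (k 0, Fin.tail k)) (measurePreserving_cons n)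
      (MeasurableEquiv.piFinSuccAbove (fun _ : Fin (n + 1) => R3) 0).measurableEmbedding,
    lintegral_prod_mul (hf.enorm.pow_const _) (hΨ.enorm.pow_const _)]

theorem memLp_tensFun {n : ℕ} (f : photon) (Ψ : sector n) :
    MemLp (tensFun f.1 Ψ.1) 2 volume :=
  ⟨aesm_tensFun (Lp.aestronglyMeasurable _) (Lp.aestronglyMeasurable _), by
    rw [eLpNorm_tensFun (Lp.aestronglyMeasurable _) (Lp.aestronglyMeasurable _)]
    exact ENNReal.mul_lt_top (Lp.eLpNorm_lt_top _) (Lp.eLpNorm_lt_top _)⟩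

/-- The tensor product `f ⊗ Ψ`. -/
def tens {n : ℕ} (f : photon) (Ψ : sector n) : L2n (n + 1) :=
  (memLp_tensFun f Ψ).toLp (tensFun f.1 Ψ.1)

theorem norm_tens {n : ℕ} (f : photon) (Ψ : sector n) : ‖tens f Ψ‖ = ‖f‖ * ‖Ψ‖ := by
  rw [tens, Lp.norm_toLp,
    eLpNorm_tensFun (Lp.aestronglyMeasurable _) (Lp.aestronglyMeasurable _), ENNReal.toReal_mul]
  rfl

theorem coeFn_tens {n : ℕ} (f : photon) (Ψ : sector n) :
    tens f Ψ =ᵐ[volume] tensFun f.1 Ψ.1 := MemLp.coeFn_toLp _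

theorem ae_tail {n : ℕ} {p : (Fin n → R3) → Prop} (h : ∀ᵐ k, p k) :
    ∀ᵐ k : Fin (n + 1) → R3, p (Fin.tail k) :=
  (Measure.quasiMeasurePreserving_snd.comp
    (measurePreserving_cons n).quasiMeasurePreserving).ae h

/-- `Ψ ↦ √(n+1) S_{n+1} (f ⊗ Ψ)`: the creation operator `a*(f)` on the `n`-photon space. The
symmetrizer `S_{n+1}` is the orthogonal projection on the symmetric wave functions. -/
def create (f : photon) (n : ℕ) : sector n →L[ℂ] sector (n + 1) :=
  ((Real.sqrt (n + 1) : ℝ) : ℂ) • (sector (n + 1)).orthogonalProjectionOnto ∘L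
    LinearMap.mkContinuous
      { toFun := fun Ψ => tens f Ψ
        map_add' := by
          intro Ψ Φ
          refine Lp.ext ?_
          filter_upwards [coeFn_tens f (Ψ + Φ), coeFn_tens f Ψ, coeFn_tens f Φ,
            Lp.coeFn_add (tens f Ψ) (tens f Φ), ae_tail (Lp.coeFn_add Ψ.1 Φ.1)]
            with k h1 h2 h3 h4 h5
          rw [h4, Pi.add_apply, h1, h2, h3]
          ext a
          simp only [tensFun, Submodule.coe_add, h5, Pi.add_apply, PiLp.add_apply, mul_add]
        map_smul' := by
          intro c Ψ
          refine Lp.ext ?_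
          filter_upwards [coeFn_tens f (c • Ψ), coeFn_tens f Ψ,
            Lp.coeFn_smul c (tens f Ψ), ae_tail (Lp.coeFn_smul c Ψ.1)] with k h1 h2 h4 h5
          rw [RingHom.id_apply, h4, Pi.smul_apply, h1, h2]
          ext a
          simp only [tensFun, Submodule.coe_smul, h5, Pi.smul_apply, PiLp.smul_apply, smul_eq_mul,
            mul_left_comm _ c] }
      ‖f‖ (fun Ψ => (norm_tens f Ψ).le)

/-- The annihilation operator `a(f)` from the `(n+1)`-photon to the `n`-photon space, the adjoint
of the creation operator. -/
def annihilate (f : photon) (n : ℕ) : sector (n + 1) →L[ℂ] sector n :=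
  ContinuousLinearMap.adjoint (create f n)

/-- The components of `2^{-1/2} (a(f) + a*(f)) Ψ`. -/
def segalComp (f : photon) (Ψ : Fock) : (n : ℕ) → sector n
  | 0 => (((Real.sqrt 2)⁻¹ : ℝ) : ℂ) • annihilate f 0 (Ψ 1)
  | n + 1 => (((Real.sqrt 2)⁻¹ : ℝ) : ℂ) •
      (annihilate f (n + 1) (Ψ (n + 2)) + create f n (Ψ n))

theorem segalComp_add (f : photon) (Ψ Φ : Fock) (n : ℕ) :
    segalComp f (Ψ + Φ) n = segalComp f Ψ n + segalComp f Φ n := by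
  cases n <;> simp only [segalComp, lp.coeFn_add, Pi.add_apply, map_add, ← smul_add]
  congr 1
  abel

theorem segalComp_smul (f : photon) (c : ℂ) (Ψ : Fock) (n : ℕ) :
    segalComp f (c • Ψ) n = c • segalComp f Ψ n := by
  cases n <;> simp only [segalComp, lp.coeFn_smul, Pi.smul_apply, map_smul, ← smul_add,
    smul_comm c]

/-- The Segal field `Φ_S(f) = 2^{-1/2} (a(f) + a*(f))`, as a closed operator: its domain consists
of all `Ψ` for which the sequence of components is square-summable. -/
def segal (f : photon) : Fock →ₗ.[ℂ] Fock :=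
  Submodule.toLinearPMap
    { carrier := {p | ∀ n, p.2 n = segalComp f p.1 n}
      zero_mem' := fun n => by
        have h := segalComp_smul f 0 0 n
        rw [zero_smul, zero_smul] at h
        exact h.symm
      add_mem' := by
        intro p q hp hq n
        have h1 := hp n
        have h2 := hq n
        simp only [Prod.snd_add, Prod.fst_add, lp.coeFn_add, Pi.add_apply, segalComp_add, h1, h2]
      smul_mem' := by
        intro c p hp n
        have h1 := hp n
        simp only [Prod.smul_snd, Prod.smul_fst, lp.coeFn_smul, Pi.smul_apply, segalComp_smul,
          h1] }

/-- `dΓ(ω)`, the second quantization of the operator of multiplication by `ω : ℝ³ → ℝ`: on the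
`n`-photon space it multiplies by `ω(k₁) + ⋯ + ω(kₙ)`, with its maximal domain. -/
def dGamma (ω : R3 → ℝ) : Fock →ₗ.[ℂ] Fock :=
  Submodule.toLinearPMap
    { carrier := {p | ∀ n, ∀ᵐ k, (p.2 n).1 k = ((∑ i, ω (k i) : ℝ) : ℂ) • (p.1 n).1 k}
      zero_mem' := fun n => by
        filter_upwards [Lp.coeFn_zero (Pol n) 2 (volume : Measure (Fin n → R3))] with k hk
        have h : ∀ k, (((0 : Fock × Fock).1 n).1 : (Fin n → R3) → Pol n) k =
          (0 : L2n n) k := fun _ => rfl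
        have h' : ∀ k, (((0 : Fock × Fock).2 n).1 : (Fin n → R3) → Pol n) k =
          (0 : L2n n) k := fun _ => rfl
        rw [h, h', hk, Pi.zero_apply, smul_zero]
      add_mem' := by
        intro p q hp hq n
        filter_upwards [hp n, hq n, Lp.coeFn_add (p.1 n).1 (q.1 n).1,
          Lp.coeFn_add (p.2 n).1 (q.2 n).1] with k h1 h2 h3 h4
        have h : ∀ k, (((p + q).1 n).1 : (Fin n → R3) → Pol n) k =
          ((p.1 n).1 + (q.1 n).1 : L2n n) k := fun _ => rfl
        have h' : ∀ k, (((p + q).2 n).1 : (Fin n → R3) → Pol n) k =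
          ((p.2 n).1 + (q.2 n).1 : L2n n) k := fun _ => rfl
        rw [h, h', h3, h4, Pi.add_apply, Pi.add_apply, h1, h2, smul_add]
      smul_mem' := by
        intro c p hp n
        filter_upwards [hp n, Lp.coeFn_smul c (p.1 n).1,
          Lp.coeFn_smul c (p.2 n).1] with k h1 h3 h4
        have h : ∀ k, (((c • p).1 n).1 : (Fin n → R3) → Pol n) k =
          (c • (p.1 n).1 : L2n n) k := fun _ => rfl
        have h' : ∀ k, (((c • p).2 n).1 : (Fin n → R3) → Pol n) k =
          (c • (p.2 n).1 : L2n n) k := fun _ => rfl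
        rw [h, h', h3, h4, Pi.smul_apply, Pi.smul_apply, h1, smul_comm] }

/-! ## Coherent states and Wick symbols -/

/-- The vacuum component `1 ∈ ℂ`. -/
def vacuum : sector 0 :=
  ⟨(memLp_const (WithLp.toLp 2 fun _ => (1 : ℂ) : Pol 0)).toLp
      (fun _ : Fin 0 → R3 => (WithLp.toLp 2 fun _ => (1 : ℂ) : Pol 0)), by
    refine ⟨fun σ => ae_of_all _ fun k a => ?_, ae_of_all _ fun k i => i.elim0⟩
    rw [Subsingleton.elim (k ∘ σ) k, Subsingleton.elim (a ∘ σ) a]⟩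

/-- `z ⊗ ⋯ ⊗ z` (`n` factors), built one factor at a time; the projection onto the symmetric wave
functions leaves `z ⊗ (z ⊗ ⋯ ⊗ z)` unchanged. -/
def tensPow (z : photon) : (n : ℕ) → sector n
  | 0 => vacuum
  | n + 1 => (sector (n + 1)).orthogonalProjectionOnto (tens z (tensPow z n))

theorem norm_tensPow_le (z : photon) (n : ℕ) : ‖tensPow z n‖ ≤ ‖vacuum‖ * ‖z‖ ^ n := by
  induction n with
  | zero => simp [tensPow]
  | succ n ih =>
    calc ‖tensPow z (n + 1)‖ ≤ ‖tens z (tensPow z n)‖ :=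
          (sector (n + 1)).norm_orthogonalProjectionOnto_apply_le _
      _ = ‖z‖ * ‖tensPow z n‖ := norm_tens _ _
      _ ≤ ‖z‖ * (‖vacuum‖ * ‖z‖ ^ n) := by gcongr
      _ = ‖vacuum‖ * ‖z‖ ^ (n + 1) := by ring

/-- The components of the coherent state `Ψ_{X,h}`, where `X = (a, b)` is read as `a + i b`:
`e^{-|X|²/4h} (a + i b)^{⊗ n} / ((2h)^{n/2} √(n!))`. -/
def coherentComp (h : ℝ) (X : photon) (n : ℕ) : sector n :=
  ((Real.exp (-‖X‖ ^ 2 / (4 * h)) / (Real.sqrt (2 * h) ^ n * Real.sqrt (n.factorial)) : ℝ) : ℂ) •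
    tensPow X n

theorem memlp_coherentComp (h : ℝ) (X : photon) : Memℓp (coherentComp h X) 2 := by
  refine memℓp_gen ?_
  have hs : Summable fun n : ℕ => (Real.exp (-‖X‖ ^ 2 / (4 * h)) * ‖vacuum‖) ^ 2 *
      ((‖X‖ / Real.sqrt (2 * h)) ^ 2) ^ n / n.factorial := by
    simp only [mul_div_assoc]
    exact (Real.summable_pow_div_factorial _).mul_left _
  refine Summable.of_nonneg_of_le (fun n => by positivity) (fun n => ?_) hs
  have h1 := norm_tensPow_le X n
  have h2 : ‖coherentComp h X n‖ ≤ Real.exp (-‖X‖ ^ 2 / (4 * h)) /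
      (Real.sqrt (2 * h) ^ n * Real.sqrt (n.factorial)) * (‖vacuum‖ * ‖X‖ ^ n) := by
    rw [coherentComp, norm_smul, Complex.norm_real, Real.norm_of_nonneg (by positivity)]
    gcongr
  have h3 : (2 : ENNReal).toReal = ((2 : ℕ) : ℝ) := by simp
  rw [h3, Real.rpow_natCast]
  refine (pow_le_pow_left₀ (norm_nonneg _) h2 2).trans (le_of_eq ?_)
  have h4 : (n.factorial : ℝ) = Real.sqrt n.factorial ^ 2 := (Real.sq_sqrt (by positivity)).symm
  conv_rhs => rw [h4]
  simp only [div_eq_mul_inv, mul_pow, mul_inv, inv_pow]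
  ring

/-- The coherent state `Ψ_{X,h}`. -/
def coherent (h : ℝ) (X : photon) : Fock := ⟨coherentComp h X, memlp_coherentComp h X⟩

/-- The function `f` on phase space is the Wick symbol `X ↦ ⟨A Ψ_{X,h}, Ψ_{X,h}⟩` of `A`, the
domain of `A` containing all coherent states. (`inner` is linear in its second entry.) -/
def HasWickSymbol (h : ℝ) (A : Fock →ₗ.[ℂ] Fock) (f : photon → ℂ) : Prop :=
  ∀ X, ∃ hX : coherent h X ∈ A.domain, inner ℂ (coherent h X) (A ⟨coherent h X, hX⟩) = f X

open Classical in
/-- The Wick symbol of an operator (with value `0` where the coherent state is not in the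
domain). -/
def wickSymbol (h : ℝ) (A : Fock →ₗ.[ℂ] Fock) (X : photon) : ℂ :=
  if hX : coherent h X ∈ A.domain then inner ℂ (coherent h X) (A ⟨coherent h X, hX⟩) else 0

/-! ## The fields -/

/-- `Φ_{S,h}(V) = h^{1/2} Φ_S(V)`. -/
def segalH (h : ℝ) (V : photon) : Fock →ₗ.[ℂ] Fock := ((Real.sqrt h : ℝ) : ℂ) • segal V

/-- The magnetic field operator `B_m(x)`. -/
def magField (χ : SchwartzMap ℝ ℂ) (h : ℝ) (x : R3) (m : Fin 3) : Fock →ₗ.[ℂ] Fock :=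
  segalH h (magVec χ x m)

/-- The electric field operator `E_m(x)`. -/
def elecField (χ : SchwartzMap ℝ ℂ) (h : ℝ) (x : R3) (m : Fin 3) : Fock →ₗ.[ℂ] Fock :=
  segalH h (elecVec χ x m)

/-- The function `E_m^{pol}(x, X) = - E_m(x, J F X)`, where `E_m(x, ·)` is the Wick symbol of
`E_m(x)` and `F(q, p) = (-p, q)`, i.e. multiplication of `q + i p` by `i`. -/
def elecPolSymbol (χ : SchwartzMap ℝ ℂ) (h : ℝ) (x : R3) (m : Fin 3) (X : photon) : ℂ :=
  - wickSymbol h (elecField χ h x m) (helicity (Complex.I • X))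

/-- The operator `E_m^{pol}(x)`: the Segal field whose Wick symbol is `E_m^{pol}(x, ·)`. -/
def elecPol (χ : SchwartzMap ℝ ℂ) (h : ℝ) (x : R3) (m : Fin 3) : Fock →ₗ.[ℂ] Fock :=
  segalH h (Classical.epsilon fun V : photon =>
    HasWickSymbol h (segalH h V) (elecPolSymbol χ h x m))

/-! ## Unbounded operators -/

section Operators

variable {E : Type*} [NormedAddCommGroup E] [InnerProductSpace ℂ E]

/-- The composition `A ∘ B` of unbounded operators, on its natural domain
`{ψ ∈ D(B) | B ψ ∈ D(A)}`. -/
def opComp (A B : E →ₗ.[ℂ] E) : E →ₗ.[ℂ] E :=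
  A.comp (B.domRestrict ((A.domain.comap B.toFun).map B.domain.subtype)) (by
    rintro ⟨x, hx, hx'⟩
    obtain ⟨y, hy, rfl⟩ := Submodule.mem_map.1 hx
    exact hy)

/-- The commutator `[A, B] = A B - B A`, on its natural domain. -/
def opComm (A B : E →ₗ.[ℂ] E) : E →ₗ.[ℂ] E := opComp A B - opComp B A

/-- An everywhere defined operator as an unbounded one. -/
def everywhere (T : E →ₗ[ℂ] E) : E →ₗ.[ℂ] E := T.toPMap ⊤

/-- `U` is the strongly continuous one-parameter unitary group `s ↦ e^{isA}` with generator `A`: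
`ψ ∈ D(A)` and `A ψ = θ` exactly if `s ↦ U s ψ` has derivative `i θ` at `0`. -/
structure IsUnitaryGroup (A : E →ₗ.[ℂ] E) (U : ℝ → E ≃ₗᵢ[ℂ] E) : Prop where
  zero : ∀ ψ, U 0 ψ = ψ
  add : ∀ s t ψ, U (s + t) ψ = U s (U t ψ)
  continuous : ∀ ψ, Continuous fun s => U s ψ
  generator : ∀ ψ θ, (ψ, θ) ∈ A.graph ↔ HasDerivAt (fun s => U s ψ) (Complex.I • θ) 0

/-- `e^{isA}`: the unitary group with generator `A`. For a self-adjoint `A` it exists and is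
unique. -/
def expI (A : E →ₗ.[ℂ] E) : ℝ → E ≃ₗᵢ[ℂ] E :=
  Classical.epsilon fun U => IsUnitaryGroup A U

/-- The Heisenberg evolution `e^{i(t/h)H} A e^{-i(t/h)H}`. -/
def heisenberg (H : E →ₗ.[ℂ] E) (h t : ℝ) (A : E →ₗ.[ℂ] E) : E →ₗ.[ℂ] E :=
  opComp (everywhere (expI H (t / h)).toLinearEquiv.toLinearMap)
    (opComp A (everywhere (expI H (-(t / h))).toLinearEquiv.toLinearMap))

/-- The extension of `A` by continuity, for the graph norm of `H`, to the vectors of `D(H)`: its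
graph consists of the limits `(ψ, θ)`, `ψ ∈ D(H)`, of sequences `(ψₙ, A ψₙ)` with
`ψₙ ∈ D(A) ∩ D(H)`, `ψₙ → ψ`, `H ψₙ → H ψ`, `A ψₙ → θ`. -/
def graphExtension (H A : E →ₗ.[ℂ] E) : E →ₗ.[ℂ] E :=
  Submodule.toLinearPMap
    { carrier := {p | ∃ η, (p.1, η) ∈ H.graph ∧ ((p.1, η), p.2) ∈
        (H.graph.comap (LinearMap.fst ℂ (E × E) E) ⊓
          A.graph.comap ((LinearMap.fst ℂ E E).prodMap LinearMap.id)).topologicalClosure}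
      zero_mem' := ⟨0, H.graph.zero_mem, Submodule.zero_mem _⟩
      add_mem' := by
        rintro p q ⟨η, h1, h2⟩ ⟨ζ, h3, h4⟩
        exact ⟨η + ζ, H.graph.add_mem h1 h3, Submodule.add_mem _ h2 h4⟩
      smul_mem' := by
        rintro c p ⟨η, h1, h2⟩
        exact ⟨c • η, H.graph.smul_mem c h1, Submodule.smul_mem _ c h2⟩ }

end Operators

/-! ## Photons and spins -/

/-- The Hilbert space `F_s(H_ℂ) ⊗ (ℂ²)^{⊗ N}`: one Fock component for each element of the standard
basis of `(ℂ²)^{⊗ N}`, which is indexed by `Fin N → Fin 2`. -/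
abbrev Space (N : ℕ) : Type := PiLp 2 fun _ : Fin N → Fin 2 => Fock

/-- The Pauli matrices. -/
def pauli : Fin 3 → Matrix (Fin 2) (Fin 2) ℂ :=
  ![!![0, 1; 1, 0], !![0, -Complex.I; Complex.I, 0], !![1, 0; 0, -1]]

/-- `σ_m^{[l]} = I ⊗ ⋯ ⊗ σ_m ⊗ ⋯ ⊗ I`, with `σ_m` at the position `l`. -/
def spin {N : ℕ} (l : Fin N) (m : Fin 3) : Matrix (Fin N → Fin 2) (Fin N → Fin 2) ℂ :=
  Matrix.of fun s s' => ∏ j, (if j = l then pauli m else 1) (s j) (s' j)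

/-- `A ⊗ I`, with domain `D(A) ⊗ (ℂ²)^{⊗ N}`. -/
def tensorI {N : ℕ} (A : Fock →ₗ.[ℂ] Fock) : Space N →ₗ.[ℂ] Space N where
  domain :=
    { carrier := {Ψ | ∀ s, Ψ s ∈ A.domain}
      zero_mem' := fun _ => A.domain.zero_mem
      add_mem' := fun h1 h2 s => A.domain.add_mem (h1 s) (h2 s)
      smul_mem' := fun c _ h1 s => A.domain.smul_mem c (h1 s) }
  toFun :=
    { toFun := fun Ψ => WithLp.toLp 2 fun s => A ⟨Ψ.1 s, Ψ.2 s⟩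
      map_add' := by
        intro Ψ Φ
        ext1 s
        exact A.map_add ⟨Ψ.1 s, Ψ.2 s⟩ ⟨Φ.1 s, Φ.2 s⟩
      map_smul' := by
        intro c Ψ
        ext1 s
        exact A.map_smul c ⟨Ψ.1 s, Ψ.2 s⟩ }

/-- `I ⊗ S`. -/
def tensorS {N : ℕ} (S : Matrix (Fin N → Fin 2) (Fin N → Fin 2) ℂ) :
    Space N →ₗ.[ℂ] Space N :=
  everywhere
    { toFun := fun Ψ => WithLp.toLp 2 fun s => ∑ s', S s s' • Ψ s'
      map_add' := by
        intro Ψ Φ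
        ext1 s
        simp [smul_add, Finset.sum_add_distrib]
      map_smul' := by
        intro c Ψ
        ext1 s
        simp [Finset.smul_sum, smul_comm c] }

/-- `A ⊗ S`, with domain `D(A) ⊗ (ℂ²)^{⊗ N}`. -/
def tensor {N : ℕ} (A : Fock →ₗ.[ℂ] Fock) (S : Matrix (Fin N → Fin 2) (Fin N → Fin 2) ℂ) :
    Space N →ₗ.[ℂ] Space N :=
  opComp (tensorS S) (tensorI A)

/-- The free energy `H_ph = h dΓ(M_ω)` of the photons, `ω(k) = |k|`. -/
def photonEnergy (h : ℝ) : Fock →ₗ.[ℂ] Fock := (h : ℂ) • dGamma fun k => ‖k‖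

/-- The photon number operator `dΓ(I)`. -/
def photonNumber : Fock →ₗ.[ℂ] Fock := dGamma fun _ => 1

/-- `H_int = ∑_{l,m} (β_m + B_m(x_l)) ⊗ σ_m^{[l]}`. -/
def interaction {N : ℕ} (χ : SchwartzMap ℝ ℂ) (x : Fin N → R3) (β : Fin 3 → ℝ) (h : ℝ) :
    Space N →ₗ.[ℂ] Space N :=
  ∑ l, ∑ m, tensor (everywhere ((β m : ℂ) • (LinearMap.id : Fock →ₗ[ℂ] Fock)) +
    magField χ h (x l) m) (spin l m)

/-- The Hamiltonian `H(h) = H_ph ⊗ I + h H_int`. -/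
def hamiltonian {N : ℕ} (χ : SchwartzMap ℝ ℂ) (x : Fin N → R3) (β : Fin 3 → ℝ) (h : ℝ) :
    Space N →ₗ.[ℂ] Space N :=
  tensorI (photonEnergy h) + (h : ℂ) • interaction χ x β h

/-- The photon emission rate
`N'(t,h) = (i/h) e^{i(t/h)H(h)} [H(h), N ⊗ I] e^{-i(t/h)H(h)}`, the commutator being taken on its
natural domain and the resulting operator being extended by continuity to `D(H(h))`. -/
def emissionRate {N : ℕ} (χ : SchwartzMap ℝ ℂ) (x : Fin N → R3) (β : Fin 3 → ℝ) (h t : ℝ) :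
    Space N →ₗ.[ℂ] Space N :=
  graphExtension (hamiltonian χ x β h)
    ((Complex.I / h) • heisenberg (hamiltonian χ x β h) h t
      (opComm (hamiltonian χ x β h) (tensorI photonNumber)))

/-- `E_m^{pol}(y, t, h) = e^{i(t/h)H(h)} (E_m^{pol}(y) ⊗ I) e^{-i(t/h)H(h)}`. -/
def elecPolAt {N : ℕ} (χ : SchwartzMap ℝ ℂ) (x : Fin N → R3) (β : Fin 3 → ℝ) (h t : ℝ) (y : R3)
    (m : Fin 3) : Space N →ₗ.[ℂ] Space N :=
  heisenberg (hamiltonian χ x β h) h t (tensorI (elecPol χ h y m))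

/-- `S_m^{[l]}(t, h) = e^{i(t/h)H(h)} (I ⊗ σ_m^{[l]}) e^{-i(t/h)H(h)}`. -/
def spinAt {N : ℕ} (χ : SchwartzMap ℝ ℂ) (x : Fin N → R3) (β : Fin 3 → ℝ) (h t : ℝ) (l : Fin N)
    (m : Fin 3) : Space N →ₗ.[ℂ] Space N :=
  heisenberg (hamiltonian χ x β h) h t (tensorS (spin l m))

end NMR

end

noncomputable section

namespace NMR

/-! ## Graphs of unbounded operators -/

section Graphs

variable {E : Type*} [NormedAddCommGroup E] [InnerProductSpace ℂ E]

/-! The operator a(f) removes a photon and a*(f) adds one, so [a, N] = a and [a*, N] = -a*. As a(f)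
is antilinear and a*(f) linear in f, this reads [Φ_S(f), N] = (a(f) - a*(f))/√2 = i Φ_S(if)
(`numberCommutator_segal`). The free energy, the constant field and the spin matrices commute with
N, so (i/h)[H(h), N ⊗ I] is minus the sum of the operators h^{1/2} Φ_S(i B) ⊗ σ, with B the vector
of the magnetic field in question. On the other side, coherent states are eigenvectors of a(V),
which makes Re⟨V, X⟩ the Wick symbol of h^{1/2} Φ_S(V). Since J is isometric on transverse
functions, -Re⟨JB, J(iX)⟩ = Re⟨iB, X⟩, and E^pol is the Segal field of iB (`elecPol_eq`).

What remains is a matter of domains. Each field vector is |k|^{1/2} times a square-integrable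
function, so creation and annihilation operators are dominated by the quadratic form of dΓ(|k|)
(`inner_create_sq_le`). The interaction is therefore infinitesimally bounded with respect to the
free energy, and `SymmetricOn.kato_rellich` gives surjectivity of H(h) + iμ for large |μ|, hence
self-adjointness. The group e^{isH} is a strong limit of groups with bounded generators
(`SymmetricOn.exists_isUnitaryGroup`).

For the extension by continuity, the right-hand side of the formula is bounded on D(H) for the graph
norm, which the evolution preserves. The domain of the commutator contains the vectors of D(H) with
finitely many photons, and truncation shows that these form a core. An operator agreeing with a
graph-bounded one on a core has that operator, restricted to D(H), as its extension
(`mem_graph_graphExtension`). The second formula follows from the first, because A ⊗ S is contained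
in (A ⊗ I)(I ⊗ S) and conjugation by unitaries respects products.

Unbounded operators are handled through their graphs, so that every domain condition becomes the
existence of intermediate vectors. -/

theorem mem_graph_iff_exists {A : E →ₗ.[ℂ] E} {x y : E} :
    (x, y) ∈ A.graph ↔ ∃ hx : x ∈ A.domain, A ⟨x, hx⟩ = y := by
  rw [LinearPMap.mem_graph_iff]
  constructor
  · rintro ⟨⟨z, hz⟩, rfl, rfl⟩
    exact ⟨hz, rfl⟩
  · rintro ⟨hx, rfl⟩
    exact ⟨⟨x, hx⟩, rfl, rfl⟩

theorem graph_unique {A : E →ₗ.[ℂ] E} {x y z : E} (hy : (x, y) ∈ A.graph)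
    (hz : (x, z) ∈ A.graph) : y = z :=
  A.mem_graph_snd_inj hy hz rfl

theorem mem_graph_add {A B : E →ₗ.[ℂ] E} {x y : E} :
    (x, y) ∈ (A + B).graph ↔ ∃ u v, (x, u) ∈ A.graph ∧ (x, v) ∈ B.graph ∧ u + v = y := by
  simp only [mem_graph_iff_exists]
  constructor
  · rintro ⟨⟨h1, h2⟩, rfl⟩
    exact ⟨_, _, ⟨h1, rfl⟩, ⟨h2, rfl⟩, rfl⟩
  · rintro ⟨_, _, ⟨h1, rfl⟩, ⟨h2, rfl⟩, rfl⟩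
    exact ⟨⟨h1, h2⟩, rfl⟩

theorem mem_graph_sub {A B : E →ₗ.[ℂ] E} {x y : E} :
    (x, y) ∈ (A - B).graph ↔ ∃ u v, (x, u) ∈ A.graph ∧ (x, v) ∈ B.graph ∧ u - v = y := by
  simp only [mem_graph_iff_exists]
  constructor
  · rintro ⟨⟨h1, h2⟩, rfl⟩
    exact ⟨_, _, ⟨h1, rfl⟩, ⟨h2, rfl⟩, rfl⟩
  · rintro ⟨_, _, ⟨h1, rfl⟩, ⟨h2, rfl⟩, rfl⟩
    exact ⟨⟨h1, h2⟩, rfl⟩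

theorem mem_graph_smul {A : E →ₗ.[ℂ] E} {c : ℂ} {x y : E} :
    (x, y) ∈ (c • A).graph ↔ ∃ u, (x, u) ∈ A.graph ∧ c • u = y := by
  simp only [mem_graph_iff_exists]
  constructor
  · rintro ⟨h1, rfl⟩
    exact ⟨_, ⟨h1, rfl⟩, rfl⟩
  · rintro ⟨_, ⟨h1, rfl⟩, rfl⟩
    exact ⟨h1, rfl⟩

theorem mem_graph_neg {A : E →ₗ.[ℂ] E} {x y : E} :
    (x, y) ∈ (-A).graph ↔ (x, -y) ∈ A.graph := by
  simp only [mem_graph_iff_exists]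
  constructor
  · rintro ⟨h1, rfl⟩
    exact ⟨h1, (neg_neg _).symm⟩
  · rintro ⟨h1, h2⟩
    exact ⟨h1, neg_eq_iff_eq_neg.2 h2⟩

theorem mem_graph_zero {x y : E} : (x, y) ∈ (0 : E →ₗ.[ℂ] E).graph ↔ y = 0 := by
  simp only [mem_graph_iff_exists]
  exact ⟨fun ⟨_, h⟩ => h.symm, fun h => ⟨trivial, h.symm⟩⟩

theorem mem_graph_opComp {A B : E →ₗ.[ℂ] E} {x y : E} :
    (x, y) ∈ (opComp A B).graph ↔ ∃ u, (x, u) ∈ B.graph ∧ (u, y) ∈ A.graph := by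
  simp only [mem_graph_iff_exists]
  constructor
  · rintro ⟨⟨h1, h2⟩, rfl⟩
    obtain ⟨z, hz, hzx⟩ := Submodule.mem_map.1 h1
    change (z : E) = x at hzx
    subst hzx
    exact ⟨_, ⟨z.2, rfl⟩, hz, rfl⟩
  · rintro ⟨_, ⟨h1, rfl⟩, h2, rfl⟩
    exact ⟨⟨Submodule.mem_map.2 ⟨⟨x, h1⟩, h2, rfl⟩, h1⟩, rfl⟩

theorem mem_graph_everywhere {T : E →ₗ[ℂ] E} {x y : E} :
    (x, y) ∈ (everywhere T).graph ↔ y = T x := by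
  simp only [mem_graph_iff_exists]
  exact ⟨fun ⟨_, h⟩ => h.symm, fun h => ⟨trivial, h.symm⟩⟩

theorem mem_graph_opComm {A B : E →ₗ.[ℂ] E} {x y : E} :
    (x, y) ∈ (opComm A B).graph ↔ ∃ u v u' v', (x, u) ∈ B.graph ∧ (u, u') ∈ A.graph ∧
      (x, v) ∈ A.graph ∧ (v, v') ∈ B.graph ∧ u' - v' = y := by
  simp only [opComm, mem_graph_sub, mem_graph_opComp]
  constructor
  · rintro ⟨u', v', ⟨u, h1, h2⟩, ⟨v, h3, h4⟩, h⟩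
    exact ⟨u, v, u', v', h1, h2, h3, h4, h⟩
  · rintro ⟨u, v, u', v', h1, h2, h3, h4, h⟩
    exact ⟨u', v', ⟨u, h1, h2⟩, ⟨v, h3, h4⟩, h⟩

theorem mem_graph_heisenberg {H A : E →ₗ.[ℂ] E} {h t : ℝ} {x y : E} :
    (x, y) ∈ (heisenberg H h t A).graph ↔
      ∃ u, (expI H (-(t / h)) x, u) ∈ A.graph ∧ expI H (t / h) u = y := by
  simp only [heisenberg, mem_graph_opComp, mem_graph_everywhere]
  constructor
  · rintro ⟨u, ⟨v, rfl, h1⟩, rfl⟩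
    exact ⟨u, h1, rfl⟩
  · rintro ⟨u, h1, rfl⟩
    exact ⟨u, ⟨_, rfl, h1⟩, rfl⟩

theorem mem_graph_sum {ι : Type*} {s : Finset ι} {A : ι → E →ₗ.[ℂ] E} {x : E} {y : ι → E}
    (h : ∀ i ∈ s, (x, y i) ∈ (A i).graph) : (x, ∑ i ∈ s, y i) ∈ (∑ i ∈ s, A i).graph := by
  classical
  induction s using Finset.induction_on with
  | empty => simp
  | insert i s hi ih =>
    rw [Finset.sum_insert hi, Finset.sum_insert hi]
    exact mem_graph_add.2 ⟨_, _, h i (Finset.mem_insert_self i s),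
      ih fun j hj => h j (Finset.mem_insert_of_mem hj), rfl⟩

theorem le_iff_graph {A B : E →ₗ.[ℂ] E} :
    A ≤ B ↔ ∀ x y, (x, y) ∈ A.graph → (x, y) ∈ B.graph := by
  rw [← LinearPMap.le_graph_iff]
  exact ⟨fun h x y hxy => h hxy, fun h p hp => h p.1 p.2 hp⟩

/-- A linear relation is the graph of an operator only if it is single valued. The operators
`segal`, `dGamma` and `graphExtension` are all given by relations, so each needs this check before
its graph can be used. -/
theorem mem_graph_toLinearPMap_iff {g : Submodule ℂ (E × E)} (hg : ∀ y, ((0 : E), y) ∈ g → y = 0)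
    {x y : E} : (x, y) ∈ g.toLinearPMap.graph ↔ (x, y) ∈ g := by
  rw [Submodule.toLinearPMap_graph_eq]
  rintro ⟨a, b⟩ hab rfl
  exact hg b hab

end Graphs

/-! ## Symmetric operators with full range -/

section Symmetric

variable {E : Type*} [NormedAddCommGroup E] [InnerProductSpace ℂ E]

/-- `B` is defined and symmetric on `D(A)`. -/
def SymmetricOn (A B : E →ₗ.[ℂ] E) : Prop :=
  A.domain ≤ B.domain ∧ ∀ x ∈ A.domain, ∀ x' ∈ A.domain, ∀ z z', (x, z) ∈ B.graph →
    (x', z') ∈ B.graph → inner ℂ z x' = inner ℂ x z'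

/-- `A + iμ` maps `D(A)` onto the whole space. -/
def ShiftSurjective (A : E →ₗ.[ℂ] E) (μ : ℝ) : Prop :=
  ∀ y, ∃ x z, (x, z) ∈ A.graph ∧ z + ((μ : ℂ) * Complex.I) • x = y

/-- `B` is infinitesimally bounded with respect to `A`. -/
def InfinitesimallyBounded (A B : E →ₗ.[ℂ] E) : Prop :=
  ∀ ε : ℝ, 0 < ε → ∃ C : ℝ, 0 ≤ C ∧ ∀ x y, (x, y) ∈ A.graph →
    ∃ z, (x, z) ∈ B.graph ∧ ‖z‖ ≤ ε * ‖y‖ + C * ‖x‖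

variable {A B : E →ₗ.[ℂ] E}

theorem mem_domain_graph {x y : E} (h : (x, y) ∈ A.graph) : x ∈ A.domain :=
  LinearPMap.mem_domain_iff.2 ⟨y, h⟩

theorem InfinitesimallyBounded.domain_le (h : InfinitesimallyBounded A B) :
    A.domain ≤ B.domain := by
  intro x hx
  obtain ⟨y, hy⟩ := LinearPMap.mem_domain_iff.1 hx
  obtain ⟨C, -, hC⟩ := h 1 one_pos
  obtain ⟨z, hz, -⟩ := hC x y hy
  exact mem_domain_graph hz

theorem InfinitesimallyBounded.bound (h : InfinitesimallyBounded A B) {ε : ℝ} (hε : 0 < ε) :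
    ∃ C : ℝ, 0 ≤ C ∧ ∀ x y z, (x, y) ∈ A.graph → (x, z) ∈ B.graph →
      ‖z‖ ≤ ε * ‖y‖ + C * ‖x‖ := by
  obtain ⟨C, hC0, hC⟩ := h ε hε
  refine ⟨C, hC0, fun x y z hy hz => ?_⟩
  obtain ⟨z', hz', hb⟩ := hC x y hy
  rwa [graph_unique hz hz']

theorem InfinitesimallyBounded.add {C : E →ₗ.[ℂ] E} (hB : InfinitesimallyBounded A B)
    (hC : InfinitesimallyBounded A C) : InfinitesimallyBounded A (B + C) := by
  intro ε hε
  obtain ⟨c, hc0, hc⟩ := hB (ε / 2) (half_pos hε)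
  obtain ⟨d, hd0, hd⟩ := hC (ε / 2) (half_pos hε)
  refine ⟨c + d, add_nonneg hc0 hd0, fun x y hxy => ?_⟩
  obtain ⟨u, hu, hu'⟩ := hc x y hxy
  obtain ⟨v, hv, hv'⟩ := hd x y hxy
  refine ⟨u + v, mem_graph_add.2 ⟨u, v, hu, hv, rfl⟩, (norm_add_le u v).trans ?_⟩
  linarith

theorem InfinitesimallyBounded.zero : InfinitesimallyBounded A 0 := fun ε hε =>
  ⟨0, le_rfl, fun x y _ => ⟨0, mem_graph_zero.2 rfl, by rw [norm_zero]; positivity⟩⟩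

theorem InfinitesimallyBounded.sum {ι : Type*} {s : Finset ι} {B : ι → E →ₗ.[ℂ] E}
    (h : ∀ i ∈ s, InfinitesimallyBounded A (B i)) : InfinitesimallyBounded A (∑ i ∈ s, B i) :=
  Finset.sum_induction B (InfinitesimallyBounded A) (fun _ _ h1 h2 => h1.add h2)
    InfinitesimallyBounded.zero h

/-- Composition on the left with a bounded operator preserves infinitesimal boundedness. -/
theorem InfinitesimallyBounded.of_bounded {B' : E →ₗ.[ℂ] E} (hB : InfinitesimallyBounded A B)
    (K : ℝ) (hK : ∀ x z, (x, z) ∈ B.graph → ∃ w, (x, w) ∈ B'.graph ∧ ‖w‖ ≤ K * ‖z‖) :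
    InfinitesimallyBounded A B' := by
  intro ε hε
  -- No sign is assumed for `K`; `|K| + 1` is a positive upper bound by which `ε` can be divided.
  have hK' : 0 < |K| + 1 := by positivity
  obtain ⟨c, hc0, hc⟩ := hB (ε / (|K| + 1)) (by positivity)
  refine ⟨(|K| + 1) * c, by positivity, fun x y hxy => ?_⟩
  obtain ⟨z, hz, hz'⟩ := hc x y hxy
  obtain ⟨w, hw, hw'⟩ := hK x z hz
  refine ⟨w, hw, hw'.trans ?_⟩
  calc K * ‖z‖ ≤ (|K| + 1) * ‖z‖ := by
        gcongr
        linarith [le_abs_self K]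
    _ ≤ (|K| + 1) * (ε / (|K| + 1) * ‖y‖ + c * ‖x‖) := by gcongr
    _ = ε * ‖y‖ + (|K| + 1) * c * ‖x‖ := by field_simp

theorem InfinitesimallyBounded.smul (hB : InfinitesimallyBounded A B) (c : ℂ) :
    InfinitesimallyBounded A (c • B) :=
  hB.of_bounded ‖c‖ fun _ z hz => ⟨c • z, mem_graph_smul.2 ⟨z, hz, rfl⟩, (norm_smul c z).le⟩

theorem SymmetricOn.add {C : E →ₗ.[ℂ] E} (hB : SymmetricOn A B) (hC : SymmetricOn A C) :
    SymmetricOn A (B + C) := by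
  refine ⟨le_inf hB.1 hC.1, fun x hx x' hx' z z' hz hz' => ?_⟩
  obtain ⟨u, v, h1, h2, rfl⟩ := mem_graph_add.1 hz
  obtain ⟨u', v', h1', h2', rfl⟩ := mem_graph_add.1 hz'
  rw [inner_add_left, inner_add_right, hB.2 x hx x' hx' u u' h1 h1', hC.2 x hx x' hx' v v' h2 h2']

theorem SymmetricOn.zero : SymmetricOn A 0 := by
  refine ⟨le_top, fun x _ x' _ z z' hz hz' => ?_⟩
  rw [mem_graph_zero.1 hz, mem_graph_zero.1 hz', inner_zero_left, inner_zero_right]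

theorem SymmetricOn.sum {ι : Type*} {s : Finset ι} {B : ι → E →ₗ.[ℂ] E}
    (h : ∀ i ∈ s, SymmetricOn A (B i)) : SymmetricOn A (∑ i ∈ s, B i) :=
  Finset.sum_induction B (SymmetricOn A) (fun _ _ h1 h2 => h1.add h2) SymmetricOn.zero h

theorem SymmetricOn.real_smul (hB : SymmetricOn A B) (c : ℝ) : SymmetricOn A ((c : ℂ) • B) := by
  refine ⟨hB.1, fun x hx x' hx' z z' hz hz' => ?_⟩
  obtain ⟨u, h1, rfl⟩ := mem_graph_smul.1 hz
  obtain ⟨u', h1', rfl⟩ := mem_graph_smul.1 hz'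
  rw [inner_smul_left, inner_smul_right, hB.2 x hx x' hx' u u' h1 h1', Complex.conj_ofReal]

theorem SymmetricOn.mono {A' : E →ₗ.[ℂ] E} (hB : SymmetricOn A B) (h : A'.domain ≤ A.domain) :
    SymmetricOn A' B :=
  ⟨h.trans hB.1, fun x hx x' hx' => hB.2 x (h hx) x' (h hx')⟩

theorem SymmetricOn.inner_eq (hA : SymmetricOn A A) {x x' z z' : E} (h : (x, z) ∈ A.graph)
    (h' : (x', z') ∈ A.graph) : inner ℂ z x' = inner ℂ x z' :=
  hA.2 x (mem_domain_graph h) x' (mem_domain_graph h') z z' h h'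

/-- Symmetry makes ⟨Ax, x⟩ real, so the cross term with iμx has real part zero. Both resolvent
estimates, |μ|‖x‖ ≤ ‖(A + iμ)x‖ and ‖Ax‖ ≤ ‖(A + iμ)x‖, are read off from this identity. -/
theorem SymmetricOn.norm_sq_shift (hA : SymmetricOn A A) {x z : E} (h : (x, z) ∈ A.graph)
    (μ : ℝ) : ‖z + ((μ : ℂ) * Complex.I) • x‖ ^ 2 = ‖z‖ ^ 2 + μ ^ 2 * ‖x‖ ^ 2 := by
  have h1 : (inner ℂ z x : ℂ).im = 0 := by
    have h4 := congrArg Complex.im (hA.inner_eq h h)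
    rw [← inner_conj_symm x z, Complex.conj_im] at h4
    linarith
  rw [norm_add_sq (𝕜 := ℂ), inner_smul_right, norm_smul, mul_pow]
  have h2 : RCLike.re ((μ : ℂ) * Complex.I * inner ℂ z x) = 0 := by
    change Complex.re _ = 0
    simp [Complex.mul_re, h1]
  rw [h2]
  simp

theorem SymmetricOn.norm_le_shift (hA : SymmetricOn A A) {x z : E} (h : (x, z) ∈ A.graph)
    (μ : ℝ) : |μ| * ‖x‖ ≤ ‖z + ((μ : ℂ) * Complex.I) • x‖ := by
  refine le_of_sq_le_sq ?_ (norm_nonneg _)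
  rw [hA.norm_sq_shift h, mul_pow, sq_abs]
  nlinarith [sq_nonneg ‖z‖]

theorem SymmetricOn.norm_image_le_shift (hA : SymmetricOn A A) {x z : E} (h : (x, z) ∈ A.graph)
    (μ : ℝ) : ‖z‖ ≤ ‖z + ((μ : ℂ) * Complex.I) • x‖ := by
  refine le_of_sq_le_sq ?_ (norm_nonneg _)
  rw [hA.norm_sq_shift h]
  nlinarith [mul_nonneg (sq_nonneg μ) (sq_nonneg ‖x‖)]

/-- The lower bound |μ|‖x‖ ≤ ‖(A + iμ)x‖ forces injectivity. This is what makes preimages under A +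
iμ, picked by choice, depend linearly on the data. -/
theorem SymmetricOn.eq_of_shift (hA : SymmetricOn A A) {x z x' z' : E} (h : (x, z) ∈ A.graph)
    (h' : (x', z') ∈ A.graph) {μ : ℝ} (hμ : μ ≠ 0)
    (he : z + ((μ : ℂ) * Complex.I) • x = z' + ((μ : ℂ) * Complex.I) • x') : x = x' := by
  have h1 := hA.norm_le_shift (A.graph.sub_mem h h') μ
  have h2 : z - z' + ((μ : ℂ) * Complex.I) • (x - x') = 0 := by
    rw [smul_sub, ← sub_eq_zero.2 he]; abel
  simp only at h1
  rw [h2, norm_zero] at h1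
  have h3 : ‖x - x'‖ ≤ 0 := by
    by_contra! h4
    exact absurd h1 (not_le.2 (mul_pos (abs_pos.2 hμ) h4))
  exact sub_eq_zero.1 (norm_le_zero_iff.1 h3)

/-- A vector orthogonal to D(A) can be written as (A + iμ)x. Pairing it with x gives ⟨x, Ax⟩ +
iμ‖x‖² = 0 with ⟨x, Ax⟩ real, so x = 0. -/
theorem SymmetricOn.dense_domain [CompleteSpace E] (hA : SymmetricOn A A) {μ : ℝ} (hμ : μ ≠ 0)
    (hs : ShiftSurjective A μ) : Dense (A.domain : Set E) := by
  rw [Submodule.dense_iff_topologicalClosure_eq_top, Submodule.topologicalClosure_eq_top_iff,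
    Submodule.eq_bot_iff]
  intro y hy
  obtain ⟨x, z, hxz, rfl⟩ := hs y
  have h1 := (Submodule.mem_orthogonal _ _).1 hy x (mem_domain_graph hxz)
  rw [inner_add_right, inner_smul_right] at h1
  have h2 := congrArg Complex.im h1
  have h3 := congrArg Complex.im (hA.inner_eq hxz hxz)
  rw [← inner_conj_symm, Complex.conj_im] at h3
  have h4 : (inner ℂ x x : ℂ) = ((‖x‖ ^ 2 : ℝ) : ℂ) := by
    rw [inner_self_eq_norm_sq_to_K]; norm_cast
  rw [h4] at h2
  simp [-Complex.ofReal_pow] at h2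
  have h5 : μ * ‖x‖ ^ 2 = 0 := by linarith
  have hx : x = 0 := by simpa [hμ] using h5
  subst hx
  have hz : z = 0 := A.graph_fst_eq_zero_snd hxz rfl
  rw [hz, smul_zero, add_zero]

/-- A symmetric operator `A` for which `A ± iμ` are onto is self-adjoint. -/
theorem SymmetricOn.isSelfAdjoint [CompleteSpace E] (hA : SymmetricOn A A) {μ : ℝ} (hμ : μ ≠ 0)
    (hs : ShiftSurjective A μ) (hs' : ShiftSurjective A (-μ)) : IsSelfAdjoint A := by
  have hd := hA.dense_domain hμ hs
  have hle : A ≤ A.adjoint := by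
    refine LinearPMap.IsFormalAdjoint.le_adjoint hd fun x y => ?_
    exact hA.inner_eq (A.mem_graph x) (A.mem_graph y)
  rw [LinearPMap.isSelfAdjoint_def]
  refine (LinearPMap.eq_of_le_of_domain_eq hle (le_antisymm hle.1 fun y hy => ?_)).symm
  -- Choose x in D(A) with (A + iμ)x = (A* + iμ)y. Then y - x lies in the kernel of A* + iμ, which
  -- is orthogonal to the range of A - iμ. That range is everything, so y - x is orthogonal to
  -- itself.
  obtain ⟨x, z, hxz, hx⟩ := hs (A.adjoint ⟨y, hy⟩ + ((μ : ℂ) * Complex.I) • y)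
  suffices h : y - x = 0 by
    rw [sub_eq_zero.1 h]
    exact mem_domain_graph hxz
  obtain ⟨u, v, huv, hu⟩ := hs' (y - x)
  have h1 : inner ℂ (A.adjoint ⟨y, hy⟩) u = inner ℂ y v := by
    obtain ⟨hu', rfl⟩ := mem_graph_iff_exists.1 huv
    exact LinearPMap.adjoint_isFormalAdjoint hd ⟨y, hy⟩ ⟨u, hu'⟩
  have h2 := hA.inner_eq hxz huv
  have h3 : inner ℂ (y - x) (y - x) = (0 : ℂ) := by
    nth_rewrite 2 [← hu]
    have h4 := congrArg (fun w => inner ℂ w u) hx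
    simp only [inner_add_left, inner_smul_left, h1, h2] at h4
    simp only [inner_add_right, inner_sub_left, inner_smul_right]
    simp only [map_mul, Complex.conj_I, Complex.conj_ofReal] at h4
    push_cast
    linear_combination -h4
  exact inner_self_eq_zero.1 h3

/-- The Kato–Rellich theorem, for infinitesimally bounded perturbations. -/
theorem SymmetricOn.kato_rellich [CompleteSpace E] (hA : SymmetricOn A A)
    (hs : ∀ μ : ℝ, μ ≠ 0 → ShiftSurjective A μ) (hB : InfinitesimallyBounded A B) :
    ∃ M : ℝ, 0 < M ∧ ∀ μ : ℝ, M ≤ |μ| → ShiftSurjective (A + B) μ := by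
  obtain ⟨C, hC0, hC⟩ := hB.bound (ε := 1 / 4) (by norm_num)
  -- For |μ| ≥ 4C both terms of ‖Bx‖ ≤ ‖Ax‖/4 + C‖x‖ are at most a quarter of ‖(A + iμ)x‖, so B(A +
  -- iμ)⁻¹ has norm at most 1/2. The extra 1 keeps μ away from zero.
  refine ⟨4 * C + 1, by positivity, fun μ hμ y => ?_⟩
  have hμ0 : 0 < |μ| := by linarith
  have hμ1 : μ ≠ 0 := abs_pos.1 hμ0
  have hex : ∀ w, ∃ x z b, (x, z) ∈ A.graph ∧ (x, b) ∈ B.graph ∧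
      z + ((μ : ℂ) * Complex.I) • x = w := fun w => by
    obtain ⟨x, z, hxz, hw⟩ := hs μ hμ1 w
    obtain ⟨b, hb⟩ := LinearPMap.mem_domain_iff.1 (hB.domain_le (mem_domain_graph hxz))
    exact ⟨x, z, b, hxz, hb, hw⟩
  choose R Z K hR hK hw using hex
  have huniq : ∀ w w', ∀ c : ℂ, K (w + c • w') = K w + c • K w' := fun w w' c => by
    have h1 := A.graph.add_mem (hR w) (A.graph.smul_mem c (hR w'))
    have h2 : R (w + c • w') = R w + c • R w' := by
      refine hA.eq_of_shift (hR _) h1 hμ1 ?_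
      rw [hw]
      simp only
      nth_rewrite 1 [← hw w, ← hw w']
      simp only [smul_add, smul_smul, Prod.smul_snd]
      rw [mul_comm c]
      abel
    have h3 := B.graph.add_mem (hK w) (B.graph.smul_mem c (hK w'))
    exact B.mem_graph_snd_inj (hK _) h3 h2
  have hKb : ∀ w, ‖K w‖ ≤ 1 / 2 * ‖w‖ := fun w => by
    have h1 := hC _ _ _ (hR w) (hK w)
    have h2 := hA.norm_le_shift (hR w) μ
    have h3 := hA.norm_image_le_shift (hR w) μ
    rw [hw] at h2 h3
    have h4 : 4 * (C * ‖R w‖) ≤ ‖w‖ := by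
      refine le_trans ?_ h2
      rw [← mul_assoc]
      gcongr
      linarith
    linarith
  let T : E →L[ℂ] E := LinearMap.mkContinuous
    { toFun := K
      map_add' := fun w w' => by simpa using huniq w w' 1
      map_smul' := fun c w => by
        have h0 : K 0 = 0 := norm_le_zero_iff.1 (by simpa using hKb 0)
        simpa [h0] using huniq 0 w c } (1 / 2) hKb
  have hT : ‖-T‖ < 1 := by
    rw [norm_neg]
    exact (LinearMap.mkContinuous_norm_le _ (by norm_num) _).trans_lt (by norm_num)
  -- The factorization A + B + iμ = (1 + T)(A + iμ), with T = B(A + iμ)⁻¹, reduces surjectivity to a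
  -- Neumann series.
  obtain ⟨u, hu⟩ := isUnit_one_sub_of_norm_lt_one hT
  obtain ⟨w, hw'⟩ : ∃ w, (1 - -T : E →L[ℂ] E) w = y :=
    ⟨(↑u⁻¹ : E →L[ℂ] E) y, by
      rw [← hu, ← mul_apply_eq_comp, Units.mul_inv, one_apply_eq_self]⟩
  refine ⟨R w, Z w + K w, mem_graph_add.2 ⟨_, _, hR w, hK w, rfl⟩, ?_⟩
  rw [← hw', sub_neg_eq_add, add_apply, one_apply_eq_self]
  change _ = w + K w
  nth_rewrite 4 [← hw w]
  abel

end Symmetric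

/-! ## Stone's theorem: existence of the unitary group -/

section Stone

variable {E : Type*} [NormedAddCommGroup E] [InnerProductSpace ℂ E]

/-- `e^{isB}` for a bounded operator `B`. -/
def boundedExp (B : E →L[ℂ] E) (s : ℝ) : E →L[ℂ] E :=
  NormedSpace.exp ((s : ℂ) • (Complex.I • B))

theorem boundedExp_zero (B : E →L[ℂ] E) : boundedExp B 0 = 1 := by
  simp [boundedExp]

theorem boundedExp_add_of_commute [CompleteSpace E] {B B' : E →L[ℂ] E} (h : Commute B B')
    (s : ℝ) : boundedExp (B + B') s = boundedExp B s * boundedExp B' s := by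
  let +nondep : NormedAlgebra ℚ (E →L[ℂ] E) := .restrictScalars ℚ ℂ _
  rw [boundedExp, smul_add, smul_add]
  exact NormedSpace.exp_add_of_commute
    ((((h.smul_left Complex.I).smul_right Complex.I).smul_left _).smul_right _)

theorem boundedExp_add [CompleteSpace E] (B : E →L[ℂ] E) (s t : ℝ) :
    boundedExp B (s + t) = boundedExp B s * boundedExp B t := by
  let +nondep : NormedAlgebra ℚ (E →L[ℂ] E) := .restrictScalars ℚ ℂ _
  rw [boundedExp, Complex.ofReal_add, add_smul]
  exact NormedSpace.exp_add_of_commute (((Commute.refl _).smul_left _).smul_right _)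

theorem norm_boundedExp_apply [CompleteSpace E] {B : E →L[ℂ] E} (hB : IsSelfAdjoint B) (s : ℝ)
    (ψ : E) : ‖boundedExp B s ψ‖ = ‖ψ‖ := by
  have hmem : boundedExp B s ∈ unitary (E →L[ℂ] E) := by
    let +nondep : NormedAlgebra ℚ (E →L[ℂ] E) := .restrictScalars ℚ ℂ _
    refine NormedSpace.exp_mem_unitary_of_mem_skewAdjoint ?_
    rw [skewAdjoint.mem_iff, star_smul, star_smul, hB.star_eq, Complex.star_def,
      Complex.conj_ofReal, Complex.conj_I, neg_smul, smul_neg]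
  exact ContinuousLinearMap.norm_map_of_mem_unitary hmem ψ

theorem hasDerivAt_boundedExp [CompleteSpace E] (B : E →L[ℂ] E) (s : ℝ) (ψ : E) :
    HasDerivAt (fun r => boundedExp B r ψ) (boundedExp B s (Complex.I • B ψ)) s := by
  have h := hasDerivAt_exp_smul_const (𝕂 := ℂ) (Complex.I • B) (s : ℂ)
  have h1 := (ContinuousLinearMap.apply ℂ E ψ).hasFDerivAt.comp_hasDerivAt (s : ℂ) h
  have h2 := HasDerivAt.scomp s h1 Complex.ofRealCLM.hasDerivAt
  refine h2.congr_deriv ?_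
  simp [boundedExp]

/-- The orbit has derivative e^{irB}(iBψ), whose norm is ‖Bψ‖ at every r by unitarity, and the mean
value inequality applies. -/
theorem norm_boundedExp_sub_le [CompleteSpace E]
    {B : E →L[ℂ] E} (hB : IsSelfAdjoint B) (s : ℝ) (ψ : E) :
    ‖boundedExp B s ψ - ψ‖ ≤ |s| * ‖B ψ‖ := by
  have h := Convex.norm_image_sub_le_of_norm_hasDerivWithin_le
    (f := fun r => boundedExp B r ψ) (s := Set.univ) (x := 0) (y := s) (C := ‖B ψ‖)
    (fun r _ => (hasDerivAt_boundedExp B r ψ).hasDerivWithinAt)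
    (fun r _ => by rw [norm_boundedExp_apply hB, norm_smul, Complex.norm_I, one_mul])
    convex_univ trivial trivial
  simpa [boundedExp_zero, mul_comm] using h

/-- The mean value inequality is applied to r ↦ e^{irB}ψ - irBψ, with derivative i(e^{irB} - 1)Bψ.
The auxiliary θ replaces ‖B(Bψ)‖ by ‖Bθ‖: when B runs through a sequence tending to A, the former
may be unbounded, whereas the latter converges for θ in D(A). -/
theorem norm_boundedExp_sub_sub_le [CompleteSpace E]
    {B : E →L[ℂ] E} (hB : IsSelfAdjoint B) (s : ℝ) (ψ θ : E) :
    ‖boundedExp B s ψ - ψ - s • (Complex.I • B ψ)‖ ≤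
      |s| * (2 * ‖B ψ - θ‖ + |s| * ‖B θ‖) := by
  have h := Convex.norm_image_sub_le_of_norm_hasDerivWithin_le
    (f := fun r => boundedExp B r ψ - r • (Complex.I • B ψ)) (s := Set.uIcc 0 s)
    (x := 0) (y := s) (C := 2 * ‖B ψ - θ‖ + |s| * ‖B θ‖)
    (f' := fun r => boundedExp B r (Complex.I • B ψ) - (1 : ℝ) • (Complex.I • B ψ))
    (fun r _ => ((hasDerivAt_boundedExp B r ψ).sub
      ((hasDerivAt_id r).smul_const _)).hasDerivWithinAt)
    (fun r hr => by
      have h1 : boundedExp B r (Complex.I • B ψ) - (1 : ℝ) • (Complex.I • B ψ) =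
          Complex.I • (boundedExp B r (B ψ - θ) - (B ψ - θ) + (boundedExp B r θ - θ)) := by
        rw [map_smul, one_smul, map_sub, ← smul_sub]
        congr 1
        abel
      have h2 : |r| ≤ |s| := by
        simpa using Set.abs_sub_left_of_mem_uIcc hr
      rw [h1, norm_smul, Complex.norm_I, one_mul]
      refine (norm_add_le _ _).trans (add_le_add ?_ ?_)
      · refine (norm_sub_le _ _).trans ?_
        rw [norm_boundedExp_apply hB, two_mul]
      · refine (norm_boundedExp_sub_le hB r θ).trans ?_
        gcongr)
    (convex_uIcc 0 s) Set.left_mem_uIcc Set.right_mem_uIcc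
  have h3 : boundedExp B s ψ - ψ - s • (Complex.I • B ψ) =
      boundedExp B s ψ - s • (Complex.I • B ψ) - ψ := by abel
  rw [h3]
  simpa [boundedExp_zero, mul_comm] using h

/-- Commutation gives e^{isB} = e^{isB'} e^{is(B - B')}; the unitary factor in front drops out of
the norm. -/
theorem norm_boundedExp_sub_boundedExp_le [CompleteSpace E]
    {B B' : E →L[ℂ] E} (hB : IsSelfAdjoint B)
    (hB' : IsSelfAdjoint B') (hc : Commute B B') (s : ℝ) (ψ : E) :
    ‖boundedExp B s ψ - boundedExp B' s ψ‖ ≤ |s| * ‖B ψ - B' ψ‖ := by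
  have h1 : Commute B' (B - B') := hc.symm.sub_right (Commute.refl _)
  have h2 : boundedExp B s = boundedExp B' s * boundedExp (B - B') s := by
    rw [← boundedExp_add_of_commute h1, add_sub_cancel]
  rw [h2, mul_apply_eq_comp, ← map_sub, norm_boundedExp_apply hB']
  exact norm_boundedExp_sub_le (hB.sub hB') s ψ

/-- If bounded commuting self-adjoint operators converge strongly to `A` on `D(A)`, then the
unitary groups that they generate converge strongly. -/
theorem exists_tendsto_boundedExp [CompleteSpace E]
    {A : E →ₗ.[ℂ] E} (hd : Dense (A.domain : Set E))
    {B : ℕ → E →L[ℂ] E} (hB : ∀ n, IsSelfAdjoint (B n)) (hc : ∀ m n, Commute (B m) (B n))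
    (hlim : ∀ x y, (x, y) ∈ A.graph → Tendsto (fun n => B n x) atTop (𝓝 y)) (s : ℝ) (ψ : E) :
    ∃ φ, Tendsto (fun n => boundedExp (B n) s ψ) atTop (𝓝 φ) := by
  refine cauchySeq_tendsto_of_complete (Metric.cauchySeq_iff.2 fun ε hε => ?_)
  obtain ⟨x, hx, hψx⟩ := Metric.mem_closure_iff.1 (hd ψ) (ε / 3) (by positivity)
  obtain ⟨y, hxy⟩ := LinearPMap.mem_domain_iff.1 hx
  have hcs := (hlim x y hxy).cauchySeq
  -- `|s| + 1` rather than `|s|`, so that s = 0 needs no separate case.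
  obtain ⟨M, hM⟩ := Metric.cauchySeq_iff.1 hcs (ε / (3 * (|s| + 1))) (by positivity)
  refine ⟨M, fun m hm n hn => ?_⟩
  have h1 := norm_boundedExp_sub_boundedExp_le (hB m) (hB n) (hc m n) s x
  have h2 := hM m hm n hn
  rw [dist_eq_norm] at h2 hψx ⊢
  have h3 : boundedExp (B m) s ψ - boundedExp (B n) s ψ =
      boundedExp (B m) s (ψ - x) + (boundedExp (B m) s x - boundedExp (B n) s x) -
        boundedExp (B n) s (ψ - x) := by
    simp only [map_sub]
    abel
  have h4 : |s| * ‖B m x - B n x‖ ≤ ε / 3 := by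
    calc |s| * ‖B m x - B n x‖ ≤ (|s| + 1) * (ε / (3 * (|s| + 1))) := by
          gcongr
          linarith
      _ = ε / 3 := by field_simp
  rw [h3]
  calc _ ≤ ‖boundedExp (B m) s (ψ - x)‖ + ‖boundedExp (B m) s x - boundedExp (B n) s x‖ +
        ‖boundedExp (B n) s (ψ - x)‖ := norm_sub_le_of_le (norm_add_le _ _) le_rfl
    _ < ε := by
      rw [norm_boundedExp_apply (hB m), norm_boundedExp_apply (hB n)]
      linarith

/-- The group law and isometry pass to the strong limit. The first-order estimates for the
approximants are uniform enough to pass to the limit too, so the limit group has derivative iA on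
D(A). Self-adjointness gives the converse: a vector with a differentiable orbit lies in D(A*). -/
theorem exists_isUnitaryGroup_of_tendsto [CompleteSpace E]
    {A : E →ₗ.[ℂ] E} (hA : IsSelfAdjoint A)
    (hd : Dense (A.domain : Set E)) {B : ℕ → E →L[ℂ] E} (hB : ∀ n, IsSelfAdjoint (B n))
    (hc : ∀ m n, Commute (B m) (B n))
    (hlim : ∀ x y, (x, y) ∈ A.graph → Tendsto (fun n => B n x) atTop (𝓝 y)) :
    ∃ U, IsUnitaryGroup A U := by
  choose V hV using exists_tendsto_boundedExp hd hB hc hlim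
  have hV0 : ∀ ψ, V 0 ψ = ψ := fun ψ => by
    refine tendsto_nhds_unique (hV 0 ψ) ?_
    simp [boundedExp_zero]
  have hVn : ∀ s ψ, ‖V s ψ‖ = ‖ψ‖ := fun s ψ => by
    refine tendsto_nhds_unique (hV s ψ).norm ?_
    simp [norm_boundedExp_apply (hB _)]
  have hVa : ∀ s ψ φ, V s (ψ + φ) = V s ψ + V s φ := fun s ψ φ => by
    refine tendsto_nhds_unique (hV s _) ?_
    simpa only [map_add] using (hV s ψ).add (hV s φ)
  have hVs : ∀ s (c : ℂ) ψ, V s (c • ψ) = c • V s ψ := fun s c ψ => by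
    refine tendsto_nhds_unique (hV s _) ?_
    simpa only [map_smul] using (hV s ψ).const_smul c
  have hVadd : ∀ s t ψ, V (s + t) ψ = V s (V t ψ) := fun s t ψ => by
    refine tendsto_nhds_unique (hV _ ψ) ?_
    have h1 : Tendsto (fun n => boundedExp (B n) s (boundedExp (B n) t ψ - V t ψ)) atTop
        (𝓝 0) := by
      rw [tendsto_zero_iff_norm_tendsto_zero]
      simp only [norm_boundedExp_apply (hB _)]
      simpa using ((hV t ψ).sub_const (V t ψ)).norm
    have h2 := h1.add (hV s (V t ψ))
    simp only [map_sub, sub_add_cancel, zero_add] at h2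
    simpa only [boundedExp_add, mul_apply_eq_comp] using h2
  let U : ℝ → E ≃ₗᵢ[ℂ] E := fun s =>
    { toFun := V s
      map_add' := hVa s
      map_smul' := hVs s
      invFun := V (-s)
      left_inv := fun ψ => by rw [← hVadd, neg_add_cancel, hV0]
      right_inv := fun ψ => by rw [← hVadd, add_neg_cancel, hV0]
      norm_map' := hVn s }
  have hU : ∀ s ψ, U s ψ = V s ψ := fun _ _ => rfl
  have hgraph : ∀ ψ θ, (ψ, θ) ∈ A.graph → ∀ s, ‖V s ψ - ψ‖ ≤ |s| * ‖θ‖ := fun ψ θ h s =>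
    le_of_tendsto_of_tendsto' ((hV s ψ).sub_const ψ).norm ((hlim ψ θ h).norm.const_mul |s|)
      fun n => norm_boundedExp_sub_le (hB n) s ψ
  have hderiv : ∀ ψ θ, (ψ, θ) ∈ A.graph → HasDerivAt (fun s => V s ψ) (Complex.I • θ) 0 := by
    intro ψ θ h
    rw [hasDerivAt_iff_isLittleO]
    refine Asymptotics.IsLittleO.of_bound fun ε hε => ?_
    -- θ = Aψ itself need not lie in D(A), so the second-order term is controlled through a nearby x
    -- that does.
    obtain ⟨x, hx, hθx⟩ := Metric.mem_closure_iff.1 (hd θ) (ε / 4) (by positivity)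
    obtain ⟨y, hxy⟩ := LinearPMap.mem_domain_iff.1 hx
    have h1 : ∀ s : ℝ, ‖V s ψ - ψ - s • (Complex.I • θ)‖ ≤
        |s| * (2 * ‖θ - x‖ + |s| * ‖y‖) := fun s =>
      le_of_tendsto_of_tendsto'
        (((hV s ψ).sub_const ψ).sub (((hlim ψ θ h).const_smul Complex.I).const_smul s)).norm
        (((((hlim ψ θ h).sub_const x).norm.const_mul 2).add
          ((hlim x y hxy).norm.const_mul |s|)).const_mul |s|)
        fun n => norm_boundedExp_sub_sub_le (hB n) s ψ x
    have h2 : ∀ᶠ s : ℝ in 𝓝 0, |s| * ‖y‖ < ε / 2 := by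
      have h3 : Continuous fun s : ℝ => |s| * ‖y‖ := by fun_prop
      exact h3.continuousAt.eventually_lt continuousAt_const (by simpa using by positivity)
    filter_upwards [h2] with s hs
    rw [dist_eq_norm] at hθx
    rw [hV0, sub_zero, Real.norm_eq_abs, mul_comm ε]
    refine (h1 s).trans ?_
    gcongr
    linarith
  have hcont0 : ∀ ψ, Tendsto (fun s => V s ψ) (𝓝 0) (𝓝 ψ) := by
    intro ψ
    rw [Metric.tendsto_nhds]
    intro ε hε
    obtain ⟨x, hx, hψx⟩ := Metric.mem_closure_iff.1 (hd ψ) (ε / 4) (by positivity)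
    obtain ⟨y, hxy⟩ := LinearPMap.mem_domain_iff.1 hx
    have h2 : ∀ᶠ s : ℝ in 𝓝 0, |s| * ‖y‖ < ε / 2 := by
      have h3 : Continuous fun s : ℝ => |s| * ‖y‖ := by fun_prop
      exact h3.continuousAt.eventually_lt continuousAt_const (by simpa using by positivity)
    filter_upwards [h2] with s hs
    rw [dist_eq_norm] at hψx ⊢
    have h4 : V s ψ - ψ = V s (ψ - x) + (V s x - x) - (ψ - x) := by
      simp only [← hU, map_sub]
      abel
    rw [h4]
    calc _ ≤ ‖V s (ψ - x)‖ + ‖V s x - x‖ + ‖ψ - x‖ := norm_sub_le_of_le (norm_add_le _ _) le_rfl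
      _ < ε := by
        rw [hVn]
        linarith [hgraph x y hxy s]
  refine ⟨U, hV0, hVadd, fun ψ => ?_, fun ψ θ => ⟨hderiv ψ θ, fun h => ?_⟩⟩
  · rw [continuous_iff_continuousAt]
    intro s
    have h1 : Tendsto (fun r : ℝ => V (r - s) (V s ψ)) (𝓝 s) (𝓝 (V s ψ)) := by
      refine (hcont0 (V s ψ)).comp ?_
      have : Continuous fun r : ℝ => r - s := by fun_prop
      simpa using this.tendsto s
    simpa [← hVadd] using! h1
  -- Membership is tested in the graph of A* = A. For (a, b) in the graph of A, both sides of ⟨a,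
  -- V_s ψ⟩ = ⟨V_{-s} a, ψ⟩ are differentiated at s = 0.
  · rw [← LinearPMap.isSelfAdjoint_def.1 hA, LinearPMap.adjoint_graph_eq_graph_adjoint hd,
      Submodule.mem_adjoint_iff]
    intro a b hab
    have h1 : HasDerivAt (fun s => inner ℂ a (V s ψ)) (inner ℂ a (Complex.I • θ)) 0 := by
      have := (hasDerivAt_const (0 : ℝ) a).inner ℂ h
      rwa [inner_zero_left, add_zero] at this
    have h2 : HasDerivAt (fun s => inner ℂ (V (-s) a) ψ) (inner ℂ (-(Complex.I • b)) ψ) 0 := by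
      have h3 : HasDerivAt (fun s : ℝ => V (-s) a) (-(Complex.I • b)) 0 := by
        have h4 := HasDerivAt.scomp (h := fun s : ℝ => -s) (h' := -1) 0
          (by simpa using hderiv a b hab) (by simpa using hasDerivAt_neg (0 : ℝ))
        simpa [Function.comp_def] using h4
      have := h3.inner ℂ (hasDerivAt_const (0 : ℝ) ψ)
      simpa using this
    have h5 : (fun s => inner ℂ a (V s ψ)) = fun s => inner ℂ (V (-s) a) ψ := by
      funext s
      rw [← hU (-s) a, ← (U s).inner_map_map (U (-s) a) ψ, hU, hU, hU, ← hVadd, add_neg_cancel,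
        hV0]
    rw [h5] at h1
    have h6 := h1.unique h2
    rw [inner_smul_right, inner_neg_left, inner_smul_left, Complex.conj_I] at h6
    have h7 : Complex.I * (inner ℂ a θ - inner ℂ b ψ) = 0 := by linear_combination h6
    rcases mul_eq_zero.1 h7 with h8 | h8
    · exact absurd h8 Complex.I_ne_zero
    · simp only
      linear_combination -h8

/-! ### Resolvents and bounded approximations of a self-adjoint operator. -/

/-- The resolvent `(A + iμ)⁻¹` of a symmetric operator. -/
theorem SymmetricOn.exists_resolvent {A : E →ₗ.[ℂ] E} (hA : SymmetricOn A A) {μ : ℝ}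
    (hμ : μ ≠ 0) (hs : ShiftSurjective A μ) : ∃ R : E →L[ℂ] E, (∀ y, ‖R y‖ ≤ |μ|⁻¹ * ‖y‖) ∧
      (∀ y, (R y, y - ((μ : ℂ) * Complex.I) • R y) ∈ A.graph) ∧
      ∀ x z, (x, z) ∈ A.graph → R (z + ((μ : ℂ) * Complex.I) • x) = x := by
  choose R Z hR hw using hs
  have hlin : ∀ w w', ∀ c : ℂ, R (w + c • w') = R w + c • R w' := fun w w' c => by
    have h1 := A.graph.add_mem (hR w) (A.graph.smul_mem c (hR w'))
    refine hA.eq_of_shift (hR _) h1 hμ ?_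
    rw [hw]
    simp only
    nth_rewrite 1 [← hw w, ← hw w']
    simp only [smul_add, smul_smul, Prod.smul_snd]
    rw [mul_comm c]
    abel
  have hb : ∀ y, ‖R y‖ ≤ |μ|⁻¹ * ‖y‖ := fun y => by
    have h := hA.norm_le_shift (hR y) μ
    rw [hw] at h
    rwa [le_inv_mul_iff₀ (abs_pos.2 hμ)]
  have h0 : R 0 = 0 := norm_le_zero_iff.1 (by simpa using hb 0)
  refine ⟨LinearMap.mkContinuous
    { toFun := R
      map_add' := fun w w' => by simpa using hlin w w' 1
      map_smul' := fun c w => by simpa [h0] using hlin 0 w c } |μ|⁻¹ hb, hb, fun y => ?_,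
    fun x z h => ?_⟩
  · change (R y, y - _ • R y) ∈ A.graph
    rw [show y - ((μ : ℂ) * Complex.I) • R y = Z y by rw [sub_eq_iff_eq_add]; exact (hw y).symm]
    exact hR y
  · exact hA.eq_of_shift (hR _) h hμ (hw _)

/-- A self-adjoint operator generates a unitary group. -/
theorem SymmetricOn.exists_isUnitaryGroup [CompleteSpace E]
    {A : E →ₗ.[ℂ] E} (hA : SymmetricOn A A) {M : ℝ}
    (hM : 0 < M) (hs : ∀ μ : ℝ, M ≤ |μ| → ShiftSurjective A μ) : ∃ U, IsUnitaryGroup A U := by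
  have hne : ∀ μ : ℝ, M ≤ |μ| → μ ≠ 0 := fun μ h => abs_pos.1 (hM.trans_le h)
  have hM' : M ≤ |M| := le_abs_self M
  have hd := hA.dense_domain (hne M hM') (hs M hM')
  have hsa := hA.isSelfAdjoint (hne M hM') (hs M hM') (hs (-M) (by rwa [abs_neg]))
  have hex : ∀ μ : ℝ, ∃ R : E →L[ℂ] E, M ≤ |μ| → (∀ y, ‖R y‖ ≤ |μ|⁻¹ * ‖y‖) ∧
      (∀ y, (R y, y - ((μ : ℂ) * Complex.I) • R y) ∈ A.graph) ∧
      ∀ x z, (x, z) ∈ A.graph → R (z + ((μ : ℂ) * Complex.I) • x) = x := fun μ => by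
    by_cases h : M ≤ |μ|
    · obtain ⟨R, hR⟩ := hA.exists_resolvent (hne μ h) (hs μ h)
      exact ⟨R, fun _ => hR⟩
    · exact ⟨0, fun h' => absurd h' h⟩
  choose R hR using hex
  have hcommA : ∀ μ, M ≤ |μ| → ∀ x z, (x, z) ∈ A.graph → (R μ x, R μ z) ∈ A.graph := by
    intro μ hμ x z hxz
    have h1 := (hR μ hμ).2.1 x
    have h2 := (hR μ hμ).2.2 x z hxz
    rw [map_add, map_smul] at h2
    rwa [show R μ z = x - ((μ : ℂ) * Complex.I) • R μ x from eq_sub_of_add_eq h2]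
  have hcomm : ∀ μ ν, M ≤ |μ| → M ≤ |ν| → Commute (R μ) (R ν) := by
    intro μ ν hμ hν
    ext y
    simp only [mul_apply_eq_comp]
    have h1 := hcommA ν hν _ _ ((hR μ hμ).2.1 y)
    have h2 := (hR μ hμ).2.2 _ _ h1
    rwa [← map_smul (R ν), ← map_add (R ν), sub_add_cancel] at h2
  -- The adjoint of R(μ) is R(-μ), hence R(μ) + R(-μ) is self-adjoint.
  have hadj : ∀ μ, M ≤ |μ| → ∀ x y, inner ℂ (R μ x) y = inner ℂ x (R (-μ) y) := by
    intro μ hμ x y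
    have hμ' : M ≤ |-μ| := by rwa [abs_neg]
    have h1 := hA.inner_eq ((hR μ hμ).2.1 x) ((hR (-μ) hμ').2.1 y)
    simp only [inner_sub_left, inner_sub_right, inner_smul_left, inner_smul_right, map_mul,
      Complex.conj_I, Complex.conj_ofReal] at h1
    push_cast at h1
    linear_combination -h1
  -- On D(A) one has iu R(u)w = w - R(u)Aw, which tends to w. The contraction bound ‖iu R(u)‖ ≤ 1
  -- extends the limit to all vectors by density.
  have hres : ∀ x y, (x, y) ∈ A.graph → ∀ u : ℕ → ℝ, (∀ n, M ≤ |u n|) →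
      Tendsto (fun n => |u n|) atTop atTop →
      Tendsto (fun n => ((u n : ℂ) * Complex.I) • R (u n) y) atTop (𝓝 y) := by
    intro x y _ u hu hut
    rw [Metric.tendsto_nhds]
    intro ε hε
    obtain ⟨w, hw, hyw⟩ := Metric.mem_closure_iff.1 (hd y) (ε / 4) (by positivity)
    obtain ⟨z, hwz⟩ := LinearPMap.mem_domain_iff.1 hw
    have hsm : ∀ᶠ n in atTop, |u n|⁻¹ * ‖z‖ < ε / 2 := by
      have h1 : Tendsto (fun n => |u n|⁻¹ * ‖z‖) atTop (𝓝 (0 * ‖z‖)) :=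
        (tendsto_inv_atTop_zero.comp hut).mul_const _
      rw [zero_mul] at h1
      exact h1.eventually_lt_const (by positivity)
    filter_upwards [hsm] with n hn
    rw [dist_eq_norm] at hyw ⊢
    have h1 := (hR (u n) (hu n)).2.2 w z hwz
    have h2 : ((u n : ℂ) * Complex.I) • R (u n) y - y =
        ((u n : ℂ) * Complex.I) • R (u n) (y - w) - R (u n) z - (y - w) := by
      have h3 : ((u n : ℂ) * Complex.I) • R (u n) w = w - R (u n) z := by
        rw [eq_sub_iff_add_eq, add_comm, ← map_smul, ← map_add, h1]
      rw [map_sub, smul_sub, h3]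
      abel
    have h4 : ‖((u n : ℂ) * Complex.I) • R (u n) (y - w)‖ ≤ ‖y - w‖ := by
      rw [norm_smul, norm_mul, Complex.norm_I, mul_one, Complex.norm_real, Real.norm_eq_abs]
      have h5 := (hR (u n) (hu n)).1 (y - w)
      rwa [le_inv_mul_iff₀ (hM.trans_le (hu n))] at h5
    rw [h2]
    calc _ ≤ ‖((u n : ℂ) * Complex.I) • R (u n) (y - w)‖ + ‖R (u n) z‖ + ‖y - w‖ :=
          norm_sub_le_of_le (norm_sub_le _ _) le_rfl
      _ < ε := by linarith [(hR (u n) (hu n)).1 z]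
  let u : ℕ → ℝ := fun n => M + n
  have hu0 : ∀ n, 0 ≤ u n := fun n => by positivity
  have hu : ∀ n, M ≤ |u n| := fun n => by
    rw [abs_of_nonneg (hu0 n)]
    simp [u]
  have hu' : ∀ n, M ≤ |-u n| := fun n => by rw [abs_neg]; exact hu n
  have hut : Tendsto (fun n => |u n|) atTop atTop := by
    simp only [abs_of_nonneg (hu0 _)]
    exact tendsto_atTop_add_const_left _ _ tendsto_natCast_atTop_atTop
  have hut' : Tendsto (fun n => |-u n|) atTop atTop := by simpa only [abs_neg] using hut
  -- Formally this is u²A(A² + u²)⁻¹, a bounded self-adjoint truncation of A. On D(A) it equals the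
  -- mean of iuR(u)Ax and -iuR(-u)Ax, and both of these tend to Ax.
  let B : ℕ → E →L[ℂ] E := fun n => ((u n ^ 2 / 2 : ℝ) : ℂ) • (R (u n) + R (-u n))
  refine exists_isUnitaryGroup_of_tendsto hsa hd (B := B) (fun n => ?_) (fun m n => ?_) ?_
  · rw [ContinuousLinearMap.isSelfAdjoint_iff_isSymmetric]
    intro x y
    have h1 := hadj (u n) (hu n) x y
    have h2 := hadj (-u n) (hu' n) x y
    rw [neg_neg] at h2
    change inner ℂ (((u n ^ 2 / 2 : ℝ) : ℂ) • (R (u n) x + R (-u n) x)) y =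
      inner ℂ x (((u n ^ 2 / 2 : ℝ) : ℂ) • (R (u n) y + R (-u n) y))
    rw [inner_smul_left, inner_smul_right, Complex.conj_ofReal, inner_add_left, inner_add_right,
      h1, h2, add_comm]
  · refine Commute.smul_left (Commute.smul_right ?_ _) _
    exact ((hcomm _ _ (hu m) (hu n)).add_right (hcomm _ _ (hu m) (hu' n))).add_left
      ((hcomm _ _ (hu' m) (hu n)).add_right (hcomm _ _ (hu' m) (hu' n)))
  · intro x y hxy
    have h1 := (hres x y hxy u hu hut).add (hres x y hxy (fun n => -u n) hu' hut')
    have h2 := h1.const_smul (2⁻¹ : ℂ)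
    rw [← two_smul ℂ y, inv_smul_smul₀ two_ne_zero] at h2
    refine h2.congr fun n => ?_
    have h3 : ∀ μ, M ≤ |μ| → ((μ : ℂ) * Complex.I) • R μ y =
        ((μ : ℂ) * Complex.I) • x + ((μ : ℂ) ^ 2) • R μ x := fun μ hμ => by
      have h4 := (hR μ hμ).2.2 x y hxy
      rw [map_add, map_smul] at h4
      rw [eq_sub_of_add_eq h4, smul_sub, smul_smul,
        show (μ : ℂ) * Complex.I * ((μ : ℂ) * Complex.I) = -(μ : ℂ) ^ 2 by
          linear_combination (μ : ℂ) ^ 2 * Complex.I_mul_I]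
      rw [neg_smul, sub_neg_eq_add]
    rw [h3 _ (hu n), h3 _ (hu' n)]
    change _ = ((u n ^ 2 / 2 : ℝ) : ℂ) • (R (u n) x + R (-u n) x)
    push_cast
    module

variable {A : E →ₗ.[ℂ] E} {U : ℝ → E ≃ₗᵢ[ℂ] E}

/-- A unitary group preserves the domain of its generator, and commutes with it. -/
theorem IsUnitaryGroup.graph_mem (hU : IsUnitaryGroup A U) (s : ℝ) {ψ θ : E}
    (h : (ψ, θ) ∈ A.graph) : (U s ψ, U s θ) ∈ A.graph := by
  rw [hU.generator] at h ⊢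
  have h1 := ((U s).toContinuousLinearEquiv : E →L[ℂ] E).restrictScalars ℝ |>.hasFDerivAt
    |>.comp_hasDerivAt (0 : ℝ) h
  refine (h1.congr_deriv ?_).congr_of_eventuallyEq (Eventually.of_forall fun r => ?_)
  · simp
  · simp only [Function.comp_apply, ← hU.add, add_comm r s]
    simp [hU.add]

end Stone

/-! ## Wave functions of `n` photons -/

section Sectors

theorem inner_def_L2 {α V : Type*} [MeasurableSpace α] {μ : Measure α} [NormedAddCommGroup V]
    [InnerProductSpace ℂ V] (f g : Lp V 2 μ) :
    (inner ℂ f g : ℂ) = ∫ a, inner ℂ (f a) (g a) ∂μ := rfl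

theorem enorm_sq_eq_lintegral {α V : Type*} [MeasurableSpace α] {μ : Measure α}
    [NormedAddCommGroup V] (f : Lp V 2 μ) : ‖f‖ₑ ^ 2 = ∫⁻ a, ‖f a‖ₑ ^ 2 ∂μ := by
  rw [Lp.enorm_def, eLpNorm_eq_lintegral_rpow_enorm_toReal two_ne_zero ENNReal.ofNat_ne_top,
    ← ENNReal.rpow_natCast, ← ENNReal.rpow_mul]
  simp

theorem lintegral_mul_sq_le {α : Type*} [MeasurableSpace α] {μ : Measure α} {u v : α → ENNReal}
    (hu : AEMeasurable u μ) (hv : AEMeasurable v μ) :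
    (∫⁻ a, u a * v a ∂μ) ^ 2 ≤ (∫⁻ a, u a ^ 2 ∂μ) * ∫⁻ a, v a ^ 2 ∂μ := by
  have h := ENNReal.lintegral_mul_le_Lp_mul_Lq μ Real.HolderConjugate.two_two hu hv
  refine (pow_le_pow_left' h 2).trans_eq ?_
  rw [mul_pow, ← ENNReal.rpow_natCast, ← ENNReal.rpow_natCast, ← ENNReal.rpow_mul,
    ← ENNReal.rpow_mul]
  norm_num

theorem ae_head {n : ℕ} {p : R3 → Prop} (h : ∀ᵐ k, p k) :
    ∀ᵐ k : Fin (n + 1) → R3, p (k 0) :=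
  (Measure.quasiMeasurePreserving_fst.comp
    (measurePreserving_cons n).quasiMeasurePreserving).ae h

theorem measurableEmbedding_cons (n : ℕ) :
    MeasurableEmbedding fun k : Fin (n + 1) → R3 => (k 0, Fin.tail k) :=
  (MeasurableEquiv.piFinSuccAbove (fun _ : Fin (n + 1) => R3) 0).measurableEmbedding

theorem lintegral_cons_mul {n : ℕ} {u : R3 → ENNReal} {v : (Fin n → R3) → ENNReal}
    (hu : AEMeasurable u volume) (hv : AEMeasurable v volume) :
    ∫⁻ k : Fin (n + 1) → R3, u (k 0) * v (Fin.tail k) = (∫⁻ k, u k) * ∫⁻ k, v k := by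
  rw [← lintegral_prod_mul hu hv]
  exact (measurePreserving_cons n).lintegral_comp_emb (measurableEmbedding_cons n)
    fun p : R3 × (Fin n → R3) => u p.1 * v p.2

theorem aemeasurable_cons_mul {n : ℕ} {u : R3 → ENNReal} {v : (Fin n → R3) → ENNReal}
    (hu : AEMeasurable u volume) (hv : AEMeasurable v volume) :
    AEMeasurable (fun k : Fin (n + 1) → R3 => u (k 0) * v (Fin.tail k)) volume := by
  have h1 : AEMeasurable (fun k : Fin (n + 1) → R3 => u (k 0)) volume :=
    hu.comp_quasiMeasurePreserving (Measure.quasiMeasurePreserving_fst.comp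
      (measurePreserving_cons n).quasiMeasurePreserving)
  have h2 : AEMeasurable (fun k : Fin (n + 1) → R3 => v (Fin.tail k)) volume :=
    hv.comp_quasiMeasurePreserving (Measure.quasiMeasurePreserving_snd.comp
      (measurePreserving_cons n).quasiMeasurePreserving)
  exact h1.mul h2

theorem inner_tensFun {n : ℕ} (f g : R3 → C3) (Ψ Φ : (Fin n → R3) → Pol n)
    (k : Fin (n + 1) → R3) : (inner ℂ (tensFun f Ψ k) (tensFun g Φ k) : ℂ) =
      inner ℂ (f (k 0)) (g (k 0)) * inner ℂ (Ψ (Fin.tail k)) (Φ (Fin.tail k)) := by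
  simp only [PiLp.inner_apply]
  rw [Finset.sum_mul_sum, ← Finset.sum_product',
    ← (Fin.consEquiv (fun _ : Fin (n + 1) => Fin 3)).sum_comp]
  refine Finset.sum_congr rfl fun p _ => ?_
  simp [tensFun, Fin.consEquiv]
  ring

theorem inner_tens {n : ℕ} (f g : photon) (Ψ Φ : sector n) :
    (inner ℂ (tens f Ψ) (tens g Φ) : ℂ) = inner ℂ f g * inner ℂ Ψ Φ := by
  rw [Submodule.coe_inner, Submodule.coe_inner, inner_def_L2, inner_def_L2, inner_def_L2,
    ← integral_prod_mul]
  rw [← (measurePreserving_cons n).integral_comp (measurableEmbedding_cons n)]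
  refine integral_congr_ae ?_
  filter_upwards [coeFn_tens f Ψ, coeFn_tens g Φ] with k h1 h2
  rw [h1, h2, inner_tensFun]

theorem tens_smul_left {n : ℕ} (c : ℂ) (f : photon) (Ψ : sector n) :
    tens (c • f) Ψ = c • tens f Ψ := by
  refine Lp.ext ?_
  filter_upwards [coeFn_tens (c • f) Ψ, coeFn_tens f Ψ, Lp.coeFn_smul c (tens f Ψ),
    ae_head (Lp.coeFn_smul c f.1)] with k h1 h2 h3 h4
  rw [h3, Pi.smul_apply, h1, h2]
  ext a
  simp only [tensFun, Submodule.coe_smul, h4, Pi.smul_apply, PiLp.smul_apply, smul_eq_mul,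
    mul_assoc]

theorem create_apply (f : photon) (n : ℕ) (Ψ : sector n) :
    create f n Ψ = ((Real.sqrt (n + 1) : ℝ) : ℂ) •
      (sector (n + 1)).orthogonalProjectionOnto (tens f Ψ) := rfl

theorem sector_inner_smul_right {n : ℕ} (c : ℂ) (Φ Ψ : sector n) :
    (inner ℂ Φ (c • Ψ) : ℂ) = c * inner ℂ Φ Ψ := inner_smul_right Φ Ψ c

theorem sector_inner_smul_left {n : ℕ} (c : ℂ) (Φ Ψ : sector n) :
    (inner ℂ (c • Φ) Ψ : ℂ) = (starRingEnd ℂ) c * inner ℂ Φ Ψ := inner_smul_left Φ Ψ c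

/-- Against a vector that is already symmetric and transverse, the orthogonal projection is
invisible. Matrix elements of a*(f) can thus be computed with the unsymmetrized product. -/
theorem inner_create (f : photon) (n : ℕ) (Φ : sector (n + 1)) (Ψ : sector n) :
    (inner ℂ Φ (create f n Ψ) : ℂ) =
      ((Real.sqrt (n + 1) : ℝ) : ℂ) * inner ℂ (Φ : L2n (n + 1)) (tens f Ψ) := by
  rw [create_apply, sector_inner_smul_right, Submodule.inner_orthogonalProjectionOnto_eq_of_mem_left]

theorem create_smul_left (c : ℂ) (f : photon) (n : ℕ) (Ψ : sector n) :
    create (c • f) n Ψ = c • create f n Ψ := by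
  rw [create_apply, create_apply, tens_smul_left, map_smul, smul_comm]

theorem inner_annihilate (f : photon) (n : ℕ) (Φ : sector (n + 1)) (Ψ : sector n) :
    (inner ℂ (annihilate f n Φ) Ψ : ℂ) = inner ℂ Φ (create f n Ψ) :=
  ContinuousLinearMap.adjoint_inner_left _ _ _

theorem annihilate_smul_left (c : ℂ) (f : photon) (n : ℕ) (Ψ : sector (n + 1)) :
    annihilate (c • f) n Ψ = (starRingEnd ℂ) c • annihilate f n Ψ := by
  refine ext_inner_right ℂ fun Φ => ?_
  rw [inner_annihilate, create_smul_left, sector_inner_smul_right, sector_inner_smul_left,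
    inner_annihilate, Complex.conj_conj]

theorem norm_create_le (f : photon) (n : ℕ) (Ψ : sector n) :
    ‖create f n Ψ‖ ≤ Real.sqrt (n + 1) * (‖f‖ * ‖Ψ‖) := by
  rw [create_apply, norm_smul, Complex.norm_real, Real.norm_of_nonneg (Real.sqrt_nonneg _),
    ← norm_tens]
  gcongr
  exact (sector (n + 1)).norm_orthogonalProjectionOnto_apply_le _

/-! ### Energy estimates for creation and annihilation operators. -/

/-- `f = |k|^{1/2} g`. -/
def SqrtEnergyMul (f g : photon) : Prop :=
  ∀ᵐ k, f.1 k = ((Real.sqrt ‖k‖ : ℝ) : ℂ) • g.1 k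

theorem SqrtEnergyMul.smul {f g : photon} (h : SqrtEnergyMul f g) (c : ℂ) :
    SqrtEnergyMul (c • f) (c • g) := by
  filter_upwards [h, Lp.coeFn_smul c f.1, Lp.coeFn_smul c g.1] with k h1 h2 h3
  rw [Submodule.coe_smul, Submodule.coe_smul, h2, h3, Pi.smul_apply, Pi.smul_apply, h1, smul_comm]

theorem SqrtEnergyMul.enorm_sq {f g : photon} (h : SqrtEnergyMul f g) :
    ∀ᵐ k, ‖f.1 k‖ₑ ^ 2 = ‖k‖ₑ * ‖g.1 k‖ₑ ^ 2 := by
  filter_upwards [h] with k hk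
  rw [hk, enorm_smul, mul_pow]
  congr 1
  rw [← ofReal_norm, Complex.norm_real, Real.norm_of_nonneg (Real.sqrt_nonneg _),
    ← ENNReal.ofReal_pow (Real.sqrt_nonneg _), Real.sq_sqrt (norm_nonneg _), ofReal_norm]

theorem enorm_inner_tens_le {n : ℕ} (Φ : L2n (n + 1)) (f : photon) (Ψ : sector n) :
    ‖(inner ℂ Φ (tens f Ψ) : ℂ)‖ₑ ≤
      ∫⁻ k, ‖Φ k‖ₑ * (‖f.1 (k 0)‖ₑ * ‖Ψ.1 (Fin.tail k)‖ₑ) := by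
  rw [inner_def_L2]
  refine (enorm_integral_le_lintegral_enorm _).trans (lintegral_mono_ae ?_)
  filter_upwards [coeFn_tens f Ψ] with k hk
  rw [hk, ← ofReal_norm]
  refine (ENNReal.ofReal_le_ofReal (norm_inner_le_norm _ _)).trans_eq ?_
  rw [norm_tensFun, ENNReal.ofReal_mul (norm_nonneg _), ENNReal.ofReal_mul (norm_nonneg _),
    ofReal_norm, ofReal_norm, ofReal_norm]

/-- A Cauchy–Schwarz inequality in which the factor |k₀|^{1/2} contained in f is shared between the
two sides as a^{1/2} b^{1/2}. Two choices of the weights yield the annihilation and the creation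
estimates. -/
theorem enorm_inner_tens_sq_le {n : ℕ} (Φ : L2n (n + 1)) {f g : photon} (h : SqrtEnergyMul f g)
    (Ψ : sector n) {a b : (Fin (n + 1) → R3) → ENNReal} (ha : Measurable a) (hb : Measurable b)
    (hab : ∀ k, ‖k 0‖ₑ ≤ a k * b k) :
    ‖(inner ℂ Φ (tens f Ψ) : ℂ)‖ₑ ^ 2 ≤ (∫⁻ k, a k * ‖Φ k‖ₑ ^ 2) *
      ∫⁻ k, b k * (‖g.1 (k 0)‖ₑ ^ 2 * ‖Ψ.1 (Fin.tail k)‖ₑ ^ 2) := by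
  have hsq : ∀ z : ENNReal, (z ^ (1 / 2 : ℝ)) ^ 2 = z := fun z => by
    rw [← ENNReal.rpow_natCast, ← ENNReal.rpow_mul]
    norm_num
  have hΦ : AEMeasurable (fun k => ‖Φ k‖ₑ) volume := (Lp.aestronglyMeasurable Φ).enorm
  have hg : AEMeasurable (fun k => ‖g.1 k‖ₑ) volume := (Lp.aestronglyMeasurable g.1).enorm
  have hΨ : AEMeasurable (fun k => ‖Ψ.1 k‖ₑ) volume := (Lp.aestronglyMeasurable Ψ.1).enorm
  have h1 : ‖(inner ℂ Φ (tens f Ψ) : ℂ)‖ₑ ≤ ∫⁻ k, (a k ^ (1 / 2 : ℝ) * ‖Φ k‖ₑ) *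
      (b k ^ (1 / 2 : ℝ) * (‖g.1 (k 0)‖ₑ * ‖Ψ.1 (Fin.tail k)‖ₑ)) := by
    refine (enorm_inner_tens_le Φ f Ψ).trans (lintegral_mono_ae ?_)
    filter_upwards [ae_head h.enorm_sq] with k hk
    have h2 : ‖f.1 (k 0)‖ₑ ≤ a k ^ (1 / 2 : ℝ) * b k ^ (1 / 2 : ℝ) * ‖g.1 (k 0)‖ₑ := by
      have h3 : ‖f.1 (k 0)‖ₑ = ((‖f.1 (k 0)‖ₑ) ^ 2) ^ (1 / 2 : ℝ) := by
        rw [← ENNReal.rpow_natCast, ← ENNReal.rpow_mul]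
        norm_num
      have h4 : ‖g.1 (k 0)‖ₑ = ((‖g.1 (k 0)‖ₑ) ^ 2) ^ (1 / 2 : ℝ) := by
        rw [← ENNReal.rpow_natCast, ← ENNReal.rpow_mul]
        norm_num
      rw [h3, h4, hk, ← ENNReal.mul_rpow_of_nonneg _ _ (by norm_num),
        ← ENNReal.mul_rpow_of_nonneg _ _ (by norm_num)]
      gcongr
      exact hab k
    calc ‖Φ k‖ₑ * (‖f.1 (k 0)‖ₑ * ‖Ψ.1 (Fin.tail k)‖ₑ)
        ≤ ‖Φ k‖ₑ * (a k ^ (1 / 2 : ℝ) * b k ^ (1 / 2 : ℝ) * ‖g.1 (k 0)‖ₑ *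
          ‖Ψ.1 (Fin.tail k)‖ₑ) := by gcongr
      _ = _ := by ring
  refine (pow_le_pow_left' h1 2).trans ((lintegral_mul_sq_le
    ((ha.aemeasurable.pow_const _).mul hΦ)
    ((hb.aemeasurable.pow_const _).mul (aemeasurable_cons_mul hg hΨ))).trans_eq ?_)
  simp only [mul_pow, hsq, Pi.mul_apply]

/-- The total energy `|k₁| + ⋯ + |kₙ|`. -/
def totalEnergy {n : ℕ} (k : Fin n → R3) : ENNReal := ∑ i, ‖k i‖ₑ

theorem measurable_totalEnergy (n : ℕ) : Measurable (totalEnergy (n := n)) := by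
  unfold totalEnergy
  fun_prop

theorem totalEnergy_comp {n : ℕ} (σ : Equiv.Perm (Fin n)) (k : Fin n → R3) :
    totalEnergy (k ∘ σ) = totalEnergy k := by
  exact Equiv.sum_comp σ fun i => ‖k i‖ₑ

theorem enorm_comp_perm {n : ℕ} (Φ : sector n) (σ : Equiv.Perm (Fin n)) :
    ∀ᵐ k, ‖Φ.1 (k ∘ σ)‖ₑ = ‖Φ.1 k‖ₑ := by
  filter_upwards [Φ.2.1 σ] with k hk
  have h : ‖Φ.1 (k ∘ σ)‖ ^ 2 = ‖Φ.1 k‖ ^ 2 := by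
    rw [EuclideanSpace.norm_sq_eq, EuclideanSpace.norm_sq_eq,
      ← (Equiv.arrowCongr σ.symm (Equiv.refl (Fin 3))).sum_comp]
    refine Finset.sum_congr rfl fun a _ => ?_
    rw [← hk a]
    rfl
  rw [← ofReal_norm, ← ofReal_norm, (pow_left_inj₀ (norm_nonneg _) (norm_nonneg _) two_ne_zero).1 h]

/-- By permutation symmetry every photon contributes as much as the first. The factor n + 1 coming
from the square of √(n+1) in a*(f) is therefore absorbed into the total energy. -/
theorem lintegral_head_eq {n : ℕ} (Φ : sector (n + 1)) {m : (Fin (n + 1) → R3) → ENNReal}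
    (hm : Measurable m) (hs : ∀ (σ : Equiv.Perm (Fin (n + 1))) k, m (k ∘ σ) = m k) :
    ((n + 1 : ℕ) : ENNReal) * ∫⁻ k, ‖k 0‖ₑ * m k * ‖Φ.1 k‖ₑ ^ 2 =
      ∫⁻ k, totalEnergy k * m k * ‖Φ.1 k‖ₑ ^ 2 := by
  have hΦ : AEMeasurable (fun k => ‖Φ.1 k‖ₑ ^ 2) volume :=
    (Lp.aestronglyMeasurable Φ.1).enorm.pow_const 2
  have hmeas : ∀ i : Fin (n + 1), AEMeasurable (fun k : Fin (n + 1) → R3 =>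
      ‖k i‖ₑ * m k * ‖Φ.1 k‖ₑ ^ 2) volume := fun i => by
    have : Measurable fun k : Fin (n + 1) → R3 => ‖k i‖ₑ := by fun_prop
    exact (this.aemeasurable.mul hm.aemeasurable).mul hΦ
  have h1 : ∀ i : Fin (n + 1), ∫⁻ k : Fin (n + 1) → R3, ‖k i‖ₑ * m k * ‖Φ.1 k‖ₑ ^ 2 =
      ∫⁻ k : Fin (n + 1) → R3, ‖k 0‖ₑ * m k * ‖Φ.1 k‖ₑ ^ 2 := fun i => by
    have h2 := (measurePreserving_perm (Equiv.swap 0 i)).map_eq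
    have h3 := lintegral_map' (μ := volume) (g := fun k : Fin (n + 1) → R3 => k ∘ Equiv.swap 0 i)
      (f := fun k => ‖k 0‖ₑ * m k * ‖Φ.1 k‖ₑ ^ 2) (by rw [h2]; exact hmeas 0)
      (measurePreserving_perm (Equiv.swap 0 i)).measurable.aemeasurable
    rw [h2] at h3
    rw [h3]
    refine lintegral_congr_ae ?_
    filter_upwards [enorm_comp_perm Φ (Equiv.swap 0 i)] with k hk
    rw [hk, hs, Function.comp_apply, Equiv.swap_apply_left]
  simp only [totalEnergy, Finset.sum_mul]
  rw [lintegral_finsetSum' _ fun i _ => hmeas i, Finset.sum_congr rfl fun i _ => h1 i]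
  simp

/-- `∫ (|k₁| + ⋯ + |kₙ|) |Ψ|²`. -/
def energyForm {n : ℕ} (Ψ : sector n) : ENNReal := ∫⁻ k, totalEnergy k * ‖Ψ.1 k‖ₑ ^ 2

/-- With Θ = dΓ(|k|)Ψ the left side is the integral of |Ψ||Θ|, and Cauchy–Schwarz applies. -/
theorem energyForm_le {n : ℕ} {Ψ Θ : sector n}
    (h : ∀ᵐ k, Θ.1 k = ((∑ i, ‖k i‖ : ℝ) : ℂ) • Ψ.1 k) : energyForm Ψ ≤ ‖Ψ‖ₑ * ‖Θ‖ₑ := by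
  have hΨ : AEMeasurable (fun k => ‖Ψ.1 k‖ₑ) volume := (Lp.aestronglyMeasurable Ψ.1).enorm
  have hΘ : AEMeasurable (fun k => ‖Θ.1 k‖ₑ) volume := (Lp.aestronglyMeasurable Θ.1).enorm
  have h1 : energyForm Ψ = ∫⁻ k, ‖Ψ.1 k‖ₑ * ‖Θ.1 k‖ₑ := by
    refine lintegral_congr_ae ?_
    filter_upwards [h] with k hk
    have h2 : ‖Θ.1 k‖ₑ = totalEnergy k * ‖Ψ.1 k‖ₑ := by
      rw [hk, enorm_smul, ← ofReal_norm, Complex.norm_real, Real.norm_of_nonneg (by positivity),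
        ENNReal.ofReal_sum_of_nonneg fun i _ => norm_nonneg _]
      simp only [ofReal_norm, totalEnergy]
    rw [h2]
    ring
  have h2 := lintegral_mul_sq_le hΨ hΘ
  rw [← h1, ← enorm_sq_eq_lintegral, ← enorm_sq_eq_lintegral, ← mul_pow] at h2
  exact (ENNReal.pow_le_pow_left_iff two_ne_zero).1 h2

/-- The first estimate puts all the energy on Φ and, by duality, bounds a(f). The second puts it on
the product g ⊗ Ψ and bounds a*(f). Both are free of n, which is what allows summation over the Fock
space. -/
theorem inner_create_sq_le {n : ℕ} {f g : photon} (h : SqrtEnergyMul f g) (Φ : sector (n + 1))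
    (Ψ : sector n) :
    ‖(inner ℂ Φ (create f n Ψ) : ℂ)‖ₑ ^ 2 ≤ energyForm Φ * (‖g‖ₑ ^ 2 * ‖Ψ‖ₑ ^ 2) ∧
    ‖(inner ℂ Φ (create f n Ψ) : ℂ)‖ₑ ^ 2 ≤
      ‖Φ‖ₑ ^ 2 * (‖f‖ₑ ^ 2 * ‖Ψ‖ₑ ^ 2 + ‖g‖ₑ ^ 2 * energyForm Ψ) := by
  have hgn : ∫⁻ k, ‖g.1 k‖ₑ ^ 2 = ‖g‖ₑ ^ 2 := (enorm_sq_eq_lintegral g.1).symm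
  have hΨn : ∫⁻ k, ‖Ψ.1 k‖ₑ ^ 2 = ‖Ψ‖ₑ ^ 2 := (enorm_sq_eq_lintegral Ψ.1).symm
  have hΦn : ∫⁻ k, ‖Φ.1 k‖ₑ ^ 2 = ‖Φ‖ₑ ^ 2 := (enorm_sq_eq_lintegral Φ.1).symm
  have hg : AEMeasurable (fun k => ‖g.1 k‖ₑ ^ 2) volume :=
    (Lp.aestronglyMeasurable g.1).enorm.pow_const 2
  have hΨ : AEMeasurable (fun k => ‖Ψ.1 k‖ₑ ^ 2) volume :=
    (Lp.aestronglyMeasurable Ψ.1).enorm.pow_const 2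
  have hc : ‖(inner ℂ Φ (create f n Ψ) : ℂ)‖ₑ ^ 2 =
      ((n + 1 : ℕ) : ENNReal) * ‖(inner ℂ (Φ : L2n (n + 1)) (tens f Ψ) : ℂ)‖ₑ ^ 2 := by
    rw [inner_create, enorm_mul, mul_pow]
    congr 1
    rw [← ofReal_norm, Complex.norm_real, Real.norm_of_nonneg (Real.sqrt_nonneg _),
      ← ENNReal.ofReal_pow (Real.sqrt_nonneg _), Real.sq_sqrt (by positivity)]
    exact_mod_cast ENNReal.ofReal_natCast (n + 1)
  have hm0 : Measurable fun k : Fin (n + 1) → R3 => ‖k 0‖ₑ := by fun_prop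
  rw [hc]
  constructor
  · have h1 := enorm_inner_tens_sq_le Φ.1 h Ψ (a := fun k => ‖k 0‖ₑ) (b := fun _ => 1) hm0
      measurable_const (fun k => by rw [mul_one])
    have h2 := lintegral_head_eq Φ (m := fun _ => 1) measurable_const fun _ _ => rfl
    simp only [one_mul, mul_one, lintegral_cons_mul hg hΨ, hgn, hΨn] at h1 h2
    calc _ ≤ ((n + 1 : ℕ) : ENNReal) * ((∫⁻ k, ‖k 0‖ₑ * ‖Φ.1 k‖ₑ ^ 2) *
          (‖g‖ₑ ^ 2 * ‖Ψ‖ₑ ^ 2)) := by gcongr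
      _ = _ := by rw [← mul_assoc, h2]; rfl
  -- The weight on Φ is the share of the total energy carried by the first photon. Summed over the
  -- photons these shares give at most 1, so Φ enters only through its norm.
  · have h1 := enorm_inner_tens_sq_le Φ.1 h Ψ (a := fun k => ‖k 0‖ₑ * (totalEnergy k)⁻¹)
      (b := totalEnergy) (hm0.mul (measurable_totalEnergy _).inv) (measurable_totalEnergy _)
      (fun k => by
        have hle : ‖k 0‖ₑ ≤ totalEnergy k :=
          Finset.single_le_sum (f := fun i => ‖k i‖ₑ) (fun i _ => zero_le) (Finset.mem_univ 0)
        -- At zero total energy the inverse does not cancel, but then ‖k 0‖ vanishes as well.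
        rcases eq_or_ne (totalEnergy k) 0 with h0 | h0
        · rw [h0] at hle
          rw [nonpos_iff_eq_zero.1 hle]
          exact zero_le
        · have ht : totalEnergy k ≠ ⊤ := ENNReal.sum_ne_top.2 fun i _ => enorm_ne_top
          rw [mul_assoc, ENNReal.inv_mul_cancel h0 ht, mul_one])
    have h2 : ((n + 1 : ℕ) : ENNReal) * ∫⁻ k, ‖k 0‖ₑ * (totalEnergy k)⁻¹ * ‖Φ.1 k‖ₑ ^ 2 =
        ∫⁻ k, totalEnergy k * (totalEnergy k)⁻¹ * ‖Φ.1 k‖ₑ ^ 2 :=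
      lintegral_head_eq Φ (m := fun k => (totalEnergy k)⁻¹)
        (measurable_totalEnergy _).inv fun σ k => by rw [totalEnergy_comp]
    have h3 : ∫⁻ k, totalEnergy k * (totalEnergy k)⁻¹ * ‖Φ.1 k‖ₑ ^ 2 ≤ ‖Φ‖ₑ ^ 2 := by
      rw [← hΦn]
      refine lintegral_mono fun k => ?_
      exact mul_le_of_le_one_left zero_le (ENNReal.mul_inv_le_one _)
    have h4 : ∫⁻ k : Fin (n + 1) → R3, totalEnergy k *
        (‖g.1 (k 0)‖ₑ ^ 2 * ‖Ψ.1 (Fin.tail k)‖ₑ ^ 2) =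
        ‖f‖ₑ ^ 2 * ‖Ψ‖ₑ ^ 2 + ‖g‖ₑ ^ 2 * energyForm Ψ := by
      have h5 : ∀ k : Fin (n + 1) → R3, totalEnergy k *
          (‖g.1 (k 0)‖ₑ ^ 2 * ‖Ψ.1 (Fin.tail k)‖ₑ ^ 2) =
          (‖k 0‖ₑ * ‖g.1 (k 0)‖ₑ ^ 2) * ‖Ψ.1 (Fin.tail k)‖ₑ ^ 2 +
          ‖g.1 (k 0)‖ₑ ^ 2 * (totalEnergy (Fin.tail k) * ‖Ψ.1 (Fin.tail k)‖ₑ ^ 2) := fun k => by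
        have h6 : totalEnergy k = ‖k 0‖ₑ + totalEnergy (Fin.tail k) := by
          rw [totalEnergy, Fin.sum_univ_succ]
          rfl
        rw [h6]
        ring
      have hm1 : AEMeasurable (fun k : R3 => ‖k‖ₑ * ‖g.1 k‖ₑ ^ 2) volume :=
        measurable_enorm.aemeasurable.mul hg
      have hm2 : AEMeasurable (fun k => totalEnergy k * ‖Ψ.1 k‖ₑ ^ 2) volume :=
        (measurable_totalEnergy n).aemeasurable.mul hΨ
      simp only [h5]
      rw [lintegral_add_left' (aemeasurable_cons_mul hm1 hΨ), lintegral_cons_mul hm1 hΨ,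
        lintegral_cons_mul (u := fun k => ‖g.1 k‖ₑ ^ 2) hg hm2, hΨn, hgn]
      congr 2
      rw [← lintegral_congr_ae h.enorm_sq]
      exact (enorm_sq_eq_lintegral f.1).symm
    rw [h4] at h1
    refine (mul_le_mul' le_rfl h1).trans ((mul_assoc _ _ _).symm.trans_le ?_)
    exact mul_le_mul' (h2.trans_le h3) le_rfl

/-- This turns a bound on matrix elements into a bound on the vector by testing with the vector
itself and cancelling ‖v‖². -/
theorem enorm_sq_le_of_inner_self {V : Type*} [NormedAddCommGroup V] [InnerProductSpace ℂ V]
    {v : V} {K : ENNReal} (h : ‖(inner ℂ v v : ℂ)‖ₑ ^ 2 ≤ K * ‖v‖ₑ ^ 2) : ‖v‖ₑ ^ 2 ≤ K := by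
  rcases eq_or_ne v 0 with rfl | hv
  · simp
  · have h1 : ‖(inner ℂ v v : ℂ)‖ₑ = ‖v‖ₑ ^ 2 := by
      rw [inner_self_eq_norm_sq_to_K, enorm_pow, ← ofReal_norm, ← ofReal_norm]
      simp
    rw [h1, pow_two (‖v‖ₑ ^ 2)] at h
    exact (ENNReal.mul_le_mul_iff_left (by simpa using hv) (by simp)).1 h

theorem norm_annihilate_sq_le {n : ℕ} {f g : photon} (h : SqrtEnergyMul f g)
    {Φ Θ : sector (n + 1)} (hΘ : ∀ᵐ k, Θ.1 k = ((∑ i, ‖k i‖ : ℝ) : ℂ) • Φ.1 k) :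
    ‖annihilate f n Φ‖ ^ 2 ≤ ‖g‖ ^ 2 * (‖Φ‖ * ‖Θ‖) := by
  have h1 : ‖annihilate f n Φ‖ₑ ^ 2 ≤ ‖g‖ₑ ^ 2 * (‖Φ‖ₑ * ‖Θ‖ₑ) := by
    refine enorm_sq_le_of_inner_self ?_
    rw [inner_annihilate]
    refine (inner_create_sq_le h Φ _).1.trans ?_
    rw [← mul_assoc, mul_comm (energyForm Φ)]
    gcongr
    exact energyForm_le hΘ
  have h2 := ENNReal.toReal_mono (by finiteness) h1
  simpa using h2

theorem norm_create_sq_le {n : ℕ} {f g : photon} (h : SqrtEnergyMul f g)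
    {Ψ Θ : sector n} (hΘ : ∀ᵐ k, Θ.1 k = ((∑ i, ‖k i‖ : ℝ) : ℂ) • Ψ.1 k) :
    ‖create f n Ψ‖ ^ 2 ≤ ‖f‖ ^ 2 * ‖Ψ‖ ^ 2 + ‖g‖ ^ 2 * (‖Ψ‖ * ‖Θ‖) := by
  have h1 : ‖create f n Ψ‖ₑ ^ 2 ≤ ‖f‖ₑ ^ 2 * ‖Ψ‖ₑ ^ 2 + ‖g‖ₑ ^ 2 * (‖Ψ‖ₑ * ‖Θ‖ₑ) := by
    refine enorm_sq_le_of_inner_self ((inner_create_sq_le h _ Ψ).2.trans ?_)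
    rw [mul_comm]
    gcongr
    exact energyForm_le hΘ
  have h2 := ENNReal.toReal_mono (by finiteness) h1
  rw [ENNReal.toReal_add (by finiteness) (by finiteness)] at h2
  simpa using h2

end Sectors

/-! ## The helicity operator and the field vectors -/

section Photon

theorem photon_inner_smul_right (c : ℂ) (f g : photon) :
    (inner ℂ f (c • g) : ℂ) = c * inner ℂ f g := inner_smul_right f g c

theorem photon_inner_smul_left (c : ℂ) (f g : photon) :
    (inner ℂ (c • f) g : ℂ) = (starRingEnd ℂ) c * inner ℂ f g := inner_smul_left f g c

/-- Lagrange's identity has the correction term (k · ā)(k · b), which transversality of a alone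
removes. -/
theorem inner_crossC (k : R3) (a b : C3) (ha : ∑ j, (k j : ℂ) * a j = 0) :
    (inner ℂ (crossC k a) (crossC k b) : ℂ) = (‖k‖ : ℂ) ^ 2 * inner ℂ a b := by
  have hk : (‖k‖ : ℂ) ^ 2 = (k 0 : ℂ) ^ 2 + (k 1 : ℂ) ^ 2 + (k 2 : ℂ) ^ 2 := by
    rw [← Complex.ofReal_pow, EuclideanSpace.norm_sq_eq, Fin.sum_univ_three]
    simp only [Real.norm_eq_abs, sq_abs]
    push_cast
    rfl
  have ha' := congrArg (starRingEnd ℂ) ha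
  simp only [Fin.sum_univ_three, map_add, map_mul, Complex.conj_ofReal, map_zero] at ha'
  simp only [PiLp.inner_apply, Fin.sum_univ_three, crossC_apply, RCLike.inner_apply, hk]
  simp
  linear_combination (-((k 0 : ℂ) * b 0 + k 1 * b 1 + k 2 * b 2)) * ha'

theorem coeFn_helicity (X : photon) : (helicity X).1 =ᵐ[volume] unitCross X.1 :=
  (memLp_unitCross (Lp.memLp X.1)).coeFn_toLp

theorem inner_helicity (A B : photon) :
    (inner ℂ (helicity A) (helicity B) : ℂ) = inner ℂ A B := by
  rw [Submodule.coe_inner, Submodule.coe_inner, inner_def_L2, inner_def_L2]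
  have h0 : ∀ᵐ k : R3, k ≠ 0 := by
    simp [ae_iff]
  have hA : ∀ᵐ k, ∑ j, (k j : ℂ) * A.1 k j = 0 := A.2
  refine integral_congr_ae ?_
  filter_upwards [coeFn_helicity A, coeFn_helicity B, h0, hA] with k h1 h2 h3 h4
  have h5 : (‖k‖ : ℂ) ≠ 0 := by simpa using h3
  rw [h1, h2, unitCross, unitCross, inner_smul_left, inner_smul_right, inner_crossC k _ _ h4,
    map_inv₀, Complex.conj_ofReal]
  field_simp

/-- The profile `i χ(|k|) (2π)^{-3/2} e^{-i k·x} e_j`. -/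
def bareProfile (χ : SchwartzMap ℝ ℂ) (x : R3) (j : Fin 3) (k : R3) : C3 :=
  (Complex.I * χ ‖k‖ / (((2 * Real.pi) ^ (3 / 2 : ℝ) : ℝ) : ℂ)
    * Complex.exp (-Complex.I * (inner ℝ k x : ℝ))) • EuclideanSpace.single j (1 : ℂ)

theorem memLp_bareProfile (χ : SchwartzMap ℝ ℂ) (x : R3) (j : Fin 3) :
    MemLp (bareProfile χ x j) 2 volume := by
  have hc : Continuous (bareProfile χ x j) := by
    unfold bareProfile
    have : Continuous χ := χ.continuous
    fun_prop
  -- Two powers of decay of χ make the squared profile O((1 + |k|)⁻⁴), which is integrable in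
  -- dimension 3.
  set C : ℝ := 2 ^ 2 * (Finset.Iic (2, 0)).sup
    (fun m => SchwartzMap.seminorm ℝ m.1 m.2) χ with hC
  have hχ : ∀ k : R3, (1 + ‖k‖) ^ 2 * ‖χ ‖k‖‖ ≤ C := fun k => by
    have := SchwartzMap.one_add_le_sup_seminorm_apply (𝕜 := ℝ) (m := (2, 0)) (k := 2) (n := 0)
      le_rfl le_rfl χ ‖k‖
    simpa using this
  have hpi : (1 : ℝ) ≤ (2 * Real.pi) ^ (3 / 2 : ℝ) :=
    Real.one_le_rpow (by nlinarith [Real.pi_gt_three]) (by norm_num)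
  have hb : ∀ k : R3, ‖bareProfile χ x j k‖ ^ 2 ≤ C ^ 2 * (1 + ‖k‖) ^ (-(4 : ℝ)) := fun k => by
    have h0 : 0 ≤ ‖k‖ := norm_nonneg k
    have h1 : ‖bareProfile χ x j k‖ ≤ ‖χ ‖k‖‖ := by
      have he : ‖Complex.exp (-Complex.I * (inner ℝ k x : ℝ))‖ = 1 := by
        have := Complex.norm_exp_ofReal_mul_I (-(inner ℝ k x : ℝ))
        rw [← this]; congr 2; push_cast; ring
      rw [bareProfile, norm_smul, norm_mul, he, norm_div, norm_mul, Complex.norm_I,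
        Complex.norm_real, Real.norm_of_nonneg (by positivity)]
      simp only [one_mul, mul_one, PiLp.norm_single, norm_one]
      exact div_le_self (by positivity) hpi
    rw [Real.rpow_neg (by positivity), ← div_eq_mul_inv, le_div_iff₀ (by positivity)]
    have h5 : (1 + ‖k‖) ^ (4 : ℝ) = (1 + ‖k‖) ^ 4 := by exact_mod_cast Real.rpow_natCast _ 4
    rw [h5]
    calc ‖bareProfile χ x j k‖ ^ 2 * (1 + ‖k‖) ^ 4
        ≤ ‖χ ‖k‖‖ ^ 2 * (1 + ‖k‖) ^ 4 := by gcongr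
      _ = ((1 + ‖k‖) ^ 2 * ‖χ ‖k‖‖) ^ 2 := by ring
      _ ≤ C ^ 2 := by gcongr; exact hχ k
  rw [memLp_two_iff_integrable_sq_norm hc.aestronglyMeasurable]
  have hint : Integrable (fun k : R3 => C ^ 2 * (1 + ‖k‖) ^ (-(4 : ℝ))) volume :=
    (integrable_one_add_norm (by simp; norm_num)).const_mul _
  refine hint.mono' (hc.norm.pow 2).aestronglyMeasurable (Eventually.of_forall fun k => ?_)
  rw [Real.norm_of_nonneg (by positivity)]
  exact hb k

/-- The field vector divided by `|k|^{1/2}`. -/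
def bareVec (χ : SchwartzMap ℝ ℂ) (x : R3) (j : Fin 3) : photon :=
  ⟨(memLp_unitCross (memLp_bareProfile χ x j)).toLp (unitCross (bareProfile χ x j)),
    unitCross_mem (memLp_bareProfile χ x j)⟩

theorem crossC_smul (k : R3) (c : ℂ) (v : C3) : crossC k (c • v) = c • crossC k v := by
  ext j
  rw [PiLp.smul_apply, crossC_apply, crossC_apply]
  fin_cases j <;> simp <;> ring

theorem sqrtEnergyMul_magVec (χ : SchwartzMap ℝ ℂ) (x : R3) (j : Fin 3) :
    SqrtEnergyMul (magVec χ x j) (bareVec χ x j) := by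
  have h1 : (magVec χ x j).1 =ᵐ[volume] unitCross (fieldProfile χ x j) :=
    (memLp_unitCross (memLp_fieldProfile χ x j)).coeFn_toLp
  have h2 : (bareVec χ x j).1 =ᵐ[volume] unitCross (bareProfile χ x j) :=
    (memLp_unitCross (memLp_bareProfile χ x j)).coeFn_toLp
  filter_upwards [h1, h2] with k h3 h4
  have h5 : fieldProfile χ x j k = ((Real.sqrt ‖k‖ : ℝ) : ℂ) • bareProfile χ x j k := by
    rw [fieldProfile, bareProfile, smul_smul]
    congr 1
    ring
  rw [h3, h4, unitCross, unitCross, h5, crossC_smul, smul_comm]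

end Photon

/-! ## Product states -/

section Products

/-- `(k₁, …, kₙ) ↦ z(k₁) ⊗ ⋯ ⊗ z(kₙ)`. -/
def prodFun (z : R3 → C3) (n : ℕ) (k : Fin n → R3) : Pol n :=
  WithLp.toLp 2 fun a => ∏ i, z (k i) (a i)

theorem tensFun_prodFun (z : R3 → C3) (n : ℕ) (k : Fin (n + 1) → R3) :
    tensFun z (prodFun z n) k = prodFun z (n + 1) k := by
  ext a
  simp only [tensFun, prodFun, Fin.prod_univ_succ, Fin.tail]

/-- A product of equal factors is invariant under reordering and inherits transversality in each
variable from its factors. The projections in the definition of `tensPow` therefore do nothing. -/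
theorem mem_sector_of_prodFun (z : photon) {n : ℕ} {Ψ : L2n n}
    (h : Ψ =ᵐ[volume] prodFun z.1 n) : Ψ ∈ sector n := by
  refine ⟨fun σ => ?_, ?_⟩
  · filter_upwards [h, (measurePreserving_perm σ).quasiMeasurePreserving.ae h] with k h1 h2 a
    rw [h1, h2]
    exact Equiv.prod_comp σ fun i => z.1 (k i) (a i)
  · have hz : ∀ᵐ k : Fin n → R3, ∀ i, ∑ j, (k i j : ℂ) * z.1 (k i) j = 0 := by
      rw [ae_all_iff]
      intro i
      exact (Measure.quasiMeasurePreserving_eval (fun _ : Fin n => (volume : Measure R3)) i).ae z.2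
    filter_upwards [h, hz] with k h1 h2 i a
    rw [h1]
    have h3 : ∀ j, prodFun z.1 n k (Function.update a i j) =
        z.1 (k i) j * ∏ i' ∈ Finset.univ.erase i, z.1 (k i') (a i') := fun j => by
      change ∏ i', z.1 (k i') (Function.update a i j i') = _
      rw [← Finset.mul_prod_erase _ _ (Finset.mem_univ i), Function.update_self]
      congr 1
      refine Finset.prod_congr rfl fun i' hi' => ?_
      rw [Function.update_of_ne (Finset.ne_of_mem_erase hi')]
    simp only [h3, ← mul_assoc]
    rw [← Finset.sum_mul, h2, zero_mul]

theorem tensPow_succ_of_prodFun (z : photon) {n : ℕ}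
    (h : (tensPow z n).1 =ᵐ[volume] prodFun z.1 n) :
    ((tensPow z (n + 1)).1 = tens z (tensPow z n)) ∧
      (tensPow z (n + 1)).1 =ᵐ[volume] prodFun z.1 (n + 1) := by
  have h1 : tens z (tensPow z n) =ᵐ[volume] prodFun z.1 (n + 1) := by
    filter_upwards [coeFn_tens z (tensPow z n), ae_tail h] with k h2 h3
    rw [h2, ← tensFun_prodFun, tensFun, h3]
    rfl
  have h2 : (tensPow z (n + 1)).1 = tens z (tensPow z n) :=
    congrArg Subtype.val (Submodule.orthogonalProjectionOnto_mem_subspace_eq_self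
      (⟨tens z (tensPow z n), mem_sector_of_prodFun z h1⟩ : sector (n + 1)))
  exact ⟨h2, h2 ▸ h1⟩

theorem coeFn_tensPow (z : photon) (n : ℕ) : (tensPow z n).1 =ᵐ[volume] prodFun z.1 n := by
  induction n with
  | zero =>
    have h : (tensPow z 0).1 =ᵐ[volume] fun _ => (WithLp.toLp 2 fun _ => (1 : ℂ) : Pol 0) :=
      (memLp_const (WithLp.toLp 2 fun _ => (1 : ℂ) : Pol 0)).coeFn_toLp
    filter_upwards [h] with k hk
    rw [hk]
    ext a
    simp [prodFun]
  | succ n ih => exact (tensPow_succ_of_prodFun z ih).2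

/-- Symmetrization leaves `z ⊗ z^{⊗ n}` unchanged. -/
theorem tensPow_succ (z : photon) (n : ℕ) : (tensPow z (n + 1)).1 = tens z (tensPow z n) :=
  (tensPow_succ_of_prodFun z (coeFn_tensPow z n)).1

theorem norm_vacuum : ‖vacuum‖ = 1 := by
  have h : ‖vacuum‖ = ‖(vacuum : sector 0).1‖ := rfl
  rw [h, vacuum, Lp.norm_toLp, eLpNorm_const _ two_ne_zero (NeZero.ne _)]
  simp [EuclideanSpace.norm_eq, volume_pi]

theorem norm_tensPow (z : photon) (n : ℕ) : ‖tensPow z n‖ = ‖z‖ ^ n := by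
  induction n with
  | zero => rw [pow_zero]; exact norm_vacuum
  | succ n ih =>
    have h : ‖tensPow z (n + 1)‖ = ‖(tensPow z (n + 1)).1‖ := rfl
    rw [h, tensPow_succ, norm_tens, ih]
    ring

/-- Tested against Φ, the left side becomes √(n+1)⟨z ⊗ z^{⊗ n}, f ⊗ Φ⟩, since z^{⊗(n+1)} needs no
symmetrization, and the inner product factorizes. -/
theorem annihilate_tensPow (f z : photon) (n : ℕ) : annihilate f n (tensPow z (n + 1)) =
    (((Real.sqrt (n + 1) : ℝ) : ℂ) * inner ℂ f z) • tensPow z n := by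
  refine ext_inner_right ℂ fun Φ => ?_
  have h : (starRingEnd ℂ) (((Real.sqrt (n + 1) : ℝ) : ℂ) * inner ℂ f z) =
      ((Real.sqrt (n + 1) : ℝ) : ℂ) * inner ℂ z f := by
    rw [map_mul, Complex.conj_ofReal]
    exact congrArg _ (inner_conj_symm z f)
  have h2 : (inner ℂ (annihilate f n (tensPow z (n + 1))) Φ : ℂ) =
      ((Real.sqrt (n + 1) : ℝ) : ℂ) * (inner ℂ z f * inner ℂ (tensPow z n) Φ) := by
    refine (inner_annihilate f n _ Φ).trans ((inner_create f n _ Φ).trans ?_)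
    refine congrArg (((Real.sqrt (n + 1) : ℝ) : ℂ) * ·) ?_
    refine Eq.trans ?_ (inner_tens z f (tensPow z n) Φ)
    exact congrArg (fun v => (inner ℂ v (tens f Φ) : ℂ)) (tensPow_succ z n)
  refine h2.trans (((mul_assoc _ _ _).symm.trans ?_).trans (sector_inner_smul_left _ _ _).symm)
  exact congrArg (· * _) h.symm

end Products

/-! ## Multiplication operators on wave functions -/

section Multiplication

/-- A scalar multiplier never disturbs transversality, and it respects permutation symmetry because
it is symmetric itself. It serves to write down the resolvent of dΓ(|k|). -/
theorem exists_sector_mul {n : ℕ} {m : (Fin n → R3) → ℂ} (hm : Measurable m) {C : ℝ}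
    (hC : ∀ k, ‖m k‖ ≤ C) (hs : ∀ (σ : Equiv.Perm (Fin n)) k, m (k ∘ σ) = m k) (Ψ : sector n) :
    ∃ Φ : sector n, (∀ᵐ k, Φ.1 k = m k • Ψ.1 k) ∧ ‖Φ‖ ≤ C * ‖Ψ‖ := by
  have hae : AEStronglyMeasurable (fun k => m k • Ψ.1 k) volume :=
    hm.aestronglyMeasurable.smul (Lp.aestronglyMeasurable Ψ.1)
  have hb : ∀ k, ‖m k • Ψ.1 k‖ ≤ C * ‖Ψ.1 k‖ := fun k => by
    rw [norm_smul]
    gcongr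
    exact hC k
  have hL : MemLp (fun k => m k • Ψ.1 k) 2 volume :=
    (Lp.memLp Ψ.1).of_le_mul hae (Eventually.of_forall hb)
  have hco : hL.toLp _ =ᵐ[volume] fun k => m k • Ψ.1 k := hL.coeFn_toLp
  refine ⟨⟨hL.toLp _, fun σ => ?_, ?_⟩, hco, ?_⟩
  · filter_upwards [hco, (measurePreserving_perm σ).quasiMeasurePreserving.ae hco, Ψ.2.1 σ]
      with k h1 h2 h3 a
    rw [h1, h2, PiLp.smul_apply, PiLp.smul_apply, h3, hs]
  · filter_upwards [hco, Ψ.2.2] with k h1 h2 i a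
    simp only [h1, PiLp.smul_apply, smul_eq_mul, mul_left_comm _ (m k)]
    rw [← Finset.mul_sum, h2, mul_zero]
  · refine Lp.norm_le_mul_norm_of_ae_le_mul (f := hL.toLp _) (g := Ψ.1) ?_
    filter_upwards [hco] with k h1
    rw [h1]
    exact hb k

end Multiplication

/-! ## Square-summable sequences -/

section SquareSummable

variable {G : ℕ → Type*} [∀ n, NormedAddCommGroup (G n)]

theorem hasSum_norm_sq (f : lp G 2) : HasSum (fun n => ‖f n‖ ^ 2) (‖f‖ ^ 2) := by
  have h := lp.hasSum_norm (p := 2) (by simp) f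
  simpa using h

theorem memℓp_two {f : ∀ n, G n} (h : Summable fun n => ‖f n‖ ^ 2) : Memℓp f 2 :=
  memℓp_gen (by simpa using h)

theorem norm_sq_le_of_summable (f : lp G 2) {b : ℕ → ℝ} {S : ℝ} (hb : HasSum b S)
    (h : ∀ n, ‖f n‖ ^ 2 ≤ b n) : ‖f‖ ^ 2 ≤ S :=
  hasSum_le h (hasSum_norm_sq f) hb

/-- The first `M` components of a sequence. -/
def truncate (M : ℕ) (f : lp G 2) : lp G 2 := ∑ n ∈ Finset.range M, lp.single 2 n (f n)

theorem truncate_apply (M : ℕ) (f : lp G 2) (n : ℕ) :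
    truncate M f n = if n < M then f n else 0 := by
  rw [truncate, lp.coeFn_sum, Finset.sum_apply]
  split_ifs with h
  · rw [Finset.sum_eq_single_of_mem n (Finset.mem_range.2 h)
      fun m _ hm => lp.single_apply_ne 2 m (f m) hm.symm, lp.single_apply_self]
  · exact Finset.sum_eq_zero fun m hm => lp.single_apply_ne 2 m (f m)
      fun hn => h (hn ▸ Finset.mem_range.1 hm)

theorem tendsto_truncate (f : lp G 2) : Tendsto (fun M => truncate M f) atTop (𝓝 f) :=
  (lp.hasSum_single (by simp) f).tendsto_sum_nat

variable [∀ n, InnerProductSpace ℂ (G n)]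

/-- A pair of sequences, obtained from `x` and `y` by operators that lower and raise the index and
are adjoint to each other. -/
theorem inner_eq_inner_of_ladder {a y x c : lp G 2} (h0 : c 0 = 0)
    (h : ∀ n, (inner ℂ (a n) (y n) : ℂ) = inner ℂ (x (n + 1)) (c (n + 1))) :
    (inner ℂ a y : ℂ) = inner ℂ x c := by
  have h1 := lp.hasSum_inner (𝕜 := ℂ) a y
  have h2 := lp.hasSum_inner (𝕜 := ℂ) x c
  simp only [h] at h1
  -- Since c has no component of index 0, shifting the index loses nothing.
  have h3 := (hasSum_nat_add_iff' 1).2 h2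
  simp only [Finset.sum_range_one, h0, inner_zero_right, sub_zero] at h3
  exact h1.unique h3

end SquareSummable

/-! ## Second quantization and Segal fields as unbounded operators -/

section Fields

theorem sector_ext_ae {n : ℕ} {Ψ Φ : sector n} (h : Ψ.1 =ᵐ[volume] Φ.1) : Ψ = Φ :=
  Subtype.ext (Lp.ext h)

theorem mem_graph_dGamma {ω : R3 → ℝ} {Ψ Φ : Fock} : (Ψ, Φ) ∈ (dGamma ω).graph ↔
    ∀ n, ∀ᵐ k, (Φ n).1 k = ((∑ i, ω (k i) : ℝ) : ℂ) • (Ψ n).1 k := by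
  refine mem_graph_toLinearPMap_iff fun Φ h => lp.ext (funext fun n => ?_)
  refine sector_ext_ae ?_
  filter_upwards [h n, Lp.coeFn_zero (Pol n) 2 (volume : Measure (Fin n → R3))] with k h1 h2
  have h3 : (((0 : Fock) n).1 : (Fin n → R3) → Pol n) k = 0 := h2
  rw [h1]
  exact (congrArg _ h3).trans ((smul_zero _).trans h3.symm)

theorem mem_graph_segal {f : photon} {Ψ Φ : Fock} :
    (Ψ, Φ) ∈ (segal f).graph ↔ ∀ n, Φ n = segalComp f Ψ n := by
  refine mem_graph_toLinearPMap_iff fun Φ h => lp.ext (funext fun n => ?_)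
  have h1 := segalComp_smul f 0 0 n
  rw [zero_smul, zero_smul] at h1
  exact (h n).trans h1

theorem mem_graph_photonNumber {Ψ Φ : Fock} :
    (Ψ, Φ) ∈ photonNumber.graph ↔ ∀ n, Φ n = (n : ℂ) • Ψ n := by
  refine mem_graph_dGamma.trans (forall_congr' fun n => ?_)
  have h1 := Lp.coeFn_smul (n : ℂ) (Ψ n).1
  have h2 : ∀ k : Fin n → R3, ((∑ _i : Fin n, (1 : ℝ) : ℝ) : ℂ) • (Ψ n).1 k =
      ((n : ℂ) • ((Ψ n).1 : (Fin n → R3) → Pol n)) k := fun k => by simp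
  simp only [h2]
  constructor
  · intro h
    refine sector_ext_ae ?_
    filter_upwards [h, h1] with k h3 h4
    rw [h3]
    exact h4.symm
  · intro h
    rw [h]
    exact h1

/-- `A = a(f) Ψ` and `C = a*(f) Ψ`. -/
structure IsLadder (f : photon) (Ψ A C : Fock) : Prop where
  lower : ∀ n, A n = annihilate f n (Ψ (n + 1))
  raise_zero : C 0 = 0
  raise : ∀ n, C (n + 1) = create f n (Ψ n)

theorem IsLadder.graph {f : photon} {Ψ A C : Fock} (h : IsLadder f Ψ A C) :
    (Ψ, (((Real.sqrt 2)⁻¹ : ℝ) : ℂ) • (A + C)) ∈ (segal f).graph := by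
  rw [mem_graph_segal]
  intro n
  rw [lp.coeFn_smul, Pi.smul_apply, lp.coeFn_add, Pi.add_apply]
  cases n with
  | zero => rw [h.lower, h.raise_zero, add_zero, segalComp]
  | succ n => rw [h.lower, h.raise, segalComp]

theorem IsLadder.inner_eq {f : photon} {Ψ A C Ψ' A' C' : Fock} (h : IsLadder f Ψ A C)
    (h' : IsLadder f Ψ' A' C') : (inner ℂ A Ψ' : ℂ) = inner ℂ Ψ C' := by
  refine inner_eq_inner_of_ladder h'.raise_zero fun n => ?_
  rw [h.lower, h'.raise]
  exact inner_annihilate f n _ _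

theorem IsLadder.inner_eq' {f : photon} {Ψ A C Ψ' A' C' : Fock} (h : IsLadder f Ψ A C)
    (h' : IsLadder f Ψ' A' C') : (inner ℂ C Ψ' : ℂ) = inner ℂ Ψ A' := by
  rw [← inner_conj_symm, ← h'.inner_eq h, inner_conj_symm]

/-- The energy controls annihilation and creation operators. -/
theorem exists_isLadder {f g : photon} (h : SqrtEnergyMul f g) {δ : ℝ} (hδ : 0 < δ)
    {Ψ Θ : Fock} (hΘ : (Ψ, Θ) ∈ (dGamma fun k => ‖k‖).graph) : ∃ A C : Fock, IsLadder f Ψ A C ∧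
      ‖A‖ ^ 2 ≤ ‖g‖ ^ 2 * (δ * ‖Θ‖ ^ 2 + (4 * δ)⁻¹ * ‖Ψ‖ ^ 2) ∧
      ‖C‖ ^ 2 ≤ ‖f‖ ^ 2 * ‖Ψ‖ ^ 2 + ‖g‖ ^ 2 * (δ * ‖Θ‖ ^ 2 + (4 * δ)⁻¹ * ‖Ψ‖ ^ 2) := by
  have hΘ' := mem_graph_dGamma.1 hΘ
  have hyoung : ∀ n, ‖Ψ n‖ * ‖Θ n‖ ≤ δ * ‖Θ n‖ ^ 2 + (4 * δ)⁻¹ * ‖Ψ n‖ ^ 2 := fun n => by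
    have h1 : 0 ≤ (4 * δ)⁻¹ * (2 * δ * ‖Θ n‖ - ‖Ψ n‖) ^ 2 := by positivity
    have h2 : (4 * δ)⁻¹ * (2 * δ * ‖Θ n‖ - ‖Ψ n‖) ^ 2 =
        δ * ‖Θ n‖ ^ 2 + (4 * δ)⁻¹ * ‖Ψ n‖ ^ 2 - ‖Ψ n‖ * ‖Θ n‖ := by
      field_simp
      ring
    linarith
  have hsum : HasSum (fun n => ‖g‖ ^ 2 * (δ * ‖Θ n‖ ^ 2 + (4 * δ)⁻¹ * ‖Ψ n‖ ^ 2))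
      (‖g‖ ^ 2 * (δ * ‖Θ‖ ^ 2 + (4 * δ)⁻¹ * ‖Ψ‖ ^ 2)) :=
    (((hasSum_norm_sq Θ).mul_left δ).add ((hasSum_norm_sq Ψ).mul_left _)).mul_left _
  have hsumC : HasSum (fun n => ‖f‖ ^ 2 * ‖Ψ n‖ ^ 2 +
      ‖g‖ ^ 2 * (δ * ‖Θ n‖ ^ 2 + (4 * δ)⁻¹ * ‖Ψ n‖ ^ 2))
      (‖f‖ ^ 2 * ‖Ψ‖ ^ 2 + ‖g‖ ^ 2 * (δ * ‖Θ‖ ^ 2 + (4 * δ)⁻¹ * ‖Ψ‖ ^ 2)) :=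
    ((hasSum_norm_sq Ψ).mul_left _).add hsum
  have hA : ∀ n, ‖annihilate f n (Ψ (n + 1))‖ ^ 2 ≤
      ‖g‖ ^ 2 * (δ * ‖Θ (n + 1)‖ ^ 2 + (4 * δ)⁻¹ * ‖Ψ (n + 1)‖ ^ 2) := fun n =>
    (norm_annihilate_sq_le h (hΘ' (n + 1))).trans
      (mul_le_mul_of_nonneg_left (hyoung (n + 1)) (sq_nonneg _))
  have hC : ∀ n, ‖create f n (Ψ n)‖ ^ 2 ≤ ‖f‖ ^ 2 * ‖Ψ n‖ ^ 2 +
      ‖g‖ ^ 2 * (δ * ‖Θ n‖ ^ 2 + (4 * δ)⁻¹ * ‖Ψ n‖ ^ 2) := fun n =>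
    (norm_create_sq_le h (hΘ' n)).trans
      (add_le_add le_rfl (mul_le_mul_of_nonneg_left (hyoung n) (sq_nonneg _)))
  let c : ∀ n, sector n := fun n => match n with
    | 0 => 0
    | n + 1 => create f n (Ψ n)
  have hAs : Summable fun n => ‖annihilate f n (Ψ (n + 1))‖ ^ 2 :=
    Summable.of_nonneg_of_le (fun n => sq_nonneg _) hA ((summable_nat_add_iff 1).2 hsum.summable)
  have hCs : Summable fun n => ‖c n‖ ^ 2 := by
    rw [← summable_nat_add_iff 1]
    exact Summable.of_nonneg_of_le (fun n => sq_nonneg _) hC hsumC.summable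
  let A : Fock := ⟨fun n => annihilate f n (Ψ (n + 1)), memℓp_two hAs⟩
  let C : Fock := ⟨c, memℓp_two hCs⟩
  refine ⟨A, C, ⟨fun _ => rfl, rfl, fun _ => rfl⟩, ?_, ?_⟩
  · have h1 := (hasSum_nat_add_iff' 1).2 hsum
    refine (norm_sq_le_of_summable A h1 hA).trans ?_
    rw [Finset.sum_range_one]
    have : 0 ≤ ‖g‖ ^ 2 * (δ * ‖Θ 0‖ ^ 2 + (4 * δ)⁻¹ * ‖Ψ 0‖ ^ 2) := by positivity
    linarith
  · have h1 := hasSum_norm_sq C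
    have h2 := (hasSum_nat_add_iff' 1).2 h1
    have h3 : C 0 = 0 := rfl
    rw [Finset.sum_range_one, h3, norm_zero, zero_pow two_ne_zero, sub_zero] at h2
    exact hasSum_le hC h2 hsumC

theorem infinitesimallyBounded_segal {f g : photon} (h : SqrtEnergyMul f g) :
    InfinitesimallyBounded (dGamma fun k => ‖k‖) (segal f) := by
  intro ε hε
  -- Chosen so that ‖g‖²δ ≤ (ε/2)²: each of a(f)Ψ and a*(f)Ψ then costs at most ε/2 times the energy
  -- norm. The + 1 covers g = 0.
  set δ : ℝ := (ε / 2) ^ 2 / (‖g‖ ^ 2 + 1) with hδ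
  have hδ0 : 0 < δ := by positivity
  have hgδ : ‖g‖ ^ 2 * δ ≤ (ε / 2) ^ 2 := by
    rw [hδ, ← mul_div_assoc, div_le_iff₀ (by positivity)]
    nlinarith [sq_nonneg (ε / 2), sq_nonneg ‖g‖]
  set q : ℝ := ‖f‖ ^ 2 + ‖g‖ ^ 2 * (4 * δ)⁻¹ with hq
  have hq0 : 0 ≤ q := by positivity
  refine ⟨2 * Real.sqrt q, by positivity, fun Ψ Θ hΘ => ?_⟩
  obtain ⟨A, C, hL, hA, hC⟩ := exists_isLadder h hδ0 hΘ
  refine ⟨_, hL.graph, ?_⟩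
  have hb : ∀ r : ℝ, r ^ 2 ≤ ‖f‖ ^ 2 * ‖Ψ‖ ^ 2 +
      ‖g‖ ^ 2 * (δ * ‖Θ‖ ^ 2 + (4 * δ)⁻¹ * ‖Ψ‖ ^ 2) → r ≤ ε / 2 * ‖Θ‖ + Real.sqrt q * ‖Ψ‖ := by
    intro r hr
    refine le_of_sq_le_sq ?_ (by positivity)
    have h1 : 0 ≤ ε / 2 * ‖Θ‖ * (Real.sqrt q * ‖Ψ‖) := by positivity
    have h2 : (Real.sqrt q * ‖Ψ‖) ^ 2 = q * ‖Ψ‖ ^ 2 := by rw [mul_pow, Real.sq_sqrt hq0]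
    have h3 : ‖g‖ ^ 2 * δ * ‖Θ‖ ^ 2 ≤ (ε / 2) ^ 2 * ‖Θ‖ ^ 2 := by gcongr
    rw [hq] at h2
    calc r ^ 2 ≤ _ := hr
      _ = ‖g‖ ^ 2 * δ * ‖Θ‖ ^ 2 + (‖f‖ ^ 2 + ‖g‖ ^ 2 * (4 * δ)⁻¹) * ‖Ψ‖ ^ 2 := by ring
      _ ≤ (ε / 2 * ‖Θ‖ + Real.sqrt q * ‖Ψ‖) ^ 2 := by
        rw [add_sq]
        linarith
  have hA' := hb ‖A‖ (hA.trans (le_add_of_nonneg_left (by positivity)))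
  have hC' := hb ‖C‖ hC
  have hs : ‖(((Real.sqrt 2)⁻¹ : ℝ) : ℂ)‖ ≤ 1 := by
    rw [Complex.norm_real, Real.norm_of_nonneg (by positivity)]
    exact inv_le_one_of_one_le₀ (Real.one_le_sqrt.2 one_le_two)
  calc ‖(((Real.sqrt 2)⁻¹ : ℝ) : ℂ) • (A + C)‖ ≤ 1 * (‖A‖ + ‖C‖) := by
        rw [norm_smul]
        exact mul_le_mul hs (norm_add_le _ _) (norm_nonneg _) zero_le_one
    _ ≤ ε * ‖Θ‖ + 2 * Real.sqrt q * ‖Ψ‖ := by linarith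

/-- On D(dΓ(|k|)) both a(f)Ψ and a*(f)Ψ exist separately as Fock vectors, so the inner products
split and adjointness exchanges the two halves. -/
theorem symmetricOn_segal {f g : photon} (h : SqrtEnergyMul f g) :
    SymmetricOn (dGamma fun k => ‖k‖) (segal f) := by
  refine ⟨(infinitesimallyBounded_segal h).domain_le, fun Ψ hΨ Ψ' hΨ' z z' hz hz' => ?_⟩
  obtain ⟨Θ, hΘ⟩ := LinearPMap.mem_domain_iff.1 hΨ
  obtain ⟨Θ', hΘ'⟩ := LinearPMap.mem_domain_iff.1 hΨ'
  obtain ⟨A, C, hL, -, -⟩ := exists_isLadder h one_pos hΘ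
  obtain ⟨A', C', hL', -, -⟩ := exists_isLadder h one_pos hΘ'
  rw [graph_unique hz hL.graph, graph_unique hz' hL'.graph, inner_smul_left, inner_smul_right,
    Complex.conj_ofReal, inner_add_left, inner_add_right, hL.inner_eq hL', hL.inner_eq' hL',
    add_comm]

theorem symmetricOn_dGamma (ω : R3 → ℝ) : SymmetricOn (dGamma ω) (dGamma ω) := by
  refine ⟨le_rfl, fun Ψ _ Ψ' _ z z' hz hz' => ?_⟩
  rw [mem_graph_dGamma] at hz hz'
  rw [lp.inner_eq_tsum, lp.inner_eq_tsum]
  refine tsum_congr fun n => integral_congr_ae ?_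
  filter_upwards [hz n, hz' n] with k h1 h2
  change (inner ℂ ((z n).1 k) ((Ψ' n).1 k) : ℂ) = inner ℂ ((Ψ n).1 k) ((z' n).1 k)
  rw [h1, h2, inner_smul_left, inner_smul_right, Complex.conj_ofReal]

/-- The resolvent is explicit: in each sector, division by |k₁| + ⋯ + |kₙ| + iμ, whose modulus is at
least |μ|. -/
theorem shiftSurjective_dGamma {μ : ℝ} (hμ : μ ≠ 0) :
    ShiftSurjective (dGamma fun k => ‖k‖) μ := by
  intro Φ
  have hne : ∀ r : ℝ, (r : ℂ) + (μ : ℂ) * Complex.I ≠ 0 := fun r h0 => by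
    have := congrArg Complex.im h0
    simp at this
    exact hμ this
  have hex : ∀ n, ∃ Ψ : sector n, (∀ᵐ k, Ψ.1 k =
      (((∑ i, ‖k i‖ : ℝ) : ℂ) + (μ : ℂ) * Complex.I)⁻¹ • (Φ n).1 k) ∧ ‖Ψ‖ ≤ |μ|⁻¹ * ‖Φ n‖ := by
    intro n
    refine exists_sector_mul
      (m := fun k => (((∑ i, ‖k i‖ : ℝ) : ℂ) + (μ : ℂ) * Complex.I)⁻¹) ?_ (fun k => ?_)
      (fun σ k => ?_) (Φ n)
    · fun_prop
    · rw [norm_inv]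
      refine inv_anti₀ (abs_pos.2 hμ) ?_
      have := Complex.abs_im_le_norm (((∑ i, ‖k i‖ : ℝ) : ℂ) + (μ : ℂ) * Complex.I)
      simpa using this
    · have : ∑ i, ‖(k ∘ σ) i‖ = ∑ i, ‖k i‖ := Equiv.sum_comp σ fun i => ‖k i‖
      simp only [this]
  choose ψ hψ hb using hex
  have hs : Summable fun n => ‖ψ n‖ ^ 2 := by
    refine Summable.of_nonneg_of_le (fun n => sq_nonneg _)
      (fun n => pow_le_pow_left₀ (norm_nonneg _) (hb n) 2) ?_
    simp only [mul_pow]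
    exact (hasSum_norm_sq Φ).summable.mul_left _
  let Ψ : Fock := ⟨ψ, memℓp_two hs⟩
  refine ⟨Ψ, Φ - ((μ : ℂ) * Complex.I) • Ψ, mem_graph_dGamma.2 fun n => ?_, sub_add_cancel _ _⟩
  filter_upwards [hψ n, Lp.coeFn_sub (Φ n).1 (((μ : ℂ) * Complex.I) • (ψ n).1),
    Lp.coeFn_smul ((μ : ℂ) * Complex.I) (ψ n).1] with k h1 h2 h3
  have h4 : (((Φ - ((μ : ℂ) * Complex.I) • Ψ : Fock) n).1 : (Fin n → R3) → Pol n) k =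
      (Φ n).1 k - ((μ : ℂ) * Complex.I) • (ψ n).1 k := by
    refine h2.trans ?_
    rw [Pi.sub_apply, h3, Pi.smul_apply]
  rw [h4]
  change _ = _ • (ψ n).1 k
  rw [h1, sub_eq_iff_eq_add, ← add_smul, smul_inv_smul₀ (hne _)]

end Fields

/-! ## Coherent states and Wick symbols of Segal fields -/

section Wick

theorem coherent_apply (h : ℝ) (X : photon) (n : ℕ) : coherent h X n = coherentComp h X n := rfl

theorem norm_coherentComp_sq {h : ℝ} (hh : 0 < h) (X : photon) (n : ℕ) :
    ‖coherentComp h X n‖ ^ 2 =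
      Real.exp (-(‖X‖ ^ 2 / (2 * h))) * ((‖X‖ ^ 2 / (2 * h)) ^ n / n.factorial) := by
  have h1 : Real.sqrt (2 * h) ^ 2 = 2 * h := Real.sq_sqrt (by positivity)
  have h2 : Real.sqrt (n.factorial) ^ 2 = n.factorial := Real.sq_sqrt (by positivity)
  have h3 : Real.exp (-(‖X‖ ^ 2 / (2 * h))) = Real.exp (-‖X‖ ^ 2 / (4 * h)) ^ 2 := by
    rw [← Real.exp_nat_mul]
    congr 1
    push_cast
    field_simp
    ring
  have h4 : ∀ e y s F : ℝ, (e / (s ^ n * F) * y ^ n) ^ 2 =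
      e ^ 2 * ((y ^ 2 / s ^ 2) ^ n / F ^ 2) := fun e y s F => by
    simp only [div_eq_mul_inv, mul_pow, mul_inv, inv_pow]
    ring
  rw [coherentComp, norm_smul, norm_tensPow, Complex.norm_real,
    Real.norm_of_nonneg (by positivity), h4, h1, h2, ← h3]

theorem norm_coherent {h : ℝ} (hh : 0 < h) (X : photon) : ‖coherent h X‖ = 1 := by
  have h1 := hasSum_norm_sq (coherent h X)
  simp only [coherent_apply, norm_coherentComp_sq hh] at h1
  have h2 := (NormedSpace.expSeries_div_hasSum_exp (‖X‖ ^ 2 / (2 * h))).mul_left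
    (Real.exp (-(‖X‖ ^ 2 / (2 * h))))
  rw [← Real.exp_eq_exp_ℝ, ← Real.exp_add, neg_add_cancel, Real.exp_zero] at h2
  exact (pow_eq_one_iff_of_nonneg (norm_nonneg _) two_ne_zero).1 (h1.unique h2)

theorem coherent_coeff_succ {h : ℝ} (hh : 0 < h) (e : ℝ) (n : ℕ) (w : ℂ) :
    ((e / (Real.sqrt (2 * h) ^ (n + 1) * Real.sqrt ((n + 1).factorial)) : ℝ) : ℂ) *
      (((Real.sqrt (n + 1) : ℝ) : ℂ) * w) = w / ((Real.sqrt (2 * h) : ℝ) : ℂ) *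
        ((e / (Real.sqrt (2 * h) ^ n * Real.sqrt (n.factorial)) : ℝ) : ℂ) := by
  have h1 : Real.sqrt ((n + 1).factorial) = Real.sqrt (n + 1) * Real.sqrt n.factorial := by
    rw [← Real.sqrt_mul (by positivity), Nat.factorial_succ]
    push_cast
    rfl
  have hs : ((Real.sqrt (2 * h) : ℝ) : ℂ) ≠ 0 := by
    exact_mod_cast (Real.sqrt_pos.2 (by positivity : 0 < 2 * h)).ne'
  have hn : ((Real.sqrt (n + 1) : ℝ) : ℂ) ≠ 0 := by
    exact_mod_cast (Real.sqrt_pos.2 (by positivity : (0 : ℝ) < n + 1)).ne'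
  have hf : ((Real.sqrt n.factorial : ℝ) : ℂ) ≠ 0 := by
    exact_mod_cast (Real.sqrt_pos.2 (by positivity : (0 : ℝ) < n.factorial)).ne'
  rw [h1]
  push_cast
  field_simp
  ring

/-- The factor √(n+1) produced by annihilation cancels the one in √((n+1)!), and one power of √(2h)
is left over. -/
theorem annihilate_coherent {h : ℝ} (hh : 0 < h) (f X : photon) (n : ℕ) :
    annihilate f n (coherent h X (n + 1)) =
      (inner ℂ f X / ((Real.sqrt (2 * h) : ℝ) : ℂ)) • coherent h X n := by
  refine (map_smul (annihilate f n) _ (tensPow X (n + 1))).trans ?_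
  rw [annihilate_tensPow, smul_smul, coherent_coeff_succ hh]
  exact (smul_smul _ _ _).symm

theorem exists_isLadder_coherent {h : ℝ} (hh : 0 < h) (f X : photon) :
    ∃ C, IsLadder f (coherent h X)
      ((inner ℂ f X / ((Real.sqrt (2 * h) : ℝ) : ℂ)) • coherent h X) C := by
  let c : ∀ n, sector n := fun n => match n with
    | 0 => 0
    | n + 1 => create f n (coherent h X n)
  set r : ℝ := ‖X‖ ^ 2 / (2 * h) with hr
  have hr0 : 0 ≤ r := by positivity
  have hc : ∀ n, ‖create f n (coherent h X n)‖ ^ 2 ≤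
      ‖f‖ ^ 2 * Real.exp (-r) * ((2 * r) ^ n / n.factorial) := fun n => by
    have h1 := norm_create_le f n (coherent h X n)
    -- This absorbs the growth of a*(f) into an exponential series at 2r, so coherent states lie in
    -- the domain.
    have h2 : (n : ℝ) + 1 ≤ 2 ^ n := by exact_mod_cast Nat.lt_two_pow_self (n := n)
    calc ‖create f n (coherent h X n)‖ ^ 2
        ≤ (Real.sqrt (n + 1) * (‖f‖ * ‖coherent h X n‖)) ^ 2 :=
          pow_le_pow_left₀ (norm_nonneg _) h1 2
      _ = ‖f‖ ^ 2 * Real.exp (-r) * ((n + 1) * (r ^ n / n.factorial)) := by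
          rw [mul_pow, mul_pow, Real.sq_sqrt (by positivity), coherent_apply,
            norm_coherentComp_sq hh]
          ring
      _ ≤ ‖f‖ ^ 2 * Real.exp (-r) * (2 ^ n * (r ^ n / n.factorial)) := by gcongr
      _ = _ := by rw [mul_pow]; ring
  have hs : Summable fun n => ‖c n‖ ^ 2 := by
    rw [← summable_nat_add_iff 1]
    exact Summable.of_nonneg_of_le (fun n => sq_nonneg _) hc
      ((Real.summable_pow_div_factorial _).mul_left _)
  refine ⟨⟨c, memℓp_two hs⟩, fun n => ?_, rfl, fun _ => rfl⟩
  rw [annihilate_coherent hh]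
  rfl

theorem mem_graph_segalH {h : ℝ} {V : photon} {Ψ Φ : Fock} :
    (Ψ, Φ) ∈ (segalH h V).graph ↔
      ∃ Θ, (Ψ, Θ) ∈ (segal V).graph ∧ ((Real.sqrt h : ℝ) : ℂ) • Θ = Φ :=
  mem_graph_smul

theorem segal_symbol_coeff {h : ℝ} (hh : 0 < h) (w : ℂ) :
    ((Real.sqrt h : ℝ) : ℂ) * ((((Real.sqrt 2)⁻¹ : ℝ) : ℂ) *
      (w / ((Real.sqrt (2 * h) : ℝ) : ℂ) +
        (starRingEnd ℂ) (w / ((Real.sqrt (2 * h) : ℝ) : ℂ)))) = ((w.re : ℝ) : ℂ) := by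
  have hs2 : ((Real.sqrt 2 : ℝ) : ℂ) ≠ 0 := by
    exact_mod_cast (Real.sqrt_pos.2 two_pos).ne'
  have hsh : ((Real.sqrt h : ℝ) : ℂ) ≠ 0 := by
    exact_mod_cast (Real.sqrt_pos.2 hh).ne'
  have hsq : ((Real.sqrt 2 : ℝ) : ℂ) ^ 2 = 2 := by
    rw [← Complex.ofReal_pow, Real.sq_sqrt two_pos.le]
    norm_cast
  rw [map_div₀, Complex.conj_ofReal, Real.sqrt_mul two_pos.le, ← add_div, Complex.add_conj]
  push_cast
  field_simp
  rw [hsq]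

theorem inner_smul_field {V : Type*} [NormedAddCommGroup V] [InnerProductSpace ℂ V] {Ψ C : V}
    {z : ℂ} (c d : ℂ) (hΨ : ‖Ψ‖ = 1) (h : (inner ℂ (z • Ψ) Ψ : ℂ) = inner ℂ Ψ C) :
    (inner ℂ Ψ (c • (d • (z • Ψ + C))) : ℂ) = c * (d * (z + (starRingEnd ℂ) z)) := by
  have h1 : (inner ℂ Ψ Ψ : ℂ) = 1 := by
    rw [inner_self_eq_norm_sq_to_K, hΨ]
    simp
  rw [inner_smul_left, h1, mul_one] at h
  rw [inner_smul_right, inner_smul_right, inner_add_right, inner_smul_right, h1, mul_one, h]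

/-- The coherent state is a unit eigenvector of a(V), and a*(V) contributes the conjugate
eigenvalue, so twice a real part appears; the factors √h, 1/√2 and 1/√(2h) reduce it to Re⟨V, X⟩. -/
theorem hasWickSymbol_segalH {h : ℝ} (hh : 0 < h) (V : photon) :
    HasWickSymbol h (segalH h V) fun X => (((inner ℂ V X : ℂ).re : ℝ) : ℂ) := by
  intro X
  obtain ⟨C, hC⟩ := exists_isLadder_coherent hh V X
  have hg : (coherent h X, ((Real.sqrt h : ℝ) : ℂ) • ((((Real.sqrt 2)⁻¹ : ℝ) : ℂ) •
      ((inner ℂ V X / ((Real.sqrt (2 * h) : ℝ) : ℂ)) • coherent h X + C))) ∈ (segalH h V).graph :=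
    mem_graph_segalH.2 ⟨_, hC.graph, rfl⟩
  obtain ⟨hX, hv⟩ := mem_graph_iff_exists.1 hg
  refine ⟨hX, ?_⟩
  refine (congrArg (fun v => (inner ℂ (coherent h X) v : ℂ)) hv).trans ?_
  exact (inner_smul_field _ _ (norm_coherent hh X) (hC.inner_eq hC)).trans
    (segal_symbol_coeff hh (inner ℂ V X))

theorem HasWickSymbol.unique {h : ℝ} {A : Fock →ₗ.[ℂ] Fock} {f g : photon → ℂ}
    (hf : HasWickSymbol h A f) (hg : HasWickSymbol h A g) : f = g := by
  funext X
  obtain ⟨_, h1⟩ := hf X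
  obtain ⟨_, h2⟩ := hg X
  exact h1.symm.trans h2

theorem HasWickSymbol.wickSymbol_eq {h : ℝ} {A : Fock →ₗ.[ℂ] Fock} {f : photon → ℂ}
    (hf : HasWickSymbol h A f) : wickSymbol h A = f := by
  funext X
  obtain ⟨hX, h1⟩ := hf X
  rw [wickSymbol, dif_pos hX, h1]

/-- A vector is determined by the real functional X ↦ Re⟨V, X⟩: test it on X = V - W. -/
theorem segalH_symbol_injective {h : ℝ} (hh : 0 < h) {V W : photon} {f : photon → ℂ}
    (hV : HasWickSymbol h (segalH h V) f) (hW : HasWickSymbol h (segalH h W) f) : V = W := by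
  have h1 := (hasWickSymbol_segalH hh V).unique hV
  have h2 := (hasWickSymbol_segalH hh W).unique hW
  have h3 : (inner ℂ V (V - W) : ℂ).re = (inner ℂ W (V - W) : ℂ).re := by
    exact_mod_cast congrFun (h1.trans h2.symm) (V - W)
  have h4 : (inner ℂ (V - W) (V - W) : ℂ).re = 0 := by
    have : (inner ℂ (V - W) (V - W) : ℂ) = inner ℂ V (V - W) - inner ℂ W (V - W) :=
      inner_sub_left V W (V - W)
    rw [this, Complex.sub_re, h3, sub_self]
  have h5 : ‖V - W‖ ^ 2 = 0 := by
    have h6 : RCLike.re (inner ℂ (V - W) (V - W) : ℂ) = ‖V - W‖ ^ 2 :=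
      inner_self_eq_norm_sq (𝕜 := ℂ) (V - W)
    exact h6.symm.trans h4
  exact sub_eq_zero.1 (norm_eq_zero.1 (by simpa using h5))

theorem hasWickSymbol_elecField (χ : SchwartzMap ℝ ℂ) {h : ℝ} (hh : 0 < h) (x : R3) (m : Fin 3) :
    HasWickSymbol h (elecField χ h x m) (wickSymbol h (elecField χ h x m)) := by
  have h1 := hasWickSymbol_segalH hh (elecVec χ x m)
  rw [elecField, h1.wickSymbol_eq]
  exact h1

/-- The two helicity operators cancel by isometry, and -Re(i⟨B, X⟩) = Re⟨iB, X⟩ because the inner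
product is antilinear on the left. -/
theorem elecPolSymbol_eq (χ : SchwartzMap ℝ ℂ) {h : ℝ} (hh : 0 < h) (x : R3) (m : Fin 3) :
    elecPolSymbol χ h x m =
      fun X => (((inner ℂ (Complex.I • magVec χ x m) X : ℂ).re : ℝ) : ℂ) := by
  have key : ∀ w : ℂ, -(((Complex.I * w).re : ℝ) : ℂ) =
      ((((starRingEnd ℂ) Complex.I * w).re : ℝ) : ℂ) := fun w => by simp
  funext X
  have h1 : wickSymbol h (elecField χ h x m) (helicity (Complex.I • X)) =
      (((inner ℂ (helicity (magVec χ x m)) (helicity (Complex.I • X)) : ℂ).re : ℝ) : ℂ) :=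
    congrFun (hasWickSymbol_segalH hh (elecVec χ x m)).wickSymbol_eq _
  have h2 : (inner ℂ (helicity (magVec χ x m)) (helicity (Complex.I • X)) : ℂ) =
      Complex.I * inner ℂ (magVec χ x m) X :=
    (inner_helicity _ _).trans (photon_inner_smul_right _ _ _)
  have h3 := photon_inner_smul_left Complex.I (magVec χ x m) X
  refine (congrArg Neg.neg (h1.trans (congrArg (fun w : ℂ => ((w.re : ℝ) : ℂ)) h2))).trans ?_
  exact (key _).trans (congrArg (fun w : ℂ => ((w.re : ℝ) : ℂ)) h3).symm

theorem hasWickSymbol_elecPolSymbol (χ : SchwartzMap ℝ ℂ) {h : ℝ} (hh : 0 < h) (x : R3)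
    (m : Fin 3) :
    HasWickSymbol h (segalH h (Complex.I • magVec χ x m)) (elecPolSymbol χ h x m) := by
  rw [elecPolSymbol_eq χ hh]
  exact hasWickSymbol_segalH hh _

theorem elecPol_eq (χ : SchwartzMap ℝ ℂ) {h : ℝ} (hh : 0 < h) (x : R3) (m : Fin 3) :
    elecPol χ h x m = segalH h (Complex.I • magVec χ x m) := by
  have h1 := hasWickSymbol_elecPolSymbol χ hh x m
  have h2 := Classical.epsilon_spec
    (p := fun V : photon => HasWickSymbol h (segalH h V) (elecPolSymbol χ h x m)) ⟨_, h1⟩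
  rw [elecPol, segalH_symbol_injective hh h2 h1]

end Wick

/-! ## Finite Hilbert sums -/

section FiniteSum

variable {F : Type*} [NormedAddCommGroup F] {ι : Type*} [Fintype ι]

theorem norm_le_sum_norm_apply (ψ : PiLp 2 fun _ : ι => F) : ‖ψ‖ ≤ ∑ s, ‖ψ s‖ := by
  rw [PiLp.norm_eq_of_L2]
  refine Real.sqrt_le_iff.2 ⟨Finset.sum_nonneg fun s _ => norm_nonneg _, ?_⟩
  exact Finset.sum_sq_le_sq_sum_of_nonneg fun s _ => norm_nonneg _

/-- The constant is crude, but the spin space is finite dimensional and an infinitesimal bound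
absorbs any fixed factor. -/
theorem norm_le_card_mul {ψ : PiLp 2 fun _ : ι => F} {c : ℝ} (h : ∀ s, ‖ψ s‖ ≤ c) :
    ‖ψ‖ ≤ Fintype.card ι * c := by
  refine (norm_le_sum_norm_apply ψ).trans ((Finset.sum_le_sum fun s _ => h s).trans ?_)
  rw [Finset.sum_const, nsmul_eq_mul, Finset.card_univ]

variable [InnerProductSpace ℂ F]

theorem inner_sum_matrix {S : Matrix ι ι ℂ} (hS : S.IsHermitian) {u v a b : ι → F}
    (h : ∀ s s', (inner ℂ (a s) (v s') : ℂ) = inner ℂ (u s) (b s')) :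
    ∑ s, (inner ℂ (∑ s', S s s' • a s') (v s) : ℂ) = ∑ s, inner ℂ (u s) (∑ s', S s s' • b s') := by
  simp only [sum_inner, inner_sum, inner_smul_left, inner_smul_right, h]
  rw [Finset.sum_comm]
  refine Finset.sum_congr rfl fun s _ => Finset.sum_congr rfl fun s' _ => ?_
  rw [← hS.apply s s']
  rfl

end FiniteSum

/-! ## Operators on the photon-spin space -/

section Tensor

variable {N : ℕ} {A B : Fock →ₗ.[ℂ] Fock} {S : Matrix (Fin N → Fin 2) (Fin N → Fin 2) ℂ}
  {ψ θ : Space N}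

theorem space_ext {ψ θ : Space N} (h : ∀ s, ψ s = θ s) : ψ = θ := PiLp.ext h

theorem mem_graph_tensorI : (ψ, θ) ∈ (tensorI (N := N) A).graph ↔ ∀ s, (ψ s, θ s) ∈ A.graph := by
  rw [mem_graph_iff_exists]
  constructor
  · rintro ⟨hx, rfl⟩ s
    exact mem_graph_iff_exists.2 ⟨hx s, rfl⟩
  · intro h
    have h1 := fun s => mem_graph_iff_exists.1 (h s)
    exact ⟨fun s => (h1 s).1, space_ext fun s => (h1 s).2⟩

theorem mem_graph_tensorS : (ψ, θ) ∈ (tensorS S).graph ↔ ∀ s, θ s = ∑ s', S s s' • ψ s' := by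
  refine mem_graph_everywhere.trans ⟨fun h s => ?_, fun h => space_ext h⟩
  rw [h]
  rfl

theorem mem_graph_tensor : (ψ, θ) ∈ (tensor A S).graph ↔
    ∃ φ : Space N, (∀ s, (ψ s, φ s) ∈ A.graph) ∧ ∀ s, θ s = ∑ s', S s s' • φ s' := by
  rw [tensor, mem_graph_opComp]
  exact exists_congr fun φ => and_congr mem_graph_tensorI mem_graph_tensorS

theorem ShiftSurjective.tensorI {μ : ℝ} (h : ShiftSurjective A μ) :
    ShiftSurjective (tensorI (N := N) A) μ := by
  intro y
  choose x z hxz hw using fun s => h (y s)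
  exact ⟨WithLp.toLp 2 x, WithLp.toLp 2 z, mem_graph_tensorI.2 hxz, space_ext hw⟩

theorem InfinitesimallyBounded.tensorI (h : InfinitesimallyBounded A B) :
    InfinitesimallyBounded (tensorI (N := N) A) (tensorI B) := by
  intro ε hε
  set c : ℝ := (Fintype.card (Fin N → Fin 2) : ℝ) with hc
  have hc0 : 0 ≤ c := Nat.cast_nonneg _
  obtain ⟨C, hC0, hC⟩ := h (ε / (c + 1)) (by positivity)
  refine ⟨c * C, by positivity, fun ψ η hη => ?_⟩
  choose z hz hb using fun s => hC _ _ (mem_graph_tensorI.1 hη s)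
  refine ⟨WithLp.toLp 2 z, mem_graph_tensorI.2 hz, ?_⟩
  have h1 : ∀ s, ‖z s‖ ≤ ε / (c + 1) * ‖η‖ + C * ‖ψ‖ := fun s =>
    (hb s).trans (add_le_add
      (mul_le_mul_of_nonneg_left (PiLp.norm_apply_le η s) (by positivity))
      (mul_le_mul_of_nonneg_left (PiLp.norm_apply_le ψ s) hC0))
  refine (norm_le_card_mul (ψ := (WithLp.toLp 2 z : Space N)) h1).trans ?_
  have h2 : c * (ε / (c + 1)) ≤ ε := by
    rw [← mul_div_assoc, div_le_iff₀ (by positivity)]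
    nlinarith
  have h3 := mul_le_mul_of_nonneg_right h2 (norm_nonneg η)
  linarith

theorem exists_norm_tensorS_le (S : Matrix (Fin N → Fin 2) (Fin N → Fin 2) ℂ) :
    ∃ K : ℝ, ∀ ψ : Space N, ∃ θ, (ψ, θ) ∈ (tensorS S).graph ∧ ‖θ‖ ≤ K * ‖ψ‖ := by
  set b : ℝ := ∑ s, ∑ s', ‖S s s'‖ with hb
  refine ⟨Fintype.card (Fin N → Fin 2) * b, fun ψ =>
    ⟨WithLp.toLp 2 fun s => ∑ s', S s s' • ψ s', mem_graph_tensorS.2 fun s => rfl, ?_⟩⟩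
  rw [mul_assoc]
  refine norm_le_card_mul fun s => ?_
  have h1 : ∀ s', ‖S s s' • ψ s'‖ ≤ ‖S s s'‖ * ‖ψ‖ := fun s' =>
    (norm_smul_le _ _).trans (mul_le_mul_of_nonneg_left (PiLp.norm_apply_le ψ s') (norm_nonneg _))
  calc ‖∑ s', S s s' • ψ s'‖ ≤ ∑ s', ‖S s s'‖ * ‖ψ‖ :=
        norm_sum_le_of_le _ fun s' _ => h1 s'
    _ = (∑ s', ‖S s s'‖) * ‖ψ‖ := by rw [Finset.sum_mul]
    _ ≤ b * ‖ψ‖ := by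
      refine mul_le_mul_of_nonneg_right ?_ (norm_nonneg _)
      exact Finset.single_le_sum (f := fun s => ∑ s', ‖S s s'‖)
        (fun s _ => Finset.sum_nonneg fun s' _ => norm_nonneg _) (Finset.mem_univ s)

theorem InfinitesimallyBounded.tensor (h : InfinitesimallyBounded A B)
    (S : Matrix (Fin N → Fin 2) (Fin N → Fin 2) ℂ) :
    InfinitesimallyBounded (NMR.tensorI A) (tensor B S) := by
  obtain ⟨K, hK⟩ := exists_norm_tensorS_le S
  refine h.tensorI.of_bounded K fun x z hz => ?_
  obtain ⟨w, hw, hb⟩ := hK z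
  exact ⟨w, mem_graph_opComp.2 ⟨z, hz, hw⟩, hb⟩

theorem domain_tensorI_le_tensor (h : A.domain ≤ B.domain)
    (S : Matrix (Fin N → Fin 2) (Fin N → Fin 2) ℂ) :
    (tensorI (N := N) A).domain ≤ (tensor B S).domain := by
  intro ψ hψ
  have h1 := fun s => LinearPMap.mem_domain_iff.1 (h (hψ s))
  choose z hz using h1
  exact mem_domain_graph (mem_graph_tensor.2
    ⟨WithLp.toLp 2 z, hz, fun s => (rfl : (WithLp.toLp 2 fun s => ∑ s', S s s' • z s' : Space N) s
      = _)⟩)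

theorem SymmetricOn.tensor (h : SymmetricOn A B) (hS : S.IsHermitian) :
    SymmetricOn (tensorI A) (tensor B S) := by
  refine ⟨domain_tensorI_le_tensor h.1 S, fun ψ hψ ψ' hψ' z z' hz hz' => ?_⟩
  obtain ⟨φ, h1, h2⟩ := mem_graph_tensor.1 hz
  obtain ⟨φ', h1', h2'⟩ := mem_graph_tensor.1 hz'
  rw [PiLp.inner_apply, PiLp.inner_apply]
  simp only [h2, h2']
  exact inner_sum_matrix hS fun s s' => h.2 _ (hψ s) _ (hψ' s') _ _ (h1 s) (h1' s')

theorem SymmetricOn.tensorI (h : SymmetricOn A B) :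
    SymmetricOn (tensorI (N := N) A) (tensorI B) := by
  refine ⟨fun ψ hψ s => h.1 (hψ s), fun ψ hψ ψ' hψ' z z' hz hz' => ?_⟩
  rw [PiLp.inner_apply, PiLp.inner_apply]
  exact Finset.sum_congr rfl fun s _ => h.2 _ (hψ s) _ (hψ' s) _ _
    (mem_graph_tensorI.1 hz s) (mem_graph_tensorI.1 hz' s)

theorem isHermitian_pauli (m : Fin 3) : (pauli m).IsHermitian := by
  refine Matrix.IsHermitian.ext fun i j => ?_
  fin_cases m <;> fin_cases i <;> fin_cases j <;> simp [pauli]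

theorem isHermitian_spin (l : Fin N) (m : Fin 3) : (spin l m).IsHermitian := by
  refine Matrix.IsHermitian.ext fun s s' => ?_
  simp only [spin, Matrix.of_apply, star_prod]
  refine Finset.prod_congr rfl fun j _ => ?_
  split_ifs
  · exact (isHermitian_pauli m).apply _ _
  · exact Matrix.isHermitian_one.apply _ _

/-- `A ⊗ S` is contained in `(A ⊗ I) ∘ (I ⊗ S)`. -/
theorem tensor_le_opComp (A : Fock →ₗ.[ℂ] Fock)
    (S : Matrix (Fin N → Fin 2) (Fin N → Fin 2) ℂ) :
    tensor A S ≤ opComp (tensorI A) (tensorS S) := by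
  rw [le_iff_graph]
  intro ψ θ h
  obtain ⟨φ, h1, h2⟩ := mem_graph_tensor.1 h
  refine mem_graph_opComp.2 ⟨WithLp.toLp 2 fun s => ∑ s', S s s' • ψ s',
    mem_graph_tensorS.2 fun s => rfl, mem_graph_tensorI.2 fun s => ?_⟩
  rw [h2]
  have h3 := A.graph.sum_mem (t := Finset.univ) (f := fun s' => S s s' • (ψ s', φ s'))
    fun s' _ => A.graph.smul_mem _ (h1 s')
  have h4 : ∑ s', S s s' • (ψ s', φ s') = (∑ s', S s s' • ψ s', ∑ s', S s s' • φ s') :=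
    Prod.ext Prod.fst_sum Prod.snd_sum
  rw [h4] at h3
  exact h3

end Tensor

/-! ## Perturbations and extensions by continuity -/

section Perturbation

variable {E : Type*} [NormedAddCommGroup E] [InnerProductSpace ℂ E] {A B T : E →ₗ.[ℂ] E}

theorem sum_le_sum_graph {ι : Type*} {s : Finset ι} {A B : ι → E →ₗ.[ℂ] E}
    (h : ∀ i ∈ s, A i ≤ B i) : ∑ i ∈ s, A i ≤ ∑ i ∈ s, B i := by
  classical
  induction s using Finset.induction_on with
  | empty => simp
  | insert i s hi ih =>
    rw [Finset.sum_insert hi, Finset.sum_insert hi, le_iff_graph]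
    intro x y hxy
    obtain ⟨u, v, hu, hv, rfl⟩ := mem_graph_add.1 hxy
    exact mem_graph_add.2 ⟨u, v, le_iff_graph.1 (h i (Finset.mem_insert_self i s)) _ _ hu,
      le_iff_graph.1 (ih fun j hj => h j (Finset.mem_insert_of_mem hj)) _ _ hv, rfl⟩

theorem neg_le_neg_graph (h : A ≤ B) : -A ≤ -B := by
  rw [le_iff_graph] at h ⊢
  exact fun x y hxy => mem_graph_neg.2 (h _ _ (mem_graph_neg.1 hxy))

theorem heisenberg_mono {H : E →ₗ.[ℂ] E} {h t : ℝ} (hAB : A ≤ B) :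
    heisenberg H h t A ≤ heisenberg H h t B := by
  rw [le_iff_graph] at hAB ⊢
  intro x y hxy
  obtain ⟨u, hu, hy⟩ := mem_graph_heisenberg.1 hxy
  exact mem_graph_heisenberg.2 ⟨u, hAB _ _ hu, hy⟩

theorem IsUnitaryGroup.apply_neg {U : ℝ → E ≃ₗᵢ[ℂ] E} (hU : IsUnitaryGroup A U) (s : ℝ) (ψ : E) :
    U s (U (-s) ψ) = ψ := by
  rw [← hU.add, add_neg_cancel, hU.zero]

theorem IsUnitaryGroup.neg_apply {U : ℝ → E ≃ₗᵢ[ℂ] E} (hU : IsUnitaryGroup A U) (s : ℝ) (ψ : E) :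
    U (-s) (U s ψ) = ψ := by
  rw [← hU.add, neg_add_cancel, hU.zero]

/-- The identity e^{-i(t/h)H} e^{i(t/h)H} = 1 is inserted between the two factors. -/
theorem heisenberg_opComp {H : E →ₗ.[ℂ] E} (hU : IsUnitaryGroup H (expI H)) (h t : ℝ) :
    heisenberg H h t (opComp A B) ≤ opComp (heisenberg H h t A) (heisenberg H h t B) := by
  rw [le_iff_graph]
  intro x y hxy
  obtain ⟨u, hu, rfl⟩ := mem_graph_heisenberg.1 hxy
  obtain ⟨v, hv, hvu⟩ := mem_graph_opComp.1 hu
  refine mem_graph_opComp.2 ⟨_, mem_graph_heisenberg.2 ⟨v, hv, rfl⟩,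
    mem_graph_heisenberg.2 ⟨u, ?_, rfl⟩⟩
  rwa [hU.neg_apply]

theorem domain_add_eq (h : A.domain ≤ B.domain) : (A + B).domain = A.domain :=
  inf_eq_left.2 h

theorem SymmetricOn.add_self (hA : SymmetricOn A A) (hB : SymmetricOn A B) :
    SymmetricOn (A + B) (A + B) :=
  (hA.add hB).mono (domain_add_eq hB.1).le

theorem isSelfAdjoint_add [CompleteSpace E] (hA : SymmetricOn A A)
    (hs : ∀ μ : ℝ, μ ≠ 0 → ShiftSurjective A μ) (hBs : SymmetricOn A B)
    (hB : InfinitesimallyBounded A B) : IsSelfAdjoint (A + B) := by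
  obtain ⟨M, hM, h⟩ := hA.kato_rellich hs hB
  have hM' : M ≤ |M| := le_abs_self M
  exact (hA.add_self hBs).isSelfAdjoint hM.ne' (h M hM') (h (-M) (by rwa [abs_neg]))

theorem isUnitaryGroup_expI_add [CompleteSpace E] (hA : SymmetricOn A A)
    (hs : ∀ μ : ℝ, μ ≠ 0 → ShiftSurjective A μ) (hBs : SymmetricOn A B)
    (hB : InfinitesimallyBounded A B) : IsUnitaryGroup (A + B) (expI (A + B)) := by
  obtain ⟨M, hM, h⟩ := hA.kato_rellich hs hB
  exact Classical.epsilon_spec ((hA.add_self hBs).exists_isUnitaryGroup hM h)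

/-! ### Graph norms, cores and the extension by continuity. -/

/-- `T` is defined on `D(H)` and bounded for the graph norm of `H`. -/
def GraphBounded (H T : E →ₗ.[ℂ] E) : Prop :=
  ∃ K : ℝ, ∀ ψ η, (ψ, η) ∈ H.graph → ∃ θ, (ψ, θ) ∈ T.graph ∧ ‖θ‖ ≤ K * (‖ψ‖ + ‖η‖)

theorem GraphBounded.add {H : E →ₗ.[ℂ] E} (hA : GraphBounded H A) (hB : GraphBounded H B) :
    GraphBounded H (A + B) := by
  obtain ⟨K, hK⟩ := hA
  obtain ⟨L, hL⟩ := hB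
  refine ⟨K + L, fun ψ η h => ?_⟩
  obtain ⟨u, hu, hu'⟩ := hK ψ η h
  obtain ⟨v, hv, hv'⟩ := hL ψ η h
  refine ⟨u + v, mem_graph_add.2 ⟨u, v, hu, hv, rfl⟩, (norm_add_le u v).trans ?_⟩
  linarith

theorem GraphBounded.neg {H : E →ₗ.[ℂ] E} (hA : GraphBounded H A) : GraphBounded H (-A) := by
  obtain ⟨K, hK⟩ := hA
  refine ⟨K, fun ψ η h => ?_⟩
  obtain ⟨u, hu, hu'⟩ := hK ψ η h
  exact ⟨-u, mem_graph_neg.2 (by rwa [neg_neg]), by rwa [norm_neg]⟩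

theorem GraphBounded.sum {H : E →ₗ.[ℂ] E} {ι : Type*} {s : Finset ι} {B : ι → E →ₗ.[ℂ] E}
    (h : ∀ i ∈ s, GraphBounded H (B i)) : GraphBounded H (∑ i ∈ s, B i) :=
  Finset.sum_induction B (GraphBounded H) (fun _ _ h1 h2 => h1.add h2)
    ⟨0, fun _ _ _ => ⟨0, mem_graph_zero.2 rfl, by simp⟩⟩ h

theorem GraphBounded.domain_le {H : E →ₗ.[ℂ] E} (h : GraphBounded H T) : H.domain ≤ T.domain := by
  intro x hx
  obtain ⟨y, hy⟩ := LinearPMap.mem_domain_iff.1 hx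
  obtain ⟨K, hK⟩ := h
  obtain ⟨z, hz, -⟩ := hK x y hy
  exact mem_domain_graph hz

/-- The evolution commutes with H and is isometric, so it preserves the graph norm and the constant
does not change. -/
theorem GraphBounded.heisenberg {H : E →ₗ.[ℂ] E} (hU : IsUnitaryGroup H (expI H))
    (hT : GraphBounded H T) (h t : ℝ) : GraphBounded H (heisenberg H h t T) := by
  obtain ⟨K, hK⟩ := hT
  refine ⟨K, fun ψ η hψ => ?_⟩
  obtain ⟨θ, hθ, hb⟩ := hK _ _ (hU.graph_mem (-(t / h)) hψ)
  refine ⟨_, mem_graph_heisenberg.2 ⟨θ, hθ, rfl⟩, ?_⟩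
  simpa using hb

/-- The graph norm of a perturbed operator controls the unperturbed operator. -/
theorem InfinitesimallyBounded.norm_le (hB : InfinitesimallyBounded A B) :
    ∃ K : ℝ, 0 ≤ K ∧ ∀ ψ η, (ψ, η) ∈ (A + B).graph →
      ∃ θ, (ψ, θ) ∈ A.graph ∧ ‖θ‖ ≤ K * (‖ψ‖ + ‖η‖) := by
  -- With relative bound 1/2, the term ‖Aψ‖/2 in ‖Aψ‖ ≤ ‖(A + B)ψ‖ + ‖Bψ‖ is absorbed on the left.
  obtain ⟨C, hC0, hC⟩ := hB.bound (ε := 1 / 2) (by norm_num)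
  refine ⟨2 * (C + 1), by positivity, fun ψ η h => ?_⟩
  obtain ⟨u, v, hu, hv, rfl⟩ := mem_graph_add.1 h
  refine ⟨u, hu, ?_⟩
  have h1 := hC ψ u v hu hv
  have h2 : ‖u‖ ≤ ‖u + v‖ + ‖v‖ := norm_le_add_norm_add u v
  nlinarith [norm_nonneg ψ, norm_nonneg (u + v)]

theorem InfinitesimallyBounded.graphBounded_add (hB : InfinitesimallyBounded A B)
    (hT : InfinitesimallyBounded A T) : GraphBounded (A + B) T := by
  obtain ⟨K, hK0, hK⟩ := hB.norm_le
  obtain ⟨C, hC0, hC⟩ := hT 1 one_pos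
  refine ⟨K + C, fun ψ η h => ?_⟩
  obtain ⟨θ, hθ, hb⟩ := hK ψ η h
  obtain ⟨z, hz, hz'⟩ := hC ψ θ hθ
  refine ⟨z, hz, ?_⟩
  nlinarith [norm_nonneg ψ, norm_nonneg η]

/-- `D` is a core: the vectors of `D ∩ D(H)` are dense in `D(H)` for the graph norm. -/
def GraphDense (H : E →ₗ.[ℂ] E) (D : Set E) : Prop :=
  ∀ ψ η, (ψ, η) ∈ H.graph → ∃ (u v : ℕ → E), (∀ n, (u n, v n) ∈ H.graph ∧ u n ∈ D) ∧
    Tendsto u atTop (𝓝 ψ) ∧ Tendsto v atTop (𝓝 η)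

/-- The domain of the evolved operator is the image of D(C) under e^{i(t/h)H}. An approximating
sequence is obtained by evolving backward, approximating there, and evolving forward. -/
theorem GraphDense.heisenberg {H C : E →ₗ.[ℂ] E} (hU : IsUnitaryGroup H (expI H))
    (hC : GraphDense H (C.domain : Set E)) (h t : ℝ) :
    GraphDense H ((heisenberg H h t C).domain : Set E) := by
  intro ψ η hψ
  obtain ⟨u, v, huv, hu, hv⟩ := hC _ _ (hU.graph_mem (-(t / h)) hψ)
  refine ⟨fun n => expI H (t / h) (u n), fun n => expI H (t / h) (v n), fun n =>
    ⟨hU.graph_mem _ (huv n).1, ?_⟩, ?_, ?_⟩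
  · obtain ⟨w, hw⟩ := LinearPMap.mem_domain_iff.1 (huv n).2
    refine mem_domain_graph (mem_graph_heisenberg.2 ⟨w, ?_, rfl⟩)
    rwa [hU.neg_apply]
  · have h1 := ((expI H (t / h)).continuous.tendsto _).comp hu
    rwa [hU.apply_neg] at h1
  · have h1 := ((expI H (t / h)).continuous.tendsto _).comp hv
    rwa [hU.apply_neg] at h1

/-- This identifies the extension without knowing in advance that it exists. Applied to differences,
the bound on S makes D-images of graph-convergent sequences tend to the S-image of the limit;
density supplies such a sequence for every vector of D(H). -/
theorem mem_graph_graphExtension {H D S : E →ₗ.[ℂ] E} (hS : GraphBounded H S)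
    (hD : ∀ ψ η θ, (ψ, η) ∈ H.graph → (ψ, θ) ∈ D.graph → (ψ, θ) ∈ S.graph)
    (hdense : GraphDense H (D.domain : Set E)) {ψ θ : E} :
    (ψ, θ) ∈ (graphExtension H D).graph ↔ ∃ η, (ψ, η) ∈ H.graph ∧ (ψ, θ) ∈ S.graph := by
  obtain ⟨K, hK⟩ := hS
  have hb : ∀ ψ η θ, (ψ, η) ∈ H.graph → (ψ, θ) ∈ S.graph → ‖θ‖ ≤ K * (‖ψ‖ + ‖η‖) := by
    intro ψ η θ h1 h2
    obtain ⟨θ', h3, h4⟩ := hK ψ η h1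
    rwa [graph_unique h2 h3]
  have key : ∀ ψ η θ, (ψ, η) ∈ H.graph → (((ψ, η), θ) ∈
      (H.graph.comap (LinearMap.fst ℂ (E × E) E) ⊓
        D.graph.comap ((LinearMap.fst ℂ E E).prodMap LinearMap.id)).topologicalClosure ↔
      (ψ, θ) ∈ S.graph) := by
    intro ψ η θ hψ
    rw [← SetLike.mem_coe, Submodule.topologicalClosure_coe, mem_closure_iff_seq_limit]
    obtain ⟨θ', hθ', -⟩ := hK ψ η hψ
    constructor
    · rintro ⟨p, hp, hlim⟩
      have h1 : Tendsto (fun n => (p n).1.1) atTop (𝓝 ψ) :=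
        ((continuous_fst.comp continuous_fst).tendsto ((ψ, η), θ)).comp hlim
      have h2 : Tendsto (fun n => (p n).1.2) atTop (𝓝 η) :=
        ((continuous_snd.comp continuous_fst).tendsto ((ψ, η), θ)).comp hlim
      have h3 : Tendsto (fun n => (p n).2) atTop (𝓝 θ) :=
        (continuous_snd.tendsto ((ψ, η), θ)).comp hlim
      have h4 : ∀ n, ‖(p n).2 - θ'‖ ≤ K * (‖(p n).1.1 - ψ‖ + ‖(p n).1.2 - η‖) := fun n =>
        hb _ _ _ (H.graph.sub_mem (hp n).1 hψ)
          (S.graph.sub_mem (hD _ _ _ (hp n).1 (hp n).2) hθ')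
      have h5 : Tendsto (fun n => K * (‖(p n).1.1 - ψ‖ + ‖(p n).1.2 - η‖)) atTop (𝓝 0) := by
        simpa using ((tendsto_iff_norm_sub_tendsto_zero.1 h1).add
          (tendsto_iff_norm_sub_tendsto_zero.1 h2)).const_mul K
      have h6 := tendsto_iff_norm_sub_tendsto_zero.2
        (squeeze_zero (fun n => norm_nonneg _) h4 h5)
      rwa [tendsto_nhds_unique h3 h6]
    · intro hθ
      obtain ⟨u, v, huv, hu, hv⟩ := hdense ψ η hψ
      choose w hw using fun n => LinearPMap.mem_domain_iff.1 (huv n).2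
      refine ⟨fun n => ((u n, v n), w n), fun n => ⟨(huv n).1, hw n⟩,
        (hu.prodMk_nhds hv).prodMk_nhds ?_⟩
      have h4 : ∀ n, ‖w n - θ‖ ≤ K * (‖u n - ψ‖ + ‖v n - η‖) := fun n =>
        hb _ _ _ (H.graph.sub_mem (huv n).1 hψ)
          (S.graph.sub_mem (hD _ _ _ (huv n).1 (hw n)) hθ)
      have h5 : Tendsto (fun n => K * (‖u n - ψ‖ + ‖v n - η‖)) atTop (𝓝 0) := by
        simpa using ((tendsto_iff_norm_sub_tendsto_zero.1 hu).add
          (tendsto_iff_norm_sub_tendsto_zero.1 hv)).const_mul K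
      exact tendsto_iff_norm_sub_tendsto_zero.2 (squeeze_zero (fun n => norm_nonneg _) h4 h5)
  refine (mem_graph_toLinearPMap_iff ?_).trans ?_
  -- The closed relation is single valued because it is contained in the graph of S.
  · rintro y ⟨η, h1, h2⟩
    exact graph_unique ((key _ _ _ h1).1 h2) S.graph.zero_mem
  · exact exists_congr fun η => and_congr_right fun h1 => key _ _ _ h1

end Perturbation

/-! ## The Hamiltonian -/

section Hamiltonian

variable {N : ℕ} {E : Type*} [NormedAddCommGroup E] [InnerProductSpace ℂ E] {A B : E →ₗ.[ℂ] E}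

/-- The operator A enters only through its domain, which scaling does not change. -/
theorem SymmetricOn.smul_left (hB : SymmetricOn A B) (c : ℂ) : SymmetricOn (c • A) B := hB

theorem InfinitesimallyBounded.smul_left (hB : InfinitesimallyBounded A B) {h : ℝ} (hh : 0 < h) :
    InfinitesimallyBounded ((h : ℂ) • A) B := by
  intro ε hε
  obtain ⟨C, hC0, hC⟩ := hB (ε * h) (by positivity)
  refine ⟨C, hC0, fun x y hxy => ?_⟩
  obtain ⟨u, hu, rfl⟩ := mem_graph_smul.1 hxy
  obtain ⟨z, hz, hb⟩ := hC x u hu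
  refine ⟨z, hz, hb.trans (le_of_eq ?_)⟩
  rw [norm_smul, Complex.norm_real, Real.norm_of_nonneg hh.le, mul_assoc]

theorem ShiftSurjective.smul {h μ : ℝ} (hh : h ≠ 0) (hA : ShiftSurjective A (μ / h)) :
    ShiftSurjective ((h : ℂ) • A) μ := by
  intro y
  have hc : (h : ℂ) ≠ 0 := Complex.ofReal_ne_zero.2 hh
  obtain ⟨x, z, hxz, hw⟩ := hA ((h : ℂ)⁻¹ • y)
  refine ⟨x, (h : ℂ) • z, mem_graph_smul.2 ⟨z, hxz, rfl⟩, ?_⟩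
  rw [← smul_inv_smul₀ hc y, ← hw, smul_add, smul_smul]
  congr 2
  push_cast
  field_simp

theorem infinitesimallyBounded_scalar (A : E →ₗ.[ℂ] E) (c : ℂ) :
    InfinitesimallyBounded A (everywhere (c • (LinearMap.id : E →ₗ[ℂ] E))) := fun ε hε =>
  ⟨‖c‖, norm_nonneg _, fun x y _ => ⟨c • x, mem_graph_everywhere.2 rfl, by
    rw [norm_smul]
    have : 0 ≤ ε * ‖y‖ := by positivity
    linarith⟩⟩

theorem symmetricOn_scalar (A : E →ₗ.[ℂ] E) (c : ℝ) :
    SymmetricOn A (everywhere ((c : ℂ) • (LinearMap.id : E →ₗ[ℂ] E))) := by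
  refine ⟨le_top, fun x _ x' _ z z' hz hz' => ?_⟩
  rw [mem_graph_everywhere.1 hz, mem_graph_everywhere.1 hz']
  change (inner ℂ ((c : ℂ) • x) x' : ℂ) = inner ℂ x ((c : ℂ) • x')
  rw [inner_smul_left, inner_smul_right, Complex.conj_ofReal]

theorem symmetricOn_photonEnergy (h : ℝ) : SymmetricOn (photonEnergy h) (photonEnergy h) :=
  ((symmetricOn_dGamma _).real_smul h).smul_left _

theorem shiftSurjective_photonEnergy {h : ℝ} (hh : 0 < h) {μ : ℝ} (hμ : μ ≠ 0) :
    ShiftSurjective (photonEnergy h) μ :=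
  (shiftSurjective_dGamma (div_ne_zero hμ hh.ne')).smul hh.ne'

theorem infinitesimallyBounded_segalH {h : ℝ} (hh : 0 < h) {f g : photon}
    (hf : SqrtEnergyMul f g) : InfinitesimallyBounded (photonEnergy h) (segalH h f) :=
  ((infinitesimallyBounded_segal hf).smul _).smul_left hh

theorem symmetricOn_segalH (h : ℝ) {f g : photon} (hf : SqrtEnergyMul f g) :
    SymmetricOn (photonEnergy h) (segalH h f) :=
  ((symmetricOn_segal hf).real_smul _).smul_left _

variable (χ : SchwartzMap ℝ ℂ) (x : Fin N → R3) (β : Fin 3 → ℝ) {h : ℝ}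

theorem infinitesimallyBounded_interaction (hh : 0 < h) :
    InfinitesimallyBounded (tensorI (photonEnergy h)) (interaction χ x β h) :=
  InfinitesimallyBounded.sum fun l _ => InfinitesimallyBounded.sum fun m _ =>
    ((infinitesimallyBounded_scalar _ _).add
      (infinitesimallyBounded_segalH hh (sqrtEnergyMul_magVec χ (x l) m))).tensor _

theorem symmetricOn_interaction (h : ℝ) :
    SymmetricOn (tensorI (photonEnergy h)) (interaction χ x β h) :=
  SymmetricOn.sum fun l _ => SymmetricOn.sum fun m _ =>
    ((symmetricOn_scalar _ _).add
      (symmetricOn_segalH h (sqrtEnergyMul_magVec χ (x l) m))).tensor (isHermitian_spin l m)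

theorem domain_hamiltonian (h : ℝ) :
    (hamiltonian χ x β h).domain = (tensorI (N := N) (photonEnergy h)).domain :=
  domain_add_eq (symmetricOn_interaction χ x β h).1

theorem isSelfAdjoint_hamiltonian (hh : 0 < h) : IsSelfAdjoint (hamiltonian χ x β h) :=
  isSelfAdjoint_add (symmetricOn_photonEnergy h).tensorI
    (fun _ hμ => (shiftSurjective_photonEnergy hh hμ).tensorI)
    ((symmetricOn_interaction χ x β h).real_smul h)
    ((infinitesimallyBounded_interaction χ x β hh).smul _)

theorem isUnitaryGroup_hamiltonian (hh : 0 < h) :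
    IsUnitaryGroup (hamiltonian χ x β h) (expI (hamiltonian χ x β h)) :=
  isUnitaryGroup_expI_add (symmetricOn_photonEnergy h).tensorI
    (fun _ hμ => (shiftSurjective_photonEnergy hh hμ).tensorI)
    ((symmetricOn_interaction χ x β h).real_smul h)
    ((infinitesimallyBounded_interaction χ x β hh).smul _)

theorem graphBounded_hamiltonian (hh : 0 < h) {T : Space N →ₗ.[ℂ] Space N}
    (hT : InfinitesimallyBounded (tensorI (photonEnergy h)) T) :
    GraphBounded (hamiltonian χ x β h) T :=
  ((infinitesimallyBounded_interaction χ x β hh).smul _).graphBounded_add hT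

end Hamiltonian

/-! ## States with finitely many photons -/

section FinitelyMany

theorem exists_weighted {G : ℕ → Type*} [∀ n, NormedAddCommGroup (G n)]
    [∀ n, InnerProductSpace ℂ (G n)] (f : lp G 2) {M : ℕ} (hf : ∀ n, M ≤ n → f n = 0)
    (c : ℕ → ℂ) : ∃ g : lp G 2, ∀ n, g n = c n • f n := by
  have hs : Summable fun n => ‖c n • f n‖ ^ 2 := by
    refine summable_of_ne_finset_zero (s := Finset.range M) fun n hn => ?_
    rw [hf n (not_lt.1 fun h => hn (Finset.mem_range.2 h)), smul_zero, norm_zero,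
      zero_pow two_ne_zero]
  exact ⟨⟨fun n => c n • f n, memℓp_two hs⟩, fun n => rfl⟩

/-- Only finitely many components of `Ψ` are different from zero. -/
def FinitePhotons (Ψ : Fock) : Prop := ∃ M : ℕ, ∀ n, M ≤ n → Ψ n = 0

theorem FinitePhotons.add {Ψ Φ : Fock} (hΨ : FinitePhotons Ψ) (hΦ : FinitePhotons Φ) :
    FinitePhotons (Ψ + Φ) := by
  obtain ⟨M, hM⟩ := hΨ
  obtain ⟨L, hL⟩ := hΦ
  refine ⟨max M L, fun n hn => ?_⟩
  rw [lp.coeFn_add, Pi.add_apply, hM n (le_of_max_le_left hn), hL n (le_of_max_le_right hn),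
    add_zero]

theorem FinitePhotons.smul {Ψ : Fock} (hΨ : FinitePhotons Ψ) (c : ℂ) :
    FinitePhotons (c • Ψ) := by
  obtain ⟨M, hM⟩ := hΨ
  refine ⟨M, fun n hn => ?_⟩
  rw [lp.coeFn_smul, Pi.smul_apply, hM n hn, smul_zero]

theorem finitePhotons_zero : FinitePhotons 0 := ⟨0, fun _ _ => rfl⟩

theorem FinitePhotons.sum {ι : Type*} {s : Finset ι} {Ψ : ι → Fock}
    (h : ∀ i ∈ s, FinitePhotons (Ψ i)) : FinitePhotons (∑ i ∈ s, Ψ i) :=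
  Finset.sum_induction Ψ FinitePhotons (fun _ _ h1 h2 => h1.add h2) finitePhotons_zero h

theorem finitePhotons_truncate (M : ℕ) (Ψ : Fock) : FinitePhotons (truncate M Ψ) :=
  ⟨M, fun n hn => by rw [truncate_apply, if_neg (not_lt.2 hn)]⟩

theorem FinitePhotons.exists_number {Ψ : Fock} (h : FinitePhotons Ψ) :
    ∃ Φ, (Ψ, Φ) ∈ photonNumber.graph := by
  obtain ⟨M, hM⟩ := h
  obtain ⟨Φ, hΦ⟩ := exists_weighted Ψ hM fun n => (n : ℂ)
  exact ⟨Φ, mem_graph_photonNumber.2 hΦ⟩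

theorem sector_ae_smul {n : ℕ} {Ψ Θ : sector n} {m : (Fin n → R3) → ℂ}
    (h : ∀ᵐ k, Θ.1 k = m k • Ψ.1 k) (c : ℂ) :
    ∀ᵐ k, (c • Θ).1 k = m k • (c • Ψ).1 k := by
  filter_upwards [h, Lp.coeFn_smul c Ψ.1, Lp.coeFn_smul c Θ.1] with k h1 h2 h3
  refine h3.trans (Eq.trans ?_ (congrArg (fun v => m k • v) h2).symm)
  rw [Pi.smul_apply, Pi.smul_apply, h1, smul_comm]

/-- Second quantization acts inside each sector, so it commutes with any weights depending on n
alone. Indicator weights give truncation and c n = n gives the photon number. -/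
theorem mem_graph_dGamma_weighted {ω : R3 → ℝ} {Ψ Θ Ψ' Θ' : Fock} (h : (Ψ, Θ) ∈ (dGamma ω).graph)
    {c : ℕ → ℂ} (hΨ : ∀ n, Ψ' n = c n • Ψ n) (hΘ : ∀ n, Θ' n = c n • Θ n) :
    (Ψ', Θ') ∈ (dGamma ω).graph := by
  rw [mem_graph_dGamma] at h ⊢
  intro n
  rw [hΨ, hΘ]
  exact sector_ae_smul (h n) (c n)

theorem truncate_eq_weighted (M : ℕ) (Ψ : Fock) (n : ℕ) :
    truncate M Ψ n = (if n < M then (1 : ℂ) else 0) • Ψ n := by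
  rw [truncate_apply]
  split_ifs
  · exact (one_smul ℂ _).symm
  · exact (zero_smul ℂ _).symm

theorem mem_graph_photonEnergy_truncate {h : ℝ} {Ψ Θ : Fock}
    (hΘ : (Ψ, Θ) ∈ (photonEnergy h).graph) (M : ℕ) :
    (truncate M Ψ, truncate M Θ) ∈ (photonEnergy h).graph := by
  obtain ⟨Φ, hΦ, rfl⟩ := mem_graph_smul.1 hΘ
  refine mem_graph_smul.2 ⟨truncate M Φ, mem_graph_dGamma_weighted hΦ (truncate_eq_weighted M Ψ)
    (truncate_eq_weighted M Φ), lp.ext (funext fun n => ?_)⟩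
  rw [lp.coeFn_smul, Pi.smul_apply, truncate_eq_weighted, truncate_eq_weighted, lp.coeFn_smul,
    Pi.smul_apply]
  exact smul_comm _ _ _

/-- The operator `B` maps states with finitely many photons to such states. -/
def PreservesFinite (B : Fock →ₗ.[ℂ] Fock) : Prop :=
  ∀ Ψ Φ, (Ψ, Φ) ∈ B.graph → FinitePhotons Ψ → FinitePhotons Φ

theorem preservesFinite_dGamma (ω : R3 → ℝ) : PreservesFinite (dGamma ω) := by
  rintro Ψ Φ h ⟨M, hM⟩
  refine ⟨M, fun n hn => sector_ext_ae ?_⟩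
  filter_upwards [mem_graph_dGamma.1 h n,
    Lp.coeFn_zero (Pol n) 2 (volume : Measure (Fin n → R3))] with k h1 h2
  rw [h1, hM n hn]
  exact (congrArg _ h2).trans ((smul_zero _).trans h2.symm)

theorem preservesFinite_segal (f : photon) : PreservesFinite (segal f) := by
  rintro Ψ Φ h ⟨M, hM⟩
  rw [mem_graph_segal] at h
  -- The creation part raises the photon number by one.
  refine ⟨M + 1, fun n hn => ?_⟩
  obtain ⟨n, rfl⟩ : ∃ m, n = m + 1 := ⟨n - 1, by omega⟩
  rw [h, segalComp, hM n (by omega), hM (n + 2) (by omega), map_zero, map_zero, add_zero,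
    smul_zero]

theorem PreservesFinite.smul {B : Fock →ₗ.[ℂ] Fock} (h : PreservesFinite B) (c : ℂ) :
    PreservesFinite (c • B) := by
  intro Ψ Φ hΦ hf
  obtain ⟨u, hu, rfl⟩ := mem_graph_smul.1 hΦ
  exact (h _ _ hu hf).smul c

theorem PreservesFinite.add {B C : Fock →ₗ.[ℂ] Fock} (hB : PreservesFinite B)
    (hC : PreservesFinite C) : PreservesFinite (B + C) := by
  intro Ψ Φ hΦ hf
  obtain ⟨u, v, hu, hv, rfl⟩ := mem_graph_add.1 hΦ
  exact (hB _ _ hu hf).add (hC _ _ hv hf)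

theorem preservesFinite_scalar (c : ℂ) :
    PreservesFinite (everywhere (c • (LinearMap.id : Fock →ₗ[ℂ] Fock))) := by
  intro Ψ Φ hΦ hf
  rw [mem_graph_everywhere.1 hΦ]
  exact hf.smul c

variable {N : ℕ}

/-- The same notion on the photon-spin space. -/
def PreservesFiniteSpin (B : Space N →ₗ.[ℂ] Space N) : Prop :=
  ∀ ψ φ : Space N, (ψ, φ) ∈ B.graph → (∀ s, FinitePhotons (ψ s)) → ∀ s, FinitePhotons (φ s)

theorem PreservesFinite.tensorI {B : Fock →ₗ.[ℂ] Fock} (h : PreservesFinite B) :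
    PreservesFiniteSpin (tensorI (N := N) B) := fun _ _ hφ hf s =>
  h _ _ (mem_graph_tensorI.1 hφ s) (hf s)

theorem PreservesFinite.tensor {B : Fock →ₗ.[ℂ] Fock} (h : PreservesFinite B)
    (S : Matrix (Fin N → Fin 2) (Fin N → Fin 2) ℂ) : PreservesFiniteSpin (tensor B S) := by
  intro ψ φ hφ hf s
  obtain ⟨u, h1, h2⟩ := mem_graph_tensor.1 hφ
  rw [h2]
  exact FinitePhotons.sum fun s' _ => (h _ _ (h1 s') (hf s')).smul _

theorem PreservesFiniteSpin.add {B C : Space N →ₗ.[ℂ] Space N} (hB : PreservesFiniteSpin B)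
    (hC : PreservesFiniteSpin C) : PreservesFiniteSpin (B + C) := by
  intro ψ φ hφ hf s
  obtain ⟨u, v, hu, hv, rfl⟩ := mem_graph_add.1 hφ
  exact (hB _ _ hu hf s).add (hC _ _ hv hf s)

theorem PreservesFiniteSpin.smul {B : Space N →ₗ.[ℂ] Space N} (hB : PreservesFiniteSpin B)
    (c : ℂ) : PreservesFiniteSpin (c • B) := by
  intro ψ φ hφ hf s
  obtain ⟨u, hu, rfl⟩ := mem_graph_smul.1 hφ
  exact (hB _ _ hu hf s).smul c

theorem PreservesFiniteSpin.sum {ι : Type*} {s : Finset ι} {B : ι → Space N →ₗ.[ℂ] Space N}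
    (h : ∀ i ∈ s, PreservesFiniteSpin (B i)) : PreservesFiniteSpin (∑ i ∈ s, B i) := by
  refine Finset.sum_induction B PreservesFiniteSpin (fun _ _ h1 h2 => h1.add h2) ?_ h
  intro ψ φ hφ _ s
  rw [mem_graph_zero.1 hφ]
  exact finitePhotons_zero

variable (χ : SchwartzMap ℝ ℂ) (x : Fin N → R3) (β : Fin 3 → ℝ) {h : ℝ}

theorem preservesFiniteSpin_hamiltonian (h : ℝ) : PreservesFiniteSpin (hamiltonian χ x β h) :=
  ((preservesFinite_dGamma _).smul _).tensorI.add
    ((PreservesFiniteSpin.sum fun _ _ => PreservesFiniteSpin.sum fun _ _ =>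
      ((preservesFinite_scalar _).add ((preservesFinite_segal _).smul _)).tensor _).smul _)

/-- Both products must be defined. H changes the number of photons by at most one, so Hψ stays in
D(N); and Nψ reweights finitely many sectors, so it stays in D(H). -/
theorem mem_domain_opComm {ψ η : Space N} (hη : (ψ, η) ∈ (hamiltonian χ x β h).graph)
    (hψ : ∀ s, FinitePhotons (ψ s)) :
    ψ ∈ (opComm (hamiltonian χ x β h) (tensorI photonNumber)).domain := by
  have h1 := preservesFiniteSpin_hamiltonian χ x β h ψ η hη hψ
  choose v hv using fun s => (h1 s).exists_number
  choose u hu using fun s => (hψ s).exists_number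
  -- Only the free energy has to be checked, since D(H) is the domain of the free operator.
  have h2 : (WithLp.toLp 2 u : Space N) ∈ (hamiltonian χ x β h).domain := by
    have h3 : ψ ∈ (hamiltonian χ x β h).domain := mem_domain_graph hη
    rw [domain_hamiltonian] at h3 ⊢
    intro s
    obtain ⟨θ, hθ⟩ := LinearPMap.mem_domain_iff.1 (h3 s)
    obtain ⟨Θ, hΘ, rfl⟩ := mem_graph_smul.1 hθ
    obtain ⟨M, hM⟩ := preservesFinite_dGamma _ _ _ hΘ (hψ s)
    obtain ⟨Φ, hΦ⟩ := exists_weighted Θ hM fun n => (n : ℂ)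
    exact mem_domain_graph (mem_graph_smul.2
      ⟨Φ, mem_graph_dGamma_weighted hΘ (mem_graph_photonNumber.1 (hu s)) hΦ, rfl⟩)
  obtain ⟨w, hw⟩ := LinearPMap.mem_domain_iff.1 h2
  exact mem_domain_graph (mem_graph_opComm.2 ⟨WithLp.toLp 2 u, η, w, WithLp.toLp 2 v,
    mem_graph_tensorI.2 hu, hw, hη, mem_graph_tensorI.2 hv, rfl⟩)

theorem tendsto_toLp_truncate (ψ : Space N) :
    Tendsto (fun M => (WithLp.toLp 2 fun s => truncate M (ψ s) : Space N)) atTop (𝓝 ψ) :=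
  ((PiLp.continuous_toLp 2 (fun _ : Fin N → Fin 2 => Fock)).tendsto ψ.ofLp).comp
    (tendsto_pi_nhds.2 fun s => tendsto_truncate (ψ s))

/-- Convergence in the graph norm of A already forces convergence of the B-images, so a core of A is
a core of A + B. -/
theorem GraphDense.add {E : Type*} [NormedAddCommGroup E] [InnerProductSpace ℂ E]
    {A B : E →ₗ.[ℂ] E} {D : Set E} (hD : GraphDense A D) (hB : InfinitesimallyBounded A B) :
    GraphDense (A + B) D := by
  obtain ⟨C, hC0, hC⟩ := hB.bound one_pos
  intro ψ η hη
  obtain ⟨a, b, ha, hb, rfl⟩ := mem_graph_add.1 hη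
  obtain ⟨u, v, huv, hu, hv⟩ := hD ψ a ha
  choose w hw using fun n => LinearPMap.mem_domain_iff.1
    (hB.domain_le (mem_domain_graph (huv n).1))
  refine ⟨u, fun n => v n + w n, fun n => ⟨mem_graph_add.2 ⟨_, _, (huv n).1, hw n, rfl⟩,
    (huv n).2⟩, hu, hv.add ?_⟩
  have h4 : ∀ n, ‖w n - b‖ ≤ 1 * ‖v n - a‖ + C * ‖u n - ψ‖ := fun n =>
    hC _ _ _ (A.graph.sub_mem (huv n).1 ha) (B.graph.sub_mem (hw n) hb)
  have h5 : Tendsto (fun n => 1 * ‖v n - a‖ + C * ‖u n - ψ‖) atTop (𝓝 0) := by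
    simpa using ((tendsto_iff_norm_sub_tendsto_zero.1 hv).const_mul 1).add
      ((tendsto_iff_norm_sub_tendsto_zero.1 hu).const_mul C)
  exact tendsto_iff_norm_sub_tendsto_zero.2 (squeeze_zero (fun n => norm_nonneg _) h4 h5)

theorem graphDense_finitePhotons (h : ℝ) :
    GraphDense (tensorI (photonEnergy h)) {ψ : Space N | ∀ s, FinitePhotons (ψ s)} := by
  intro ψ η hη
  exact ⟨fun M => WithLp.toLp 2 fun s => truncate M (ψ s),
    fun M => WithLp.toLp 2 fun s => truncate M (η s), fun M =>
    ⟨mem_graph_tensorI.2 fun s => mem_graph_photonEnergy_truncate (mem_graph_tensorI.1 hη s) M,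
      fun s => finitePhotons_truncate M (ψ s)⟩, tendsto_toLp_truncate ψ, tendsto_toLp_truncate η⟩

theorem graphDense_opComm (hh : 0 < h) : GraphDense (hamiltonian χ x β h)
    ((opComm (hamiltonian χ x β h) (tensorI photonNumber)).domain : Set (Space N)) := by
  intro ψ η hη
  obtain ⟨u, v, huv, hu, hv⟩ := (graphDense_finitePhotons h).add
    ((infinitesimallyBounded_interaction χ x β hh).smul _) ψ η hη
  exact ⟨u, v, fun n => ⟨(huv n).1, mem_domain_opComm χ x β (huv n).1 (huv n).2⟩, hu, hv⟩

end FinitelyMany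

/-! ## The commutator with the photon number -/

section Commutator

/-- `[B, dΓ(I)] = i T`, componentwise. -/
def NumberCommutator (B T : Fock →ₗ.[ℂ] Fock) : Prop :=
  ∀ Ψ U W W' Z, (Ψ, U) ∈ photonNumber.graph → (Ψ, W) ∈ B.graph → (U, W') ∈ B.graph →
    (Ψ, Z) ∈ T.graph → ∀ n, W' n - (n : ℂ) • W n = Complex.I • Z n

theorem commutator_add {V : Type*} [AddCommGroup V] [Module ℂ V] {a a' b b' z : V} {c : ℂ}
    (ha : a' - c • a = 0) (hb : b' - c • b = Complex.I • z) :
    (a' + b') - c • (a + b) = Complex.I • z := by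
  rw [← hb, smul_add, add_sub_add_comm, ha, zero_add]

theorem commutator_add_add {V : Type*} [AddCommGroup V] [Module ℂ V] {a a' b b' y z : V} {c : ℂ}
    (ha : a' - c • a = Complex.I • y) (hb : b' - c • b = Complex.I • z) :
    (a' + b') - c • (a + b) = Complex.I • (y + z) := by
  rw [smul_add Complex.I, ← hb, ← ha, smul_add, add_sub_add_comm]

theorem commutator_smul {V : Type*} [AddCommGroup V] [Module ℂ V] {a a' z : V} {c : ℂ} (d : ℂ)
    (ha : a' - c • a = Complex.I • z) : d • a' - c • (d • a) = Complex.I • (d • z) := by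
  rw [smul_comm c d, smul_comm Complex.I d, ← ha, smul_sub]

theorem commutator_lower {V : Type*} [AddCommGroup V] [Module ℂ V] (a : V) (d : ℂ) :
    d • (((1 : ℕ) : ℂ) • a) - ((0 : ℕ) : ℂ) • (d • a) =
      Complex.I • (d • ((starRingEnd ℂ) Complex.I • a)) := by
  simp only [smul_smul, ← sub_smul]
  congr 1
  rw [Complex.conj_I]
  push_cast
  linear_combination d * Complex.I_sq

/-- In sector n + 1 the annihilation part comes from n + 2 photons and the creation part from n, so
the commutator is a - b = i(ī a + i b). -/
theorem commutator_ladder {V : Type*} [AddCommGroup V] [Module ℂ V] (a b : V) (d : ℂ) (n : ℕ) :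
    d • (((n + 2 : ℕ) : ℂ) • a + (n : ℂ) • b) - ((n + 1 : ℕ) : ℂ) • (d • (a + b)) =
      Complex.I • (d • ((starRingEnd ℂ) Complex.I • a + Complex.I • b)) := by
  rw [Complex.conj_I]
  push_cast
  match_scalars
  · linear_combination d * Complex.I_sq
  · linear_combination -d * Complex.I_sq

/-- The coefficients ī and i of `commutator_ladder` are those acquired by a(f) and a*(f) when f is
replaced by if. The vacuum sector is separate because nothing is created into it. -/
theorem numberCommutator_segal (f : photon) :
    NumberCommutator (segal f) (segal (Complex.I • f)) := by
  intro Ψ U W W' Z hU hW hW' hZ n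
  rw [mem_graph_photonNumber] at hU
  rw [mem_graph_segal] at hW hW' hZ
  rw [hW, hW', hZ]
  cases n with
  | zero =>
    rw [segalComp, segalComp, segalComp, annihilate_smul_left, hU]
    have h1 : annihilate f 0 (((1 : ℕ) : ℂ) • Ψ 1) = ((1 : ℕ) : ℂ) • annihilate f 0 (Ψ 1) :=
      map_smul _ _ _
    rw [h1]
    exact commutator_lower _ _
  | succ n =>
    rw [segalComp, segalComp, segalComp, annihilate_smul_left, create_smul_left, hU, hU]
    have h1 : annihilate f (n + 1) (((n + 2 : ℕ) : ℂ) • Ψ (n + 2)) =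
      ((n + 2 : ℕ) : ℂ) • annihilate f (n + 1) (Ψ (n + 2)) := map_smul _ _ _
    have h2 : create f n ((n : ℂ) • Ψ n) = (n : ℂ) • create f n (Ψ n) := map_smul _ _ _
    rw [h1, h2]
    exact commutator_ladder _ _ _ _

theorem numberCommutator_dGamma (ω : R3 → ℝ) : NumberCommutator (dGamma ω) 0 := by
  intro Ψ U W W' Z hU hW hW' hZ n
  rw [mem_graph_zero.1 hZ]
  rw [mem_graph_photonNumber] at hU
  rw [mem_graph_dGamma] at hW hW'
  have h1 := sector_ae_smul (hW n) (n : ℂ)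
  have h2 := hW' n
  rw [hU] at h2
  have h3 : W' n = (n : ℂ) • W n := by
    refine sector_ext_ae ?_
    filter_upwards [h1, h2] with k h3 h4
    exact h4.trans h3.symm
  exact (sub_eq_zero.2 h3).trans (smul_zero Complex.I).symm

theorem numberCommutator_scalar (c : ℂ) :
    NumberCommutator (everywhere (c • (LinearMap.id : Fock →ₗ[ℂ] Fock))) 0 := by
  intro Ψ U W W' Z hU hW hW' hZ n
  rw [mem_graph_photonNumber] at hU
  have h1 : W n = c • Ψ n := by rw [mem_graph_everywhere.1 hW]; rfl
  have h2 : W' n = c • U n := by rw [mem_graph_everywhere.1 hW']; rfl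
  rw [mem_graph_zero.1 hZ, h1, h2, hU, sub_eq_zero.2 (smul_comm c (n : ℂ) (Ψ n))]
  exact (smul_zero Complex.I).symm

theorem NumberCommutator.smul {B T : Fock →ₗ.[ℂ] Fock} (h : NumberCommutator B T) (c : ℂ) :
    NumberCommutator (c • B) (c • T) := by
  intro Ψ U W W' Z hU hW hW' hZ n
  obtain ⟨w, hw, rfl⟩ := mem_graph_smul.1 hW
  obtain ⟨w', hw', rfl⟩ := mem_graph_smul.1 hW'
  obtain ⟨z, hz, rfl⟩ := mem_graph_smul.1 hZ
  exact commutator_smul c (h _ _ _ _ _ hU hw hw' hz n)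

/-- A sum may be split because the relation is componentwise: the images under A and B separately
need not lie in D(N), even if their sum does. -/
theorem NumberCommutator.zero_add {A B T : Fock →ₗ.[ℂ] Fock} (hA : NumberCommutator A 0)
    (hB : NumberCommutator B T) : NumberCommutator (A + B) T := by
  intro Ψ U W W' Z hU hW hW' hZ n
  obtain ⟨u, v, hu, hv, rfl⟩ := mem_graph_add.1 hW
  obtain ⟨u', v', hu', hv', rfl⟩ := mem_graph_add.1 hW'
  have h1 := hA _ _ _ _ 0 hU hu hu' (mem_graph_zero.2 rfl) n
  exact commutator_add (h1.trans (smul_zero Complex.I)) (hB _ _ _ _ _ hU hv hv' hZ n)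

variable {N : ℕ}

/-- `[B, dΓ(I) ⊗ I] = i T`, componentwise. -/
def NumberCommutatorSpin (B T : Space N →ₗ.[ℂ] Space N) : Prop :=
  ∀ ψ u w w' z : Space N, (ψ, u) ∈ (tensorI photonNumber).graph → (ψ, w) ∈ B.graph →
    (u, w') ∈ B.graph → (ψ, z) ∈ T.graph →
      ∀ s n, w' s n - (n : ℂ) • w s n = Complex.I • z s n

theorem NumberCommutator.tensorI {B : Fock →ₗ.[ℂ] Fock} (h : NumberCommutator B 0) :
    NumberCommutatorSpin (tensorI (N := N) B) 0 := by
  intro ψ u w w' z hu hw hw' hz s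
  rw [mem_graph_tensorI] at hu hw hw'
  rw [mem_graph_zero.1 hz]
  exact h _ _ _ _ 0 (hu s) (hw s) (hw' s) (mem_graph_zero.2 rfl)

theorem lp_sum_smul_apply {G : ℕ → Type*} [∀ n, NormedAddCommGroup (G n)]
    [∀ n, InnerProductSpace ℂ (G n)] {ι : Type*} (t : Finset ι) (c : ι → ℂ) (f : ι → lp G 2)
    (n : ℕ) : (∑ i ∈ t, c i • f i : lp G 2) n = ∑ i ∈ t, c i • f i n := by
  rw [lp.coeFn_sum, Finset.sum_apply]
  rfl

theorem commutator_sum {V : Type*} [AddCommGroup V] [Module ℂ V] {ι : Type*} {t : Finset ι}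
    {a a' z : ι → V} {c : ℂ} (d : ι → ℂ) (h : ∀ i, a' i - c • a i = Complex.I • z i) :
    ∑ i ∈ t, d i • a' i - c • ∑ i ∈ t, d i • a i = Complex.I • ∑ i ∈ t, d i • z i := by
  rw [Finset.smul_sum, Finset.smul_sum, ← Finset.sum_sub_distrib]
  exact Finset.sum_congr rfl fun i _ => commutator_smul (d i) (h i)

theorem NumberCommutator.tensor {B T : Fock →ₗ.[ℂ] Fock} (h : NumberCommutator B T)
    (S : Matrix (Fin N → Fin 2) (Fin N → Fin 2) ℂ) :
    NumberCommutatorSpin (tensor B S) (tensor T S) := by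
  intro ψ u w w' z hu hw hw' hz s n
  rw [mem_graph_tensorI] at hu
  obtain ⟨a, ha, hwa⟩ := mem_graph_tensor.1 hw
  obtain ⟨a', ha', hwa'⟩ := mem_graph_tensor.1 hw'
  obtain ⟨b, hb, hzb⟩ := mem_graph_tensor.1 hz
  rw [hwa, hwa', hzb, lp_sum_smul_apply, lp_sum_smul_apply, lp_sum_smul_apply]
  exact commutator_sum (S s) fun s' => h _ _ _ _ _ (hu s') (ha s') (ha' s') (hb s') n

theorem NumberCommutatorSpin.zero_add {A B T : Space N →ₗ.[ℂ] Space N}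
    (hA : NumberCommutatorSpin A 0) (hB : NumberCommutatorSpin B T) :
    NumberCommutatorSpin (A + B) T := by
  intro ψ u w w' z hu hw hw' hz s n
  obtain ⟨a, b, ha, hb, rfl⟩ := mem_graph_add.1 hw
  obtain ⟨a', b', ha', hb', rfl⟩ := mem_graph_add.1 hw'
  have h1 := hA _ _ _ _ 0 hu ha ha' (mem_graph_zero.2 rfl) s n
  exact commutator_add (h1.trans (smul_zero Complex.I)) (hB _ _ _ _ _ hu hb hb' hz s n)

theorem NumberCommutatorSpin.add {A B T T' : Space N →ₗ.[ℂ] Space N}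
    (hA : NumberCommutatorSpin A T) (hB : NumberCommutatorSpin B T') :
    NumberCommutatorSpin (A + B) (T + T') := by
  intro ψ u w w' z hu hw hw' hz s n
  obtain ⟨a, b, ha, hb, rfl⟩ := mem_graph_add.1 hw
  obtain ⟨a', b', ha', hb', rfl⟩ := mem_graph_add.1 hw'
  obtain ⟨y, y', hy, hy', rfl⟩ := mem_graph_add.1 hz
  exact commutator_add_add (hA _ _ _ _ _ hu ha ha' hy s n) (hB _ _ _ _ _ hu hb hb' hy' s n)

theorem NumberCommutatorSpin.smul {B T : Space N →ₗ.[ℂ] Space N} (h : NumberCommutatorSpin B T)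
    (c : ℂ) : NumberCommutatorSpin (c • B) (c • T) := by
  intro ψ u w w' z hu hw hw' hz s n
  obtain ⟨a, ha, rfl⟩ := mem_graph_smul.1 hw
  obtain ⟨a', ha', rfl⟩ := mem_graph_smul.1 hw'
  obtain ⟨y, hy, rfl⟩ := mem_graph_smul.1 hz
  exact commutator_smul c (h _ _ _ _ _ hu ha ha' hy s n)

theorem numberCommutatorSpin_zero : NumberCommutatorSpin (0 : Space N →ₗ.[ℂ] Space N) 0 := by
  intro ψ u w w' z _ hw hw' hz s n
  rw [mem_graph_zero.1 hw, mem_graph_zero.1 hw', mem_graph_zero.1 hz]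
  exact (sub_eq_zero.2 (smul_zero (n : ℂ)).symm).trans (smul_zero Complex.I).symm

theorem NumberCommutatorSpin.sum {ι : Type*} {t : Finset ι} {B T : ι → Space N →ₗ.[ℂ] Space N}
    (h : ∀ i ∈ t, NumberCommutatorSpin (B i) (T i)) :
    NumberCommutatorSpin (∑ i ∈ t, B i) (∑ i ∈ t, T i) := by
  classical
  induction t using Finset.induction_on with
  | empty =>
    rw [Finset.sum_empty, Finset.sum_empty]
    exact numberCommutatorSpin_zero
  | insert i t hi ih =>
    rw [Finset.sum_insert hi, Finset.sum_insert hi]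
    exact (h i (Finset.mem_insert_self i t)).add
      (ih fun j hj => h j (Finset.mem_insert_of_mem hj))

variable (χ : SchwartzMap ℝ ℂ) (x : Fin N → R3) (β : Fin 3 → ℝ) {h : ℝ}

theorem numberCommutator_magField (hh : 0 < h) (y : R3) (m : Fin 3) :
    NumberCommutator (magField χ h y m) (elecPol χ h y m) := by
  rw [elecPol_eq χ hh]
  exact (numberCommutator_segal _).smul _

/-- Only the magnetic field terms contribute. The free energy acts sector by sector, the constant
field is scalar, and the spin matrices do not touch the photon variables. -/
theorem numberCommutatorSpin_hamiltonian (hh : 0 < h) :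
    NumberCommutatorSpin (hamiltonian χ x β h)
      ((h : ℂ) • ∑ l, ∑ m, tensor (elecPol χ h (x l) m) (spin l m)) := by
  refine NumberCommutatorSpin.zero_add (NumberCommutator.tensorI ?_)
    ((NumberCommutatorSpin.sum fun l _ => NumberCommutatorSpin.sum fun m _ =>
      ((numberCommutator_scalar _).zero_add (numberCommutator_magField χ hh (x l) m)).tensor _).smul
        _)
  intro Ψ U W W' Z hU hW hW' hZ n
  have h1 := (numberCommutator_dGamma fun k => ‖k‖).smul (h : ℂ)
  exact h1 _ _ _ _ _ hU hW hW' (mem_graph_smul.2 ⟨0, mem_graph_zero.2 rfl,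
    (smul_zero _).trans (mem_graph_zero.1 hZ).symm⟩) n

theorem space_ext_apply {ψ θ : Space N} (h : ∀ s n, ψ s n = θ s n) : ψ = θ :=
  space_ext fun s => lp.ext (funext (h s))

/-- The commutator equals ih times the polarization sum, and (i/h)(ih) = -1. -/
theorem opComm_hamiltonian (hh : 0 < h) {ψ θ z : Space N}
    (hθ : (ψ, θ) ∈ (opComm (hamiltonian χ x β h) (tensorI photonNumber)).graph)
    (hz : (ψ, z) ∈ (∑ l, ∑ m, tensor (elecPol χ h (x l) m) (spin l m)).graph) :
    (Complex.I / h) • θ = -z := by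
  obtain ⟨u, v, u', v', h1, h2, h3, h4, rfl⟩ := mem_graph_opComm.1 hθ
  have h5 := numberCommutatorSpin_hamiltonian χ x β hh ψ u v u' _ h1 h3 h2
    (mem_graph_smul.2 ⟨z, hz, rfl⟩)
  have h6 : u' - v' = Complex.I • ((h : ℂ) • z) := by
    refine space_ext_apply fun s n => Eq.trans ?_ (h5 s n)
    exact congrArg (fun y => u' s n - y) (mem_graph_photonNumber.1 (mem_graph_tensorI.1 h4 s) n)
  have h7 : (Complex.I / h) * (Complex.I * h) = -1 := by
    have : (h : ℂ) ≠ 0 := Complex.ofReal_ne_zero.2 hh.ne'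
    field_simp
    exact Complex.I_sq
  rw [h6, smul_smul, smul_smul, mul_assoc, h7, neg_one_smul]

theorem infinitesimallyBounded_elecPol (hh : 0 < h) (y : R3) (m : Fin 3) :
    InfinitesimallyBounded (photonEnergy h) (elecPol χ h y m) := by
  rw [elecPol_eq χ hh]
  exact infinitesimallyBounded_segalH hh ((sqrtEnergyMul_magVec χ y m).smul _)

end Commutator

/-! ## The emission rate -/

section Emission

variable {N : ℕ} (χ : SchwartzMap ℝ ℂ) (x : Fin N → R3) (β : Fin 3 → ℝ) {h : ℝ} (t : ℝ)

/-- The sum of the operators `e^{i(t/h)H} (E_m^{pol}(x_l) ⊗ σ_m^{[l]}) e^{-i(t/h)H}`. -/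
def polarizationSum (h : ℝ) : Space N →ₗ.[ℂ] Space N :=
  ∑ l, ∑ m, heisenberg (hamiltonian χ x β h) h t (tensor (elecPol χ h (x l) m) (spin l m))

theorem graphBounded_polarizationSum (hh : 0 < h) :
    GraphBounded (hamiltonian χ x β h) (polarizationSum χ x β t h) :=
  GraphBounded.sum fun l _ => GraphBounded.sum fun m _ =>
    (graphBounded_hamiltonian χ x β hh
      ((infinitesimallyBounded_elecPol χ hh (x l) m).tensor (spin l m))).heisenberg
        (isUnitaryGroup_hamiltonian χ x β hh) h t

/-- The commutator identity is used at the evolved vector e^{-i(t/h)H}ψ. That vector is still in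
D(H), so each summand of the right-hand side is defined there, and the forward evolution distributes
over the sum. -/
theorem heisenberg_opComm_hamiltonian (hh : 0 < h) {ψ η θ : Space N}
    (hη : (ψ, η) ∈ (hamiltonian χ x β h).graph)
    (hθ : (ψ, θ) ∈ ((Complex.I / h) • heisenberg (hamiltonian χ x β h) h t
      (opComm (hamiltonian χ x β h) (tensorI photonNumber))).graph) :
    (ψ, θ) ∈ (-polarizationSum χ x β t h).graph := by
  obtain ⟨w, hw, rfl⟩ := mem_graph_smul.1 hθ
  obtain ⟨u, hu, rfl⟩ := mem_graph_heisenberg.1 hw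
  have hU := (isUnitaryGroup_hamiltonian χ x β hh).graph_mem (-(t / h)) hη
  have hex : ∀ l m, ∃ z, (expI (hamiltonian χ x β h) (-(t / h)) ψ, z) ∈
      (tensor (elecPol χ h (x l) m) (spin l m)).graph := fun l m =>
    LinearPMap.mem_domain_iff.1 ((graphBounded_hamiltonian χ x β hh
      ((infinitesimallyBounded_elecPol χ hh (x l) m).tensor (spin l m))).domain_le
        (mem_domain_graph hU))
  choose z hz using hex
  have h1 := opComm_hamiltonian χ x β hh hu
    (mem_graph_sum fun l _ => mem_graph_sum fun m _ => hz l m)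
  have h2 : (ψ, ∑ l, ∑ m, expI (hamiltonian χ x β h) (t / h) (z l m)) ∈
      (polarizationSum χ x β t h).graph :=
    mem_graph_sum fun l _ => mem_graph_sum fun m _ => mem_graph_heisenberg.2 ⟨_, hz l m, rfl⟩
  refine mem_graph_neg.2 ?_
  rw [← map_smul, h1, map_neg, neg_neg, map_sum]
  simp only [map_sum]
  exact h2

/-- All the hypotheses of `mem_graph_graphExtension` meet here: graph boundedness of the sum,
agreement on the commutator's domain, and density of the evolved core. -/
theorem mem_graph_emissionRate (hh : 0 < h) {ψ θ : Space N} :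
    (ψ, θ) ∈ (emissionRate χ x β h t).graph ↔ ∃ η, (ψ, η) ∈ (hamiltonian χ x β h).graph ∧
      (ψ, θ) ∈ (-polarizationSum χ x β t h).graph := by
  refine mem_graph_graphExtension (graphBounded_polarizationSum χ x β t hh).neg
    (fun _ _ _ h1 h2 => heisenberg_opComm_hamiltonian χ x β t hh h1 h2) ?_
  exact (graphDense_opComm χ x β hh).heisenberg (isUnitaryGroup_hamiltonian χ x β hh) h t

theorem domain_emissionRate (hh : 0 < h) :
    (emissionRate χ x β h t).domain = (hamiltonian χ x β h).domain := by
  refine le_antisymm (fun ψ hψ => ?_) (fun ψ hψ => ?_)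
  · obtain ⟨θ, hθ⟩ := LinearPMap.mem_domain_iff.1 hψ
    obtain ⟨η, hη, -⟩ := (mem_graph_emissionRate χ x β t hh).1 hθ
    exact mem_domain_graph hη
  · obtain ⟨η, hη⟩ := LinearPMap.mem_domain_iff.1 hψ
    obtain ⟨K, hK⟩ := (graphBounded_polarizationSum χ x β t hh).neg
    obtain ⟨θ, hθ, -⟩ := hK ψ η hη
    exact mem_domain_graph ((mem_graph_emissionRate χ x β t hh).2 ⟨η, hη, hθ⟩)

theorem emissionRate_le (hh : 0 < h) :
    emissionRate χ x β h t ≤ -polarizationSum χ x β t h :=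
  le_iff_graph.2 fun _ _ hθ => ((mem_graph_emissionRate χ x β t hh).1 hθ).choose_spec.2

theorem exists_norm_emissionRate_le (hh : 0 < h) : ∃ C : ℝ, ∀ (ψ θ η : Space N),
    (ψ, θ) ∈ (emissionRate χ x β h t).graph → (ψ, η) ∈ (hamiltonian χ x β h).graph →
      ‖θ‖ ≤ C * (‖ψ‖ + ‖η‖) := by
  obtain ⟨K, hK⟩ := (graphBounded_polarizationSum χ x β t hh).neg
  refine ⟨K, fun ψ θ η hθ hη => ?_⟩
  obtain ⟨θ', hθ', hb⟩ := hK ψ η hη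
  rwa [graph_unique (le_iff_graph.1 (emissionRate_le χ x β t hh) _ _ hθ) hθ']

/-- Termwise, E^pol ⊗ σ is contained in (E^pol ⊗ I)(I ⊗ σ), and the evolution of this product is
contained in the product of the evolutions. -/
theorem polarizationSum_le (hh : 0 < h) : polarizationSum χ x β t h ≤
    ∑ l, ∑ m, opComp (elecPolAt χ x β h t (x l) m) (spinAt χ x β h t l m) :=
  sum_le_sum_graph fun _ _ => sum_le_sum_graph fun _ _ =>
    (heisenberg_mono (tensor_le_opComp _ _)).trans
      (heisenberg_opComp (isUnitaryGroup_hamiltonian χ x β hh) h t)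

end Emission

end NMR

end

theorem lemmat5p1 (χ : SchwartzMap ℝ ℂ) {N : ℕ} (x : Fin N → NMR.R3) (β : Fin 3 → ℝ)
    (h : ℝ) (hh : 0 < h) (t : ℝ) :
    -- the objects are well defined: `H(h)` is self-adjoint, with the domain of the free operator
    IsSelfAdjoint (NMR.hamiltonian χ x β h) ∧
    (NMR.hamiltonian χ x β h).domain = (NMR.tensorI (N := N) (NMR.photonEnergy h)).domain ∧
    NMR.IsUnitaryGroup (NMR.hamiltonian χ x β h) (NMR.expI (NMR.hamiltonian χ x β h)) ∧
    -- `E_m^{pol}(y)` is the unique Segal field with the prescribed Wick symbol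
    (∀ (y : NMR.R3) (m : Fin 3),
      NMR.HasWickSymbol h (NMR.elecField χ h y m) (NMR.wickSymbol h (NMR.elecField χ h y m)) ∧
      NMR.HasWickSymbol h (NMR.elecPol χ h y m) (NMR.elecPolSymbol χ h y m) ∧
      ∃! V : NMR.photon,
        NMR.HasWickSymbol h (NMR.segalH h V) (NMR.elecPolSymbol χ h y m)) ∧
    -- `N'(t, h)` is a bounded operator from `D(H(h))` to the whole space
    (NMR.emissionRate χ x β h t).domain = (NMR.hamiltonian χ x β h).domain ∧
    (∃ C : ℝ, ∀ (ψ θ η : NMR.Space N), (ψ, θ) ∈ (NMR.emissionRate χ x β h t).graph →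
      (ψ, η) ∈ (NMR.hamiltonian χ x β h).graph → ‖θ‖ ≤ C * (‖ψ‖ + ‖η‖)) ∧
    -- the two formulas, the right-hand sides being defined on `D(H(h))`
    NMR.emissionRate χ x β h t ≤
      -∑ l : Fin N, ∑ m : Fin 3, NMR.heisenberg (NMR.hamiltonian χ x β h) h t
        (NMR.tensor (NMR.elecPol χ h (x l) m) (NMR.spin l m)) ∧
    NMR.emissionRate χ x β h t ≤
      -∑ l : Fin N, ∑ m : Fin 3,
        NMR.opComp (NMR.elecPolAt χ x β h t (x l) m) (NMR.spinAt χ x β h t l m) := by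
  exact ⟨NMR.isSelfAdjoint_hamiltonian χ x β hh, NMR.domain_hamiltonian χ x β h,
    NMR.isUnitaryGroup_hamiltonian χ x β hh, fun y m => ⟨NMR.hasWickSymbol_elecField χ hh y m, by
      rw [NMR.elecPol_eq χ hh]
      exact NMR.hasWickSymbol_elecPolSymbol χ hh y m,
      _, NMR.hasWickSymbol_elecPolSymbol χ hh y m, fun _ hV =>
        NMR.segalH_symbol_injective hh hV (NMR.hasWickSymbol_elecPolSymbol χ hh y m)⟩,
    NMR.domain_emissionRate χ x β t hh, NMR.exists_norm_emissionRate_le χ x β t hh,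
    NMR.emissionRate_le χ x β t hh, (NMR.emissionRate_le χ x β t hh).trans
      (NMR.neg_le_neg_graph (NMR.polarizationSum_le χ x β t hh))⟩
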